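/- Let $d>0$ and let $C\subset\Sigma_d$ be a real proper tetragonal curve in the Hirzebruch surface $\Sigma_d$, i.e. a reduced curve which, in affine coordinates $(x,y)$ in which the exceptional section is $\{y=\infty\}$ and the barycenter of each fiber of $C$ is at $y=0$, is given by $$f(x,y)=y^4+p(x)y^2+q(x)y+r(x)=0,\qquad p,q,r\in\mathbb R[x],\quad \deg p\le 2d,\ \deg q\le 3d,\ \deg r\le 4d.$$ Put $b_1:=p^2-4r$. For $x\in\mathbb R$ let $S_x\subset\mathbb C$ be the set of roots of $f(x,\cdot)$; the fiber over $x$ is singular if $|S_x|<4$. Over a nonsingular $x$, let $y_1,\dots,y_4$ be the points of $S_x$ ordered lexicographically by decreasing of $\operatorname{Re}y$ first and of $\operatorname{Im}y$ second. Let $I=[a,b]$, $a\le b$, be a real segment over which there are no singular fibers, and let $s\in\mathbb R$ be greater than the real parts of all points of $S_x$, $x\in I$. For $x\in I$ let $\pi(x):=\pi_1(\mathbb C\smallsetminus S_x,s)$ (the product $gh$ is $g$ followed by $h$), with its canonical geometric basis $\alpha_1,\dots,\alpha_4$: for small $\epsilon>0$, $\alpha_j$ starts at $s$, follows the segments from $s$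 to $s+1-i/\epsilon$, then to $y_j+1-i/\epsilon$, then to $y_j+\epsilon(\epsilon-i)$, makes one counterclockwise turn along the circle centered at $y_j$, and returns the same way (so that $\alpha_1\alpha_2\alpha_3\alpha_4$ is the class of a large counterclockwise circle). The fibration of the punctured affine fibers $\mathbb C\smallsetminus S_x$ over $I$, with the section $y=s$, has a monodromy isomorphism $\gamma\colon\pi(a)\to\pi(b)$ along $I$: it takes the class of a loop to the class of a loop if and only if the first loop can be carried to the second one by a continuous family of loops at $s$ in the punctured fibers over the points of $I$. Identify $\pi(a)$ and $\pi(b)$ with the free group on $\alpha_1,\dots,\alpha_4$ via their canonical bases and regard $\gamma$ as an automorphism of this group. Let automorphisms act from the right (so $\beta\gamma$ is $\beta$ followed by $\gamma$), and let $\sigma_i$, $i=1,2,3$, be the standard braids $\alpha_i\mapsto\alpha_i\alpha_{i+1}\alpha_i^{-1}$, $\alpha_{i+1}\mapsto\alpha_i$ (the other generators being fixed). Then the following holds. 1. If all four branches of $C$ over $I$ are real, then $\gamma=\mathrm{id}$. 2. Otherwise, one of the following two cases occurs. (a) Over each point of $I$ exactly two branches are real. Assume that the two non-real branches are $y_i,y_{i+1}$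 over $a$ and $y_j,y_{j+1}$ over $b$. Then $\gamma=\rho_i^{-1}\rho_j$, where $\rho_1:=1$, $\rho_2:=\sigma_2^{-1}\sigma_1$, $\rho_3:=\sigma_2^{-1}\sigma_1\cdot\sigma_3^{-1}\sigma_2$. In particular, a single crossing of a real branch with the pair contributes $\sigma_{i+1}^{-1}\sigma_i$ if the pair passes from the positions $(i,i+1)$ to $(i+1,i+2)$, and the inverse braid $\sigma_i^{-1}\sigma_{i+1}$ if it passes from $(i+1,i+2)$ to $(i,i+1)$. (b) Over each point of $I$ all four branches are non-real. Assume that neither end of $I$ is a root of $q$ at which $b_1>0$ (equivalently, the four branches over each end do not all have the same real part), or that $q$ vanishes identically. Then $\gamma=\tau^t$, where $\tau:=\sigma_2^{-1}\sigma_3\sigma_1^{-1}\sigma_2$ and the twist parameter $t\in\mathbb Z$ is the number of roots $x'\in I$ of $q$ such that $b_1(x')>0$ and $q$ changes sign at $x'$, each root contributing $+1$ or $-1$ depending on whether $q$ is increasing or decreasing at $x'$, respectively. -/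

import Mathlib

open Set Filter Topology Polynomial
open scoped unitInterval

noncomputable section

/-! ### Real proper tetragonal curves -/

/-- The polynomial `y ^ 4 + p(x) y ^ 2 + q(x) y + r(x)`, as a polynomial in `y` over `ℝ[x]`. -/
def reducedQuartic (p q r : ℝ[X]) : ℝ[X][X] :=
  X ^ 4 + C p * X ^ 2 + C q * X + C r

/-- A real proper tetragonal curve in the Hirzebruch surface `Σ_d`, `d > 0`: in affine coordinates
`(x, y)` in which the exceptional section is `y = ∞` and the zero section is `y = 0`, it is the
reduced curve `y ^ 4 + p(x) y ^ 2 + q(x) y + r(x) = 0`, the coefficient of `y ^ (4 - k)` being of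
degree at most `k d`. -/
structure RealTetragonalCurve (d : ℕ) where
  p : ℝ[X]
  q : ℝ[X]
  r : ℝ[X]
  d_pos : 0 < d
  natDegree_p_le : p.natDegree ≤ 2 * d
  natDegree_q_le : q.natDegree ≤ 3 * d
  natDegree_r_le : r.natDegree ≤ 4 * d
  reduced : Squarefree (reducedQuartic p q r)

namespace RealTetragonalCurve

variable {d : ℕ}

/-- The linear coefficient `b₁ = p ^ 2 - 4 r` of the modified cubic resolvent
`y ^ 3 - 2 p y ^ 2 + b₁ y + q ^ 2`. -/
def b₁ (K : RealTetragonalCurve d) : ℝ[X] := K.p ^ 2 - 4 * K.r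

/-- The restriction of the equation of the curve to the fiber over the real point `x`, with complex
coefficients. -/
def fiberPoly (K : RealTetragonalCurve d) (x : ℝ) : ℂ[X] :=
  ((reducedQuartic K.p K.q K.r).map (evalRingHom x)).map (algebraMap ℝ ℂ)

/-- The points of the curve in the affine fiber (a copy of `ℂ`) over the real point `x`. -/
def points (K : RealTetragonalCurve d) (x : ℝ) : Set ℂ :=
  {z | (K.fiberPoly x).eval z = 0}

/-- A fiber is singular if it contains fewer than four points of the curve. -/
def IsSingularFiber (K : RealTetragonalCurve d) (x : ℝ) : Prop :=
  (K.points x).ncard < 4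

/-- All branches over `x` are real. -/
def AllReal (K : RealTetragonalCurve d) (x : ℝ) : Prop :=
  ∀ z ∈ K.points x, z.im = 0

/-- Exactly two branches over `x` are real. -/
def TwoReal (K : RealTetragonalCurve d) (x : ℝ) : Prop :=
  {z ∈ K.points x | z.im = 0}.ncard = 2

/-- All branches over `x` are non-real. -/
def NoneReal (K : RealTetragonalCurve d) (x : ℝ) : Prop :=
  ∀ z ∈ K.points x, z.im ≠ 0

/-- The twist parameter of the segment `[a, b]`: the number of roots of `q` in `[a, b]` with
`b₁ > 0` at which `q` changes sign, each counted with `+1` if `q` increases (from negative to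
positive) and with `-1` if `q` decreases (from positive to negative). -/
def twist (K : RealTetragonalCurve d) (a b : ℝ) : ℤ :=
  ({x ∈ Icc a b | K.q.eval x = 0 ∧ 0 < K.b₁.eval x ∧
      (∀ᶠ u in 𝓝[<] x, K.q.eval u < 0) ∧ (∀ᶠ u in 𝓝[>] x, 0 < K.q.eval u)}.ncard : ℤ) -
  ({x ∈ Icc a b | K.q.eval x = 0 ∧ 0 < K.b₁.eval x ∧
      (∀ᶠ u in 𝓝[<] x, 0 < K.q.eval u) ∧ (∀ᶠ u in 𝓝[>] x, K.q.eval u < 0)}.ncard : ℤ)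

end RealTetragonalCurve

/-! ### The canonical basis -/

/-- `y` lists the elements of `S`, which are four in number, lexicographically, by decreasing of the
real part first and of the imaginary part second. -/
def IsLexOrdering (S : Set ℂ) (y : Fin 4 → ℂ) : Prop :=
  range y = S ∧
    ∀ i j, i < j → (y j).re < (y i).re ∨ ((y j).re = (y i).re ∧ (y j).im < (y i).im)

/-- The circle around `w` of radius `ε * |ε - i|`, counterclockwise, from `w + ε (ε - i)`. -/
def circlePath (w : ℂ) (ε : ℝ) :
    Path (w + ε * (ε - Complex.I)) (w + ε * (ε - Complex.I)) where
  toFun t := w + ε * (ε - Complex.I) * Complex.exp (2 * Real.pi * Complex.I * ((t : ℝ) : ℂ))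
  continuous_toFun := by fun_prop
  source' := by simp
  target' := by simp

/-- The path from `s` to a point near `w` that first descends to a large depth, then goes parallel
to the segment from `s` to `w` until it is below `w`, and then ascends. The directions of descent
and ascent are slightly tilted from the vertical (by the vector `ε - i`), so that of two points on a
vertical line the lower one is left on the left. -/
def tailPath (s : ℝ) (w : ℂ) (ε : ℝ) : Path (s : ℂ) (w + ε * (ε - Complex.I)) :=
  ((Path.segment (s : ℂ) (s + (1 - Complex.I / ε))).trans
    (Path.segment (s + (1 - Complex.I / ε)) (w + (1 - Complex.I / ε)))).trans
    (Path.segment (w + (1 - Complex.I / ε)) (w + ε * (ε - Complex.I)))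

/-- The loop at `s` around `w`: the tail, the small counterclockwise circle, and the tail back. -/
def lasso (s : ℝ) (w : ℂ) (ε : ℝ) : Path (s : ℂ) (s : ℂ) :=
  ((tailPath s w ε).trans (circlePath w ε)).trans (tailPath s w ε).symm

lemma eventually_notMem_range_lasso {s : ℝ} {w v : ℂ} (hv : v.re < s)
    (hvw : v = w ∨ v.re ≠ w.re ∨ (v.re = w.re ∧ v.im ≠ w.im)) :
    ∀ᶠ ε : ℝ in 𝓝[>] 0, v ∉ range (lasso s w ε) := by
  have h1 : ∀ᶠ ε : ℝ in 𝓝[>] 0, v.re + ε * v.im < s := by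
    have : Tendsto (fun ε : ℝ => v.re + ε * v.im) (𝓝 0) (𝓝 (v.re + 0 * v.im)) :=
      Continuous.tendsto (by fun_prop) 0
    exact (this.eventually_lt_const (by simpa using hv)).filter_mono nhdsWithin_le_nhds
  have h2 : ∀ c : ℝ, ∀ᶠ ε : ℝ in 𝓝[>] 0, ε * c < 1 := by
    intro c
    have : Tendsto (fun ε : ℝ => ε * c) (𝓝 0) (𝓝 (0 * c)) :=
      Continuous.tendsto (by fun_prop) 0
    exact (this.eventually_lt_const (by simp)).filter_mono nhdsWithin_le_nhds
  have h3 : ∀ᶠ ε : ℝ in 𝓝[>] 0, v = w ∨ v.re + ε * v.im ≠ w.re + ε * w.im := by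
    rcases hvw with h | h | ⟨h, h'⟩
    · exact Eventually.of_forall fun _ => Or.inl h
    · have : Tendsto (fun ε : ℝ => (v.re + ε * v.im) - (w.re + ε * w.im)) (𝓝 0)
          (𝓝 ((v.re + 0 * v.im) - (w.re + 0 * w.im))) :=
        Continuous.tendsto (by fun_prop) 0
      have h4 := this.eventually_ne (b₂ := 0) (by simpa [sub_eq_zero] using h)
      filter_upwards [h4.filter_mono nhdsWithin_le_nhds] with ε hε
      exact Or.inr fun h5 => hε (by rw [h5, sub_self])
    · filter_upwards [self_mem_nhdsWithin] with ε hε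
      refine Or.inr fun h5 => h' ?_
      rw [h] at h5
      exact mul_left_cancel₀ (ne_of_gt hε) (add_left_cancel h5)
  have h4 : ∀ᶠ ε : ℝ in 𝓝[>] 0, v = w ∨ ‖(ε : ℂ) * (ε - Complex.I)‖ < ‖v - w‖ := by
    by_cases h : v = w
    · exact Eventually.of_forall fun _ => Or.inl h
    · have : Tendsto (fun ε : ℝ => ‖(ε : ℂ) * (ε - Complex.I)‖) (𝓝 0)
          (𝓝 ‖((0 : ℝ) : ℂ) * ((0 : ℝ) - Complex.I)‖) :=
        Continuous.tendsto (by fun_prop) 0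
      have h6 := this.eventually_lt_const (u := ‖v - w‖) (by simpa [sub_eq_zero] using h)
      exact (h6.filter_mono nhdsWithin_le_nhds).mono fun _ => Or.inr
  filter_upwards [self_mem_nhdsWithin, h1, h2 (-v.im), h2 (w.im - v.im), h3, h4]
    with ε hε e1 e2 e2' e3 e4
  have hε0 : (0 : ℝ) < ε := hε
  have hI : Complex.I / (ε : ℂ) = ((1 / ε : ℝ) : ℂ) * Complex.I := by
    push_cast; ring
  have hc1 : v ∉ range (circlePath w ε) := by
    rintro ⟨t, ht⟩
    have hn : ‖v - w‖ = ‖(ε : ℂ) * (ε - Complex.I)‖ := by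
      rw [← ht]
      simp only [circlePath, Path.coe_mk_mk, add_sub_cancel_left]
      rw [norm_mul, show (2 * Real.pi * Complex.I * ((t : ℝ) : ℂ)) =
        ((2 * Real.pi * (t : ℝ) : ℝ) : ℂ) * Complex.I by push_cast; ring,
        Complex.norm_exp_ofReal_mul_I, mul_one]
    rcases e4 with rfl | e4
    · have h7 : (ε : ℂ) * (ε - Complex.I) = 0 := by simpa using hn.symm
      rcases mul_eq_zero.1 h7 with h8 | h8
      · exact hε0.ne' (by exact_mod_cast h8)
      · have := congrArg Complex.im h8
        simp at this
    · exact absurd hn e4.ne'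
  have hc2 : v ∉ range (tailPath s w ε) := by
    simp only [tailPath, Path.trans_range, mem_union, not_or]
    refine ⟨⟨?_, ?_⟩, ?_⟩
    · rintro ⟨t, ht⟩
      have hre := congrArg Complex.re ht
      have him := congrArg Complex.im ht
      simp only [Path.segment_apply, AffineMap.lineMap_apply, hI] at hre him
      simp at hre him
      have : v.re + ε * v.im = s := by
        rw [← hre, ← him]; field_simp; ring
      exact absurd this e1.ne
    · rintro ⟨t, ht⟩
      have him := congrArg Complex.im ht
      simp only [Path.segment_apply, AffineMap.lineMap_apply, hI] at him
      simp at him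
      have ht0 := t.2.1
      have ht1 := t.2.2
      have h8 : ε * v.im = ε * ((t : ℝ) * w.im) - 1 := by
        rw [← him]; field_simp; ring
      have h9 : (1 - (t : ℝ)) * (ε * -v.im) + (t : ℝ) * (ε * (w.im - v.im)) = 1 := by
        linear_combination -h8
      rcases ht0.eq_or_lt with h | h
      · rw [← h] at h9
        linarith
      · nlinarith [mul_le_mul_of_nonneg_left e2.le (sub_nonneg.2 ht1),
          mul_lt_mul_of_pos_left e2' h]
    · rintro ⟨t, ht⟩
      have hre := congrArg Complex.re ht
      have him := congrArg Complex.im ht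
      simp only [Path.segment_apply, AffineMap.lineMap_apply, hI] at hre him
      simp at hre him
      have ht0 := t.2.1
      have ht1 := t.2.2
      rcases e3 with rfl | e3
      · have h8 : (1 - (t : ℝ)) + (t : ℝ) * (ε * ε) = 0 := by linear_combination hre
        rcases ht0.eq_or_lt with h | h
        · rw [← h] at h8
          norm_num at h8
        · have := mul_pos h (mul_pos hε0 hε0)
          linarith
      · refine e3 ?_
        rw [← hre, ← him]; field_simp; ring
  simp only [lasso, Path.trans_range, Path.symm_range, mem_union, not_or]
  exact ⟨⟨hc2, hc1⟩, hc2⟩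

/-- All sufficiently small lassos avoid the given points. -/
lemma exists_lasso_scale {S : Set ℂ} {y : Fin 4 → ℂ} (hy : IsLexOrdering S y) {s : ℝ}
    (hs : ∀ z ∈ S, z.re < s) (j : Fin 4) :
    ∃ ε₀ : ℝ, 0 < ε₀ ∧ ∀ ε : ℝ, 0 < ε → ε ≤ ε₀ → ∀ t, lasso s (y j) ε t ∈ Sᶜ := by
  have h : ∀ᶠ ε : ℝ in 𝓝[>] 0, ∀ k, y k ∉ range (lasso s (y j) ε) := by
    rw [eventually_all]
    intro k
    refine eventually_notMem_range_lasso (hs _ (hy.1 ▸ mem_range_self k)) ?_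
    rcases lt_trichotomy k j with h | h | h
    · rcases hy.2 _ _ h with h' | h'
      · exact Or.inr (Or.inl h'.ne')
      · exact Or.inr (Or.inr ⟨h'.1.symm, h'.2.ne'⟩)
    · exact Or.inl (by rw [h])
    · rcases hy.2 _ _ h with h' | h'
      · exact Or.inr (Or.inl h'.ne)
      · exact Or.inr (Or.inr ⟨h'.1, h'.2.ne⟩)
  obtain ⟨u, hu, hsub⟩ := (mem_nhdsGT_iff_exists_Ioc_subset).1 h
  refine ⟨u, hu, fun ε h0 h1 t ht => ?_⟩
  rw [← hy.1] at ht
  obtain ⟨k, hk⟩ := ht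
  exact hsub ⟨h0, h1⟩ k ⟨t, hk.symm⟩

/-- The base point `s` of the punctured fiber `ℂ ∖ S`, to the right of `S`. -/
def basePoint {S : Set ℂ} {s : ℝ} (hs : ∀ z ∈ S, z.re < s) : ↥(Sᶜ) :=
  ⟨(s : ℂ), fun h => lt_irrefl s (by simpa using hs _ h)⟩

/-- The fundamental group `π₁(ℂ ∖ S, s)`. Mathlib multiplies loops from right to left; the opposite
group is taken, so that `g * h` is `g` followed by `h`. -/
abbrev FiberGroup {S : Set ℂ} {s : ℝ} (hs : ∀ z ∈ S, z.re < s) : Type :=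
  (FundamentalGroup ↥(Sᶜ) (basePoint hs))ᵐᵒᵖ

/-- The class of a loop. -/
def loopClass {S : Set ℂ} {s : ℝ} (hs : ∀ z ∈ S, z.re < s)
    (ℓ : Path (basePoint hs) (basePoint hs)) : FiberGroup hs :=
  MulOpposite.op (FundamentalGroup.fromPath (Path.Homotopic.Quotient.mk ℓ))

/-- The lasso of a small size, as a loop in the punctured fiber; all loops obtained from smaller
sizes are homotopic to it. -/
def canonicalLoop {S : Set ℂ} {y : Fin 4 → ℂ} (hy : IsLexOrdering S y) {s : ℝ}
    (hs : ∀ z ∈ S, z.re < s) (j : Fin 4) : Path (basePoint hs) (basePoint hs) where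
  toFun t := ⟨lasso s (y j) (exists_lasso_scale hy hs j).choose t,
    (exists_lasso_scale hy hs j).choose_spec.2 _ (exists_lasso_scale hy hs j).choose_spec.1
      le_rfl t⟩
  continuous_toFun := by fun_prop
  source' := Subtype.ext (Path.source _)
  target' := Subtype.ext (Path.target _)

/-- The canonical geometric basis `α₁, …, α₄` of `π₁(ℂ ∖ S, s)`, as the homomorphism from the free
group on four generators. -/
def canonicalBasis {S : Set ℂ} {y : Fin 4 → ℂ} (hy : IsLexOrdering S y) {s : ℝ}
    (hs : ∀ z ∈ S, z.re < s) : FreeGroup (Fin 4) →* FiberGroup hs :=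
  FreeGroup.lift fun j => loopClass hs (canonicalLoop hy hs j)

/-! ### Monodromy along a segment -/

/-- The loop `ℓ` in the punctured fiber over `a` is carried to the loop `ℓ'` in the punctured fiber
over `b` by a continuous family of loops, based at the constant section `s`, in the punctured
fibers over the points of the segment from `a` to `b`. -/
def CarriedTo (S : ℝ → Set ℂ) {a b s : ℝ} {ha : ∀ z ∈ S a, z.re < s} {hb : ∀ z ∈ S b, z.re < s}
    (ℓ : Path (basePoint ha) (basePoint ha)) (ℓ' : Path (basePoint hb) (basePoint hb)) : Prop :=
  ∃ H : I × I → ℂ, Continuous H ∧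
    (∀ u t : I, H (u, t) ∉ S (a + (u : ℝ) * (b - a))) ∧
    (∀ t : I, H (0, t) = ℓ t) ∧ (∀ t : I, H (1, t) = ℓ' t) ∧
    (∀ u : I, H (u, 0) = s ∧ H (u, 1) = s)

/-- `μ` is the monodromy isomorphism along the segment from `a` to `b` of the family of punctured
fibers `ℂ ∖ S x`. At most one `μ` has this property. -/
def IsMonodromy (S : ℝ → Set ℂ) {a b s : ℝ} (ha : ∀ z ∈ S a, z.re < s) (hb : ∀ z ∈ S b, z.re < s)
    (μ : FiberGroup ha ≃* FiberGroup hb) : Prop :=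
  ∀ (ℓ : Path (basePoint ha) (basePoint ha)) (ℓ' : Path (basePoint hb) (basePoint hb)),
    μ (loopClass ha ℓ) = loopClass hb ℓ' ↔ CarriedTo S ℓ ℓ'

/-- Automorphisms of the free group on `α₁, …, α₄` (indexed from `0`), with the multiplication of
right actions: `β * γ` is `β` followed by `γ`. -/
abbrev FreeAut : Type := (MulAut (FreeGroup (Fin 4)))ᵐᵒᵖ

/-- The monodromy isomorphism along the segment from `a` to `b` exists, and it is the automorphism
`β` when the groups of the fibers over `a` and `b` are identified with the free group by means of
their canonical bases. -/
def HasMonodromy (S : ℝ → Set ℂ) {a b s : ℝ} (ha : ∀ z ∈ S a, z.re < s) (hb : ∀ z ∈ S b, z.re < s)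
    {y y' : Fin 4 → ℂ} (hy : IsLexOrdering (S a) y) (hy' : IsLexOrdering (S b) y')
    (β : FreeAut) : Prop :=
  ∃ μ : FiberGroup ha ≃* FiberGroup hb, IsMonodromy S ha hb μ ∧
    ∀ w : FreeGroup (Fin 4), μ (canonicalBasis hy ha w) = canonicalBasis hy' hb (β.unop w)

/-! ### Braids -/

/-- The homomorphism `α_i ↦ α_i α_{i+1} α_i⁻¹`, `α_{i+1} ↦ α_i`. -/
def sigmaHom (i : Fin 3) : FreeGroup (Fin 4) →* FreeGroup (Fin 4) :=
  FreeGroup.lift fun k =>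
    if k = i.castSucc then
      FreeGroup.of i.castSucc * FreeGroup.of i.succ * (FreeGroup.of i.castSucc)⁻¹
    else if k = i.succ then FreeGroup.of i.castSucc
    else FreeGroup.of k

/-- The inverse homomorphism `α_i ↦ α_{i+1}`, `α_{i+1} ↦ α_{i+1}⁻¹ α_i α_{i+1}`. -/
def sigmaInvHom (i : Fin 3) : FreeGroup (Fin 4) →* FreeGroup (Fin 4) :=
  FreeGroup.lift fun k =>
    if k = i.castSucc then FreeGroup.of i.succ
    else if k = i.succ then
      (FreeGroup.of i.succ)⁻¹ * FreeGroup.of i.castSucc * FreeGroup.of i.succ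
    else FreeGroup.of k

/-- The standard generators of Artin's braid group on four strands: `σ₁ = sigma 0`,
`σ₂ = sigma 1`, `σ₃ = sigma 2`. -/
def sigma (i : Fin 3) : FreeAut :=
  MulOpposite.op <| MonoidHom.toMulEquiv (sigmaHom i) (sigmaInvHom i)
    (by
      ext k
      have h : i.succ ≠ i.castSucc := i.castSucc_lt_succ.ne'
      by_cases h1 : k = i.castSucc
      · simp [sigmaHom, sigmaInvHom, h1, h, mul_assoc]
      · by_cases h2 : k = i.succ <;> simp [sigmaHom, sigmaInvHom, h1, h2, h])
    (by
      ext k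
      have h : i.succ ≠ i.castSucc := i.castSucc_lt_succ.ne'
      by_cases h1 : k = i.castSucc
      · simp [sigmaHom, sigmaInvHom, h1, h]
      · by_cases h2 : k = i.succ <;> simp [sigmaHom, sigmaInvHom, h1, h2, h, mul_assoc])

/-- `τ = σ₂⁻¹ σ₃ σ₁⁻¹ σ₂`. -/
def tau : FreeAut := (sigma 1)⁻¹ * sigma 2 * (sigma 0)⁻¹ * sigma 1

/-- The braid that moves a pair of complex conjugate branches from the first two positions to the
positions `j`, `j + 1` (from `0`), each real branch that it crosses contributing
`σ_{i+1}⁻¹ σ_i` if the pair moves from `(i, i + 1)` to `(i + 1, i + 2)`. -/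
def pairBraid : Fin 3 → FreeAut
  | 0 => 1
  | 1 => (sigma 1)⁻¹ * sigma 0
  | 2 => (sigma 1)⁻¹ * sigma 0 * ((sigma 2)⁻¹ * sigma 1)

/-- The `i`-th and `(i + 1)`-st points are non-real and conjugate to each other. -/
def IsConjugatePair (y : Fin 4 → ℂ) (i : Fin 3) : Prop :=
  (y i.castSucc).im ≠ 0 ∧ y i.succ = (starRingEnd ℂ) (y i.castSucc)

end

noncomputable section

/-! ### Paths in simply connected sets -/

/-- A path with values in a set, as a path in this set. -/
def Path.intoSet {X : Type*} [TopologicalSpace X] {A : Set X} {x y : X} (p : Path x y)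
    (h : ∀ t, p t ∈ A) (hx : x ∈ A) (hy : y ∈ A) : Path (⟨x, hx⟩ : A) ⟨y, hy⟩ where
  toFun t := ⟨p t, h t⟩
  continuous_toFun := by fun_prop
  source' := Subtype.ext p.source
  target' := Subtype.ext p.target

section SimplyConnectedSets

variable {X : Type*} [TopologicalSpace X] {A B : Set X} {x y z : X}

lemma IsSimplyConnected.homotopic (hA : IsSimplyConnected A) (p q : Path x y)
    (hp : ∀ t, p t ∈ A) (hq : ∀ t, q t ∈ A) : p.Homotopic q := by
  have hx : x ∈ A := p.source ▸ hp 0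
  have hy : y ∈ A := p.target ▸ hp 1
  have := hA.simplyConnectedSpace
  exact (SimplyConnectedSpace.paths_homotopic (p.intoSet hp hx hy) (q.intoSet hq hx hy)).map
    ⟨Subtype.val, continuous_subtype_val⟩

lemma IsSimplyConnected.joinedIn (hA : IsSimplyConnected A) (hx : x ∈ A) (hy : y ∈ A) :
    JoinedIn A x y :=
  hA.isPathConnected.joinedIn x hx y hy

/-- The class of the paths from `x` to `y` in a simply connected set. -/
def pathClassIn (hA : IsSimplyConnected A) (hx : x ∈ A) (hy : y ∈ A) :
    Path.Homotopic.Quotient x y :=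
  .mk (hA.joinedIn hx hy).somePath

lemma mk_eq_pathClassIn (hA : IsSimplyConnected A) (p : Path x y) (hp : ∀ t, p t ∈ A)
    (hx : x ∈ A) (hy : y ∈ A) : .mk p = pathClassIn hA hx hy :=
  Path.Homotopic.Quotient.eq.2 (hA.homotopic _ _ hp (hA.joinedIn hx hy).somePath_mem)

lemma pathClassIn_trans (hA : IsSimplyConnected A) (hx : x ∈ A) (hy : y ∈ A) (hz : z ∈ A) :
    (pathClassIn hA hx hy).trans (pathClassIn hA hy hz) = pathClassIn hA hx hz := by
  rw [pathClassIn, pathClassIn, ← Path.Homotopic.Quotient.mk_trans]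
  refine mk_eq_pathClassIn hA _ (fun t => ?_) hx hz
  have : ((hA.joinedIn hx hy).somePath.trans (hA.joinedIn hy hz).somePath) t ∈
      range ((hA.joinedIn hx hy).somePath.trans (hA.joinedIn hy hz).somePath) := mem_range_self t
  rw [Path.trans_range] at this
  rcases this with ⟨u, hu⟩ | ⟨u, hu⟩
  · exact hu ▸ (hA.joinedIn hx hy).somePath_mem u
  · exact hu ▸ (hA.joinedIn hy hz).somePath_mem u

lemma pathClassIn_symm (hA : IsSimplyConnected A) (hx : x ∈ A) (hy : y ∈ A) :
    (pathClassIn hA hx hy).symm = pathClassIn hA hy hx := by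
  rw [pathClassIn, ← Path.Homotopic.Quotient.mk_symm]
  exact mk_eq_pathClassIn hA (hA.joinedIn hx hy).somePath.symm
    (fun t => (hA.joinedIn hx hy).somePath_mem _) hy hx

lemma pathClassIn_congr (hA : IsSimplyConnected A) (hB : IsSimplyConnected B)
    (h : JoinedIn (A ∩ B) x y) (hx : x ∈ A) (hy : y ∈ A) (hx' : x ∈ B) (hy' : y ∈ B) :
    pathClassIn hA hx hy = pathClassIn hB hx' hy' := by
  rw [← mk_eq_pathClassIn hA h.somePath (fun t => (h.somePath_mem t).1) hx hy,
    ← mk_eq_pathClassIn hB h.somePath (fun t => (h.somePath_mem t).2) hx' hy']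

end SimplyConnectedSets

/-! ### Complements of slits -/

/-- The real part of a point, measured along the lines with direction `ε - i`. -/
def tilt (ε : ℝ) (z : ℂ) : ℝ := z.re + ε * z.im

/-- The point over `x` on the tilted graph of the function `g`. -/
def graphPoint (ε : ℝ) (g : ℝ → ℝ) (x : ℝ) : ℂ := ⟨x - ε * g x, g x⟩

@[simp] lemma tilt_graphPoint (ε : ℝ) (g : ℝ → ℝ) (x : ℝ) : tilt ε (graphPoint ε g x) = x := by
  simp [tilt, graphPoint]

@[simp] lemma graphPoint_im (ε : ℝ) (g : ℝ → ℝ) (x : ℝ) : (graphPoint ε g x).im = g x := rfl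

@[fun_prop]
lemma continuous_tilt (ε : ℝ) : Continuous (tilt ε) := by unfold tilt; fun_prop

lemma Continuous.complex_mk {X : Type*} [TopologicalSpace X] {f g : X → ℝ} (hf : Continuous f)
    (hg : Continuous g) : Continuous fun x => (⟨f x, g x⟩ : ℂ) :=
  Complex.equivRealProdCLM.symm.continuous.comp (hf.prodMk hg)

/-- The union of the graph of `g` and the complement of the vertical lines through the points of
`S`, together with the half-lines that lie over or under these points like the graph. -/
def slitRegion (S : Set ℂ) (ε : ℝ) (g : ℝ → ℝ) : Set ℂ :=
  {z | ∀ v ∈ S, tilt ε z = tilt ε v → 0 < (z.im - v.im) * (g (tilt ε v) - v.im)}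

/-- The graph of `g` over the segment between `l` and `s`, with its ends on the real axis, is
disjoint from `S`. -/
structure Separates (S : Set ℂ) (ε s l : ℝ) (g : ℝ → ℝ) : Prop where
  continuous : Continuous g
  right : g s = 0
  left : g l = 0
  ne : ∀ v ∈ S, g (tilt ε v) ≠ v.im

section Slits

variable {S : Set ℂ} {ε s l : ℝ} {g g' : ℝ → ℝ}

lemma slitRegion_subset_compl : slitRegion S ε g ⊆ Sᶜ := fun z hz h => by
  simpa using hz z h rfl

lemma graphPoint_mem_slitRegion (hg : ∀ v ∈ S, g (tilt ε v) ≠ v.im) (x : ℝ) :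
    graphPoint ε g x ∈ slitRegion S ε g := by
  intro v hv h
  rw [tilt_graphPoint] at h
  rw [graphPoint_im, h]
  exact mul_self_pos.2 (sub_ne_zero.2 (hg v hv))

lemma isSimplyConnected_slitRegion (hc : Continuous g) (hg : ∀ v ∈ S, g (tilt ε v) ≠ v.im) :
    IsSimplyConnected (slitRegion S ε g) := by
  let toR : C(slitRegion S ε g, ℝ) := ⟨fun z => tilt ε z, by fun_prop⟩
  let ofR : C(ℝ, slitRegion S ε g) :=
    ⟨fun x => ⟨graphPoint ε g x, graphPoint_mem_slitRegion hg x⟩, by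
      refine Continuous.subtype_mk ?_ _
      exact Continuous.complex_mk (by fun_prop) (by fun_prop)⟩
  let φ : ℝ → ℂ → ℂ := fun u z =>
    ⟨tilt ε z - ε * ((1 - u) * g (tilt ε z) + u * z.im), (1 - u) * g (tilt ε z) + u * z.im⟩
  have hφt : ∀ u z, tilt ε (φ u z) = tilt ε z := fun u z => by simp [φ, tilt]
  have hφ : ∀ u : I, ∀ z ∈ slitRegion S ε g, φ u z ∈ slitRegion S ε g := by
    intro u z hz v hv h
    rw [hφt] at h
    have h1 := hz v hv h
    have h2 : 0 < (g (tilt ε v) - v.im) * (g (tilt ε v) - v.im) :=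
      mul_self_pos.2 (sub_ne_zero.2 (hg v hv))
    simp only [φ]
    rw [h]
    have h3 : ((1 - (u : ℝ)) * g (tilt ε v) + u * z.im - v.im) * (g (tilt ε v) - v.im) =
      (1 - (u : ℝ)) * ((g (tilt ε v) - v.im) * (g (tilt ε v) - v.im)) +
      u * ((z.im - v.im) * (g (tilt ε v) - v.im)) := by ring
    rw [h3]
    rcases u.2.1.eq_or_lt with h0 | h0
    · rw [← h0]; simpa using h2
    · have := mul_pos h0 h1
      have := mul_nonneg (sub_nonneg.2 u.2.2) h2.le
      linarith
  have hφc : Continuous fun p : ℝ × ℂ => φ p.1 p.2 := by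
    refine Continuous.complex_mk ?_ ?_ <;> fun_prop
  have hom : (ofR.comp toR).Homotopic (ContinuousMap.id _) := by
    refine ⟨⟨⟨fun p => ⟨φ p.1 p.2, hφ p.1 _ p.2.2⟩, ?_⟩, ?_, ?_⟩⟩
    · exact Continuous.subtype_mk (hφc.comp (by fun_prop :
        Continuous fun p : I × slitRegion S ε g => ((p.1 : ℝ), (p.2 : ℂ)))) _
    · intro z
      apply Subtype.ext
      simp [φ, ofR, toR, graphPoint]
    · intro z
      apply Subtype.ext
      apply Complex.ext <;> simp [φ, tilt]
  have e : ContinuousMap.HomotopyEquiv (slitRegion S ε g) ℝ :=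
    ⟨toR, ofR, hom, by
      rw [show toR.comp ofR = ContinuousMap.id _ by ext x; simp [toR, ofR]]⟩
  have := e.contractibleSpace
  exact (inferInstance : SimplyConnectedSpace (slitRegion S ε g))

/-- The complement of slits, as a subset of the punctured plane. -/
def slitSet (S : Set ℂ) (ε : ℝ) (g : ℝ → ℝ) : Set ↥(Sᶜ) := Subtype.val ⁻¹' slitRegion S ε g

lemma Separates.isSimplyConnected (hg : Separates S ε s l g) :
    IsSimplyConnected (slitSet S ε g) := by
  rw [← Topology.IsEmbedding.subtypeVal.isSimplyConnected_image, slitSet,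
    Subtype.image_preimage_coe, inter_eq_right.2 slitRegion_subset_compl]
  exact isSimplyConnected_slitRegion hg.continuous hg.ne

lemma joinedIn_coe {X : Type*} [TopologicalSpace X] {B : Set X} {A : Set B} {x y : B}
    (h : JoinedIn (Subtype.val '' A) (x : X) y) : JoinedIn A x y := by
  have hm : ∀ t, h.somePath t ∈ B := fun t => by
    obtain ⟨a, -, ha⟩ := h.somePath_mem t
    exact ha ▸ a.2
  refine ⟨h.somePath.intoSet hm x.2 y.2, fun t => ?_⟩
  obtain ⟨a, ha, hat⟩ := h.somePath_mem t
  have : h.somePath.intoSet hm x.2 y.2 t = a := Subtype.ext hat.symm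
  rwa [this]

/-- The class of the paths from `z` to `w` in the complement of slits only depends on the sides of
the slits between `z` and `w`. -/
lemma pathClassIn_slitSet_congr (hg : Separates S ε s l g) (hg' : Separates S ε s l g')
    {z w : ↥(Sᶜ)} (hz : z ∈ slitSet S ε g) (hw : w ∈ slitSet S ε g)
    (hz' : z ∈ slitSet S ε g') (hw' : w ∈ slitSet S ε g')
    (h : ∀ v ∈ S, tilt ε v ∈ uIcc (tilt ε z) (tilt ε w) →
      0 < (g (tilt ε v) - v.im) * (g' (tilt ε v) - v.im)) :
    pathClassIn hg.isSimplyConnected hz hw = pathClassIn hg'.isSimplyConnected hz' hw' := by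
  have key : ∀ z : ↥(Sᶜ), z ∈ slitSet S ε g → z ∈ slitSet S ε g' →
      (∀ v ∈ S, tilt ε v = tilt ε z → 0 < (g (tilt ε v) - v.im) * (g' (tilt ε v) - v.im)) →
      JoinedIn (slitRegion S ε g ∩ slitRegion S ε g') (z : ℂ) (graphPoint ε g (tilt ε z)) := by
    intro z hz hz' h
    let f : I → ℂ := fun u => ⟨tilt ε z - ε * ((1 - u) * (z : ℂ).im + u * g (tilt ε z)),
      (1 - u) * (z : ℂ).im + u * g (tilt ε z)⟩
    have hf : Continuous f := by refine Continuous.complex_mk ?_ ?_ <;> fun_prop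
    have hft : ∀ u, tilt ε (f u) = tilt ε z := fun u => by simp [f, tilt]
    refine ⟨⟨⟨f, hf⟩, ?_, ?_⟩, fun u => ?_⟩
    · apply Complex.ext <;> simp [f, tilt]
    · simp [f, graphPoint]
    · change f u ∈ _
      have e1 : ∀ A B C D : ℝ, ((1 - (u : ℝ)) * A + u * B - C) * D =
        (1 - (u : ℝ)) * ((A - C) * D) + u * ((B - C) * D) := by intros; ring
      have pos : ∀ A B : ℝ, 0 < A → 0 < B → 0 < (1 - (u : ℝ)) * A + u * B := by
        intro A B hA hB
        rcases u.2.1.eq_or_lt with h0 | h0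
        · rw [← h0]; simpa using hA
        · have := mul_pos h0 hB
          have := mul_nonneg (sub_nonneg.2 u.2.2) hA.le
          linarith
      constructor
      · intro v hv hvt
        rw [hft] at hvt
        simp only [f, e1]
        refine pos _ _ (hz v hv hvt) ?_
        rw [hvt]
        exact mul_self_pos.2 (sub_ne_zero.2 (hg.ne v hv))
      · intro v hv hvt
        rw [hft] at hvt
        simp only [f, e1]
        refine pos _ _ (hz' v hv hvt) ?_
        rw [hvt]
        exact h v hv hvt.symm
  refine pathClassIn_congr _ _ (joinedIn_coe ?_) hz hw hz' hw'
  have himg : (Subtype.val '' (slitSet S ε g ∩ slitSet S ε g') : Set ℂ) =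
      slitRegion S ε g ∩ slitRegion S ε g' := by
    rw [slitSet, slitSet, ← preimage_inter, Subtype.image_preimage_coe,
      inter_eq_right.2 (inter_subset_left.trans slitRegion_subset_compl)]
  rw [himg]
  refine (key z hz hz' fun v hv e => h v hv (e ▸ left_mem_uIcc)).trans (JoinedIn.trans ?_
    (key w hw hw' fun v hv e => h v hv (e ▸ right_mem_uIcc)).symm)
  let f : I → ℂ := fun u => graphPoint ε g (tilt ε z + u * (tilt ε w - tilt ε z))
  have hf : Continuous f := by
    have := hg.continuous
    refine Continuous.complex_mk ?_ ?_ <;> fun_prop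
  refine ⟨⟨⟨f, hf⟩, by simp [f], by simp [f]⟩, fun u => ⟨graphPoint_mem_slitRegion hg.ne _, ?_⟩⟩
  intro v hv e
  change tilt ε (f u) = _ at e
  change 0 < ((f u).im - _) * _
  simp only [f, tilt_graphPoint, graphPoint_im] at e ⊢
  rw [e]
  refine h v hv ?_
  rw [← e, uIcc, mem_Icc]
  have h0 := u.2.1
  have h1 := u.2.2
  rcases le_total (tilt ε (z : ℂ)) (tilt ε (w : ℂ)) with h2 | h2
  · simp only [inf_eq_left.2 h2, sup_eq_right.2 h2]
    constructor <;> nlinarith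
  · simp only [inf_eq_right.2 h2, sup_eq_left.2 h2]
    constructor <;> nlinarith

end Slits

section PathClasses

variable {X : Type*} [TopologicalSpace X] {A B C : Set X} {x y z : X}

lemma pathClassIn_self (hA : IsSimplyConnected A) (hx : x ∈ A) :
    pathClassIn hA hx hx = .refl x := by
  rw [← mk_eq_pathClassIn hA (Path.refl x) (fun _ => hx) hx hx, Path.Homotopic.Quotient.mk_refl]

lemma mk_eq_trans_pathClassIn (hA : IsSimplyConnected A) (hB : IsSimplyConnected B)
    (hC : IsSimplyConnected C) (p : Path x y) (t₁ t₂ : I) (h₁₂ : t₁ ≤ t₂)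
    (h₁ : ∀ t ≤ t₁, p t ∈ A) (h₂ : ∀ t, t₁ ≤ t → t ≤ t₂ → p t ∈ B) (h₃ : ∀ t, t₂ ≤ t → p t ∈ C)
    (hx : x ∈ A) (hy : y ∈ C) :
    .mk p = ((pathClassIn hA hx (h₁ _ le_rfl)).trans
      ((pathClassIn hB (h₂ _ le_rfl h₁₂) (h₂ _ h₁₂ le_rfl)).trans
      (pathClassIn hC (h₃ _ le_rfl) hy))) := by
  have e1 : ∀ t, (p.subpath 0 t₁) t ∈ A := fun t => by
    obtain ⟨u, hu, hu'⟩ := (Path.range_subpath_of_le p 0 t₁ bot_le).subset (mem_range_self t)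
    exact hu' ▸ h₁ u hu.2
  have e2 : ∀ t, (p.subpath t₁ t₂) t ∈ B := fun t => by
    obtain ⟨u, hu, hu'⟩ := (Path.range_subpath_of_le p t₁ t₂ h₁₂).subset (mem_range_self t)
    exact hu' ▸ h₂ u hu.1 hu.2
  have e3 : ∀ t, (p.subpath t₂ 1) t ∈ C := fun t => by
    obtain ⟨u, hu, hu'⟩ := (Path.range_subpath_of_le p t₂ 1 le_top).subset (mem_range_self t)
    exact hu' ▸ h₃ u hu.1
  rw [← mk_eq_pathClassIn hA ((p.subpath 0 t₁).cast p.source.symm rfl) e1,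
    ← mk_eq_pathClassIn hB (p.subpath t₁ t₂) e2,
    ← mk_eq_pathClassIn hC ((p.subpath t₂ 1).cast rfl p.target.symm) e3,
    ← Path.Homotopic.Quotient.mk_trans, ← Path.Homotopic.Quotient.mk_trans,
    Path.Homotopic.Quotient.eq]
  have h4 : (((p.subpath 0 t₁).trans ((p.subpath t₁ t₂).trans (p.subpath t₂ 1)))).Homotopic
      (p.subpath 0 1) :=
    (Path.Homotopic.hcomp (.refl _) ⟨Path.Homotopy.subpathTransSubpath p t₁ t₂ 1⟩).trans
      ⟨Path.Homotopy.subpathTransSubpath p 0 t₁ 1⟩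
  rw [Path.subpath_zero_one] at h4
  exact h4.symm.pathCast p.source.symm p.target.symm

lemma homotopic_of_family {p q : Path x y} (H : I × I → X) (hH : Continuous H)
    (h0 : ∀ t, H (0, t) = p t) (h1 : ∀ t, H (1, t) = q t) (hx : ∀ u, H (u, 0) = x)
    (hy : ∀ u, H (u, 1) = y) : p.Homotopic q := by
  refine ⟨⟨⟨⟨H, hH⟩, h0, h1⟩, ?_⟩⟩
  rintro u t (rfl | rfl)
  · simp [hx]
  · simp [hy]

end PathClasses

/-- A separating function with prescribed position relative to each point exists if the points over
which it passes lie lower than those under which it passes. -/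
lemma exists_separates {y : Fin 4 → ℂ} {ε s l : ℝ} (hl : ∀ j, l < tilt ε (y j))
    (hs : ∀ j, tilt ε (y j) < s) (e : Fin 4 → Prop)
    (h : ∀ i j, tilt ε (y i) = tilt ε (y j) → ¬ e i → e j → (y j).im < (y i).im) :
    ∃ g, Separates (range y) ε s l g ∧ ∀ j, (y j).im < g (tilt ε (y j)) ↔ e j := by
  classical
  have h1 : ∀ x : ℝ, ∃ m : ℝ, (∀ j, tilt ε (y j) = x → e j → (y j).im < m) ∧
      ∀ i, tilt ε (y i) = x → ¬ e i → m < (y i).im := by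
    intro x
    obtain ⟨m, hm, hm'⟩ := Order.exists_between_finsets
      ((Finset.univ.filter fun j => tilt ε (y j) = x ∧ e j).image fun j => (y j).im)
      ((Finset.univ.filter fun j => tilt ε (y j) = x ∧ ¬ e j).image fun j => (y j).im) (by
        intro u hu v hv
        simp only [Finset.mem_image, Finset.mem_filter, Finset.mem_univ, true_and] at hu hv
        obtain ⟨j, ⟨hj, hej⟩, rfl⟩ := hu
        obtain ⟨i, ⟨hi, hei⟩, rfl⟩ := hv
        exact h i j (hi.trans hj.symm) hei hej)
    exact ⟨m, fun j hj hej => hm _ (Finset.mem_image_of_mem _ (by simp [hj, hej])),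
      fun j hj hej => hm' _ (Finset.mem_image_of_mem _ (by simp [hj, hej]))⟩
  choose m hm hm' using h1
  let f : ℝ → ℝ := fun x => if x = s ∨ x = l then 0 else m x
  let T : Finset ℝ := insert s (insert l (Finset.univ.image fun j => tilt ε (y j)))
  have hev : ∀ x ∈ T, (Lagrange.interpolate T id f).eval x = f x := fun x hx =>
    Lagrange.eval_interpolate_at_node f (injOn_id _) hx
  have hy : ∀ j, (Lagrange.interpolate T id f).eval (tilt ε (y j)) = m (tilt ε (y j)) := by
    intro j
    rw [hev _ (by simp [T])]
    simp [f, (hl j).ne', (hs j).ne]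
  have hiff : ∀ j, (y j).im < m (tilt ε (y j)) ↔ e j := by
    intro j
    by_cases hj : e j
    · exact ⟨fun _ => hj, fun _ => hm _ j rfl hj⟩
    · exact ⟨fun h2 => absurd h2 (hm' _ j rfl hj).not_gt, fun h2 => absurd h2 hj⟩
  refine ⟨fun x => (Lagrange.interpolate T id f).eval x, ⟨Polynomial.continuous _, ?_, ?_, ?_⟩, ?_⟩
  · simp only [hev s (by simp [T])]; simp [f]
  · simp only [hev l (by simp [T])]; simp [f]
  · rintro _ ⟨j, rfl⟩
    simp only [hy]
    by_cases hj : e j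
    · exact (hm _ j rfl hj).ne'
    · exact (hm' _ j rfl hj).ne
  · intro j
    simp only [hy, hiff]

/-! ### Loops along graphs -/

/-- The left end of the graphs, to the left of `S`. -/
def leftPoint {S : Set ℂ} {l : ℝ} (hl : ∀ z ∈ S, l < z.re) : ↥(Sᶜ) :=
  ⟨(l : ℂ), fun h => lt_irrefl l (by simpa using hl _ h)⟩

@[simp] lemma tilt_ofReal (ε s : ℝ) : tilt ε (s : ℂ) = s := by simp [tilt]

@[simp] lemma tilt_zero (z : ℂ) : tilt 0 z = z.re := by simp [tilt]

/-- The path along the graph of a function, from the right to the left. -/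
def graphPath {ε s l : ℝ} {g : ℝ → ℝ} (hg : Continuous g) (hs : g s = 0) (hl : g l = 0) :
    Path (s : ℂ) (l : ℂ) where
  toFun t := graphPoint ε g (s + t * (l - s))
  continuous_toFun := by
    refine Continuous.complex_mk ?_ ?_ <;> fun_prop
  source' := by apply Complex.ext <;> simp [graphPoint, hs]
  target' := by apply Complex.ext <;> simp [graphPoint, hl]

section SepLoop

variable {S : Set ℂ} {ε s l : ℝ} {g g₀ : ℝ → ℝ}

lemma Separates.graphPath_mem (hg : Separates S ε s l g) (t : I) :
    graphPath (ε := ε) hg.continuous hg.right hg.left t ∈ slitRegion S ε g :=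
  graphPoint_mem_slitRegion hg.ne _

/-- The path along the graph of a separating function, in the punctured plane. -/
def Separates.path (hg : Separates S ε s l g) (hs : ∀ z ∈ S, z.re < s) (hl : ∀ z ∈ S, l < z.re) :
    Path (basePoint hs) (leftPoint hl) :=
  (graphPath (ε := ε) hg.continuous hg.right hg.left).intoSet
    (fun t => slitRegion_subset_compl (hg.graphPath_mem t)) _ _

/-- The loop that goes to the left along the graph of `g` and back along that of `g₀`. -/
def sepLoop (hg : Separates S ε s l g) (hg₀ : Separates S ε s l g₀) (hs : ∀ z ∈ S, z.re < s)
    (hl : ∀ z ∈ S, l < z.re) : Path (basePoint hs) (basePoint hs) :=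
  (hg.path hs hl).trans (hg₀.path hs hl).symm

lemma Separates.basePoint_mem (hg : Separates S ε s l g) (hs : ∀ z ∈ S, z.re < s) :
    basePoint hs ∈ slitSet S ε g := by
  have := graphPoint_mem_slitRegion hg.ne s
  rwa [show graphPoint ε g s = s by apply Complex.ext <;> simp [graphPoint, hg.right]] at this

lemma Separates.leftPoint_mem (hg : Separates S ε s l g) (hl : ∀ z ∈ S, l < z.re) :
    leftPoint hl ∈ slitSet S ε g := by
  have := graphPoint_mem_slitRegion hg.ne l
  rwa [show graphPoint ε g l = l by apply Complex.ext <;> simp [graphPoint, hg.left]] at this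

lemma Separates.mk_path (hg : Separates S ε s l g) (hs : ∀ z ∈ S, z.re < s)
    (hl : ∀ z ∈ S, l < z.re) : .mk (hg.path hs hl) =
      pathClassIn hg.isSimplyConnected (hg.basePoint_mem hs) (hg.leftPoint_mem hl) :=
  mk_eq_pathClassIn _ (hg.path hs hl) hg.graphPath_mem _ _

/-- The class of a loop, from its homotopy class as a path. -/
def fiberClass {hs : ∀ z ∈ S, z.re < s}
    (q : Path.Homotopic.Quotient (basePoint hs) (basePoint hs)) : FiberGroup hs :=
  MulOpposite.op (FundamentalGroup.fromPath q)

lemma fiberClass_trans {hs : ∀ z ∈ S, z.re < s}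
    (q q' : Path.Homotopic.Quotient (basePoint hs) (basePoint hs)) :
    fiberClass (q.trans q') = fiberClass q * fiberClass q' := rfl

lemma loopClass_eq_iff {hs : ∀ z ∈ S, z.re < s} (ℓ ℓ' : Path (basePoint hs) (basePoint hs)) :
    loopClass hs ℓ = loopClass hs ℓ' ↔ ℓ.Homotopic ℓ' := by
  rw [← Path.Homotopic.Quotient.eq]
  exact MulOpposite.op_injective.eq_iff

lemma loopClass_surjective {hs : ∀ z ∈ S, z.re < s} (c : FiberGroup hs) :
    ∃ ℓ, loopClass hs ℓ = c := by
  obtain ⟨ℓ, hℓ⟩ := Path.Homotopic.Quotient.mk_surjective (FundamentalGroup.toPath c.unop)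
  exact ⟨ℓ, by rw [loopClass, hℓ]; rfl⟩

lemma loopClass_sepLoop (hg : Separates S ε s l g) (hg₀ : Separates S ε s l g₀)
    (hs : ∀ z ∈ S, z.re < s) (hl : ∀ z ∈ S, l < z.re) :
    loopClass hs (sepLoop hg hg₀ hs hl) = fiberClass
      ((pathClassIn hg.isSimplyConnected (hg.basePoint_mem hs) (hg.leftPoint_mem hl)).trans
      (pathClassIn hg₀.isSimplyConnected (hg₀.leftPoint_mem hl) (hg₀.basePoint_mem hs))) := by
  rw [← pathClassIn_symm hg₀.isSimplyConnected (hg₀.basePoint_mem hs), ← hg.mk_path,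
    ← hg₀.mk_path]
  rfl

/-- The class of the loop along two graphs only depends on the sides of the points on which they
pass. -/
lemma loopClass_sepLoop_congr {g' g₀' : ℝ → ℝ}
    (hg : Separates S ε s l g) (hg₀ : Separates S ε s l g₀)
    (hg' : Separates S ε s l g') (hg₀' : Separates S ε s l g₀')
    (hs : ∀ z ∈ S, z.re < s) (hl : ∀ z ∈ S, l < z.re)
    (h : ∀ v ∈ S, 0 < (g (tilt ε v) - v.im) * (g' (tilt ε v) - v.im))
    (h₀ : ∀ v ∈ S, 0 < (g₀ (tilt ε v) - v.im) * (g₀' (tilt ε v) - v.im)) :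
    loopClass hs (sepLoop hg hg₀ hs hl) = loopClass hs (sepLoop hg' hg₀' hs hl) := by
  rw [loopClass_sepLoop, loopClass_sepLoop,
    pathClassIn_slitSet_congr hg hg' _ _ (hg'.basePoint_mem hs) (hg'.leftPoint_mem hl)
      fun v hv _ => h v hv,
    pathClassIn_slitSet_congr hg₀ hg₀' _ _ (hg₀'.leftPoint_mem hl) (hg₀'.basePoint_mem hs)
      fun v hv _ => h₀ v hv]

lemma continuous_trans_family {X ι : Type*} [TopologicalSpace X] [TopologicalSpace ι]
    {a b c : ι → X} {γ₁ : ∀ i, Path (a i) (b i)} (h₁ : Continuous fun p : ι × I => γ₁ p.1 p.2)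
    {γ₂ : ∀ i, Path (b i) (c i)} (h₂ : Continuous fun p : ι × I => γ₂ p.1 p.2) :
    Continuous fun p : ι × I => ((γ₁ p.1).trans (γ₂ p.1)) p.2 :=
  Path.trans_continuous_family γ₁ h₁ γ₂ h₂

lemma continuous_symm_family {X ι : Type*} [TopologicalSpace X] [TopologicalSpace ι]
    {a b : ι → X} {γ : ∀ i, Path (a i) (b i)} (h : Continuous fun p : ι × I => γ p.1 p.2) :
    Continuous fun p : ι × I => (γ p.1).symm p.2 := by
  have : Continuous fun p : ι × I => (p.1, unitInterval.symm p.2) := by fun_prop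
  exact h.comp this

/-- Tilting the graphs does not change the class of the loop along them, as long as they avoid the
points. -/
lemma loopClass_sepLoop_tilt {ε : ℝ} {g g₀ : ℝ → ℝ}
    (hg : Separates S 0 s l g) (hg₀ : Separates S 0 s l g₀)
    (hg' : Separates S ε s l g) (hg₀' : Separates S ε s l g₀)
    (hs : ∀ z ∈ S, z.re < s) (hl : ∀ z ∈ S, l < z.re)
    (h : ∀ u : I, ∀ v ∈ S, g (tilt (u * ε) v) ≠ v.im)
    (h₀ : ∀ u : I, ∀ v ∈ S, g₀ (tilt (u * ε) v) ≠ v.im) :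
    loopClass hs (sepLoop hg hg₀ hs hl) = loopClass hs (sepLoop hg' hg₀' hs hl) := by
  rw [loopClass_eq_iff]
  have hu : ∀ u : I, Separates S (u * ε) s l g := fun u => ⟨hg.continuous, hg.right, hg.left, h u⟩
  have hu₀ : ∀ u : I, Separates S (u * ε) s l g₀ :=
    fun u => ⟨hg₀.continuous, hg₀.right, hg₀.left, h₀ u⟩
  have hc : ∀ {g : ℝ → ℝ} (hu : ∀ u : I, Separates S (u * ε) s l g),
      Continuous fun p : I × I => (hu p.1).path hs hl p.2 := by
    intro g hu
    have := (hu 0).continuous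
    refine Continuous.subtype_mk ?_ _
    change Continuous fun p : I × I => graphPoint (p.1 * ε) g (s + p.2 * (l - s))
    exact Continuous.complex_mk (by fun_prop) (by fun_prop)
  refine homotopic_of_family (fun p => sepLoop (hu p.1) (hu₀ p.1) hs hl p.2)
    (continuous_trans_family (γ₁ := fun u => (hu u).path hs hl)
      (γ₂ := fun u => ((hu₀ u).path hs hl).symm) (hc hu)
      (continuous_symm_family (γ := fun u => (hu₀ u).path hs hl) (hc hu₀))) ?_ ?_ ?_ ?_
  · intro t
    congr 2; simp
  · intro t
    congr 2; simp
  · intro u; simp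
  · intro u; simp

end SepLoop

/-! ### Lassos -/

/-- The tail of a lasso, ending at distance `ρ |ε - i|` from `w`. -/
def thinTail (s : ℝ) (w : ℂ) (ε ρ : ℝ) : Path (s : ℂ) (w + ρ * (ε - Complex.I)) :=
  ((Path.segment (s : ℂ) (s + (1 - Complex.I / ε))).trans
    (Path.segment (s + (1 - Complex.I / ε)) (w + (1 - Complex.I / ε)))).trans
    (Path.segment (w + (1 - Complex.I / ε)) (w + ρ * (ε - Complex.I)))

/-- The circle around `w` of radius `ρ |ε - i|`. -/
def thinCircle (w : ℂ) (ε ρ : ℝ) :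
    Path (w + ρ * (ε - Complex.I)) (w + ρ * (ε - Complex.I)) where
  toFun t := w + ρ * (ε - Complex.I) * Complex.exp (2 * Real.pi * Complex.I * ((t : ℝ) : ℂ))
  continuous_toFun := by fun_prop
  source' := by simp
  target' := by simp

/-- The lasso around `w` with a circle of radius `ρ |ε - i|`. -/
def thinLasso (s : ℝ) (w : ℂ) (ε ρ : ℝ) : Path (s : ℂ) (s : ℂ) :=
  ((thinTail s w ε ρ).trans (thinCircle w ε ρ)).trans (thinTail s w ε ρ).symm

lemma lasso_eq_thinLasso (s : ℝ) (w : ℂ) (ε : ℝ) : lasso s w ε = thinLasso s w ε ε := rfl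

lemma thinTail_cases {s : ℝ} {w : ℂ} {ε ρ : ℝ} (hε : 0 < ε) (hρ : 0 < ρ) (t : I) :
    tilt ε (thinTail s w ε ρ t) = s ∨
    (∃ u : I, (thinTail s w ε ρ t).im = u * w.im - 1 / ε) ∨
    (tilt ε (thinTail s w ε ρ t) = tilt ε w ∧ (thinTail s w ε ρ t).im < w.im) := by
  have hI : Complex.I / (ε : ℂ) = ((1 / ε : ℝ) : ℂ) * Complex.I := by
    push_cast; ring
  have ht : thinTail s w ε ρ t ∈ range (thinTail s w ε ρ) := mem_range_self t
  generalize thinTail s w ε ρ t = z at ht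
  simp only [thinTail, Path.trans_range] at ht
  rcases ht with (⟨u, rfl⟩ | ⟨u, rfl⟩) | ⟨u, rfl⟩
  · left
    simp only [Path.segment_apply, AffineMap.lineMap_apply, hI, tilt]
    simp
    field_simp
    ring
  · right; left
    refine ⟨u, ?_⟩
    simp only [Path.segment_apply, AffineMap.lineMap_apply, hI]
    simp
    ring
  · right; right
    have h0 : 0 < (1 - (u : ℝ)) * (1 / ε) + u * ρ := by
      rcases u.2.1.eq_or_lt with h0 | h0
      · rw [← h0]; simpa using hε
      · have := mul_pos h0 hρ
        have := mul_nonneg (sub_nonneg.2 u.2.2) (one_div_pos.2 hε).le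
        linarith
    constructor
    · simp only [Path.segment_apply, AffineMap.lineMap_apply, hI, tilt]
      simp
      field_simp
      ring
    · simp only [Path.segment_apply, AffineMap.lineMap_apply, hI]
      simp
      rw [one_div] at h0
      linarith

lemma thinCircle_apply (w : ℂ) (ε ρ : ℝ) (t : I) : thinCircle w ε ρ t =
    w + ρ * (ε - Complex.I) * (Real.cos (2 * Real.pi * t) + Real.sin (2 * Real.pi * t) *
      Complex.I) := by
  rw [thinCircle, Path.coe_mk_mk, show (2 * Real.pi * Complex.I * ((t : ℝ) : ℂ)) =
    ((2 * Real.pi * (t : ℝ) : ℝ) : ℂ) * Complex.I by push_cast; ring, Complex.exp_mul_I]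
  push_cast
  rfl

lemma tilt_thinCircle (w : ℂ) (ε ρ : ℝ) (t : I) : tilt ε (thinCircle w ε ρ t) =
    tilt ε w + ρ * (1 + ε ^ 2) * Real.sin (2 * Real.pi * t) := by
  rw [thinCircle_apply]
  simp [tilt, -Complex.ofReal_cos, -Complex.ofReal_sin, -Complex.ofReal_mul]
  ring

lemma im_thinCircle (w : ℂ) (ε ρ : ℝ) (t : I) : (thinCircle w ε ρ t).im =
    w.im + ρ * (ε * Real.sin (2 * Real.pi * t) - Real.cos (2 * Real.pi * t)) := by
  rw [thinCircle_apply]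
  simp [-Complex.ofReal_cos, -Complex.ofReal_sin, -Complex.ofReal_mul]
  ring

lemma norm_thinCircle_sub (w : ℂ) (ε ρ : ℝ) (t : I) :
    ‖thinCircle w ε ρ t - w‖ = ‖(ρ : ℂ) * (ε - Complex.I)‖ := by
  rw [thinCircle, Path.coe_mk_mk, add_sub_cancel_left, norm_mul,
    show (2 * Real.pi * Complex.I * ((t : ℝ) : ℂ)) =
    ((2 * Real.pi * (t : ℝ) : ℝ) : ℂ) * Complex.I by push_cast; ring,
    Complex.norm_exp_ofReal_mul_I, mul_one]

lemma continuous_segment_family {ι : Type*} [TopologicalSpace ι] {a b : ι → ℂ}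
    (ha : Continuous a) (hb : Continuous b) :
    Continuous fun p : ι × I => Path.segment (a p.1) (b p.1) p.2 := by
  simp only [Path.segment_apply, AffineMap.lineMap_apply]
  simp only [vsub_eq_sub, vadd_eq_add, Complex.real_smul]
  fun_prop

lemma continuous_polygon_family {ι : Type*} [TopologicalSpace ι] {a b c d : ι → ℂ}
    (ha : Continuous a) (hb : Continuous b) (hc : Continuous c) (hd : Continuous d) :
    Continuous fun p : ι × I => (((Path.segment (a p.1) (b p.1)).trans
      (Path.segment (b p.1) (c p.1))).trans (Path.segment (c p.1) (d p.1))) p.2 :=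
  continuous_trans_family (γ₁ := fun u => (Path.segment (a u) (b u)).trans
      (Path.segment (b u) (c u))) (γ₂ := fun u => Path.segment (c u) (d u))
    (continuous_trans_family (γ₁ := fun u => Path.segment (a u) (b u))
      (γ₂ := fun u => Path.segment (b u) (c u)) (continuous_segment_family ha hb)
      (continuous_segment_family hb hc)) (continuous_segment_family hc hd)

lemma continuous_thinLasso_family (s : ℝ) (w : ℂ) {E R : I → ℝ} (hE : Continuous E)
    (hR : Continuous R) (hpos : ∀ u, E u ≠ 0) :
    Continuous fun p : I × I => thinLasso s w (E p.1) (R p.1) p.2 := by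
  have hEc : Continuous fun u => (1 : ℂ) - Complex.I / (E u : ℂ) := by
    have : Continuous fun u => Complex.I / (E u : ℂ) :=
      continuous_const.div (by fun_prop) fun u => by exact_mod_cast hpos u
    fun_prop
  have h1 : Continuous fun p : I × I => thinTail s w (E p.1) (R p.1) p.2 :=
    continuous_polygon_family (a := fun _ => (s : ℂ)) (b := fun u => s + (1 - Complex.I / E u))
      (c := fun u => w + (1 - Complex.I / E u)) (d := fun u => w + R u * (E u - Complex.I))
      continuous_const (continuous_const.add hEc) (continuous_const.add hEc) (by fun_prop)
  have h2 : Continuous fun p : I × I => thinCircle w (E p.1) (R p.1) p.2 := by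
    change Continuous fun p : I × I => w + R p.1 * (E p.1 - Complex.I) *
      Complex.exp (2 * Real.pi * Complex.I * ((p.2 : ℝ) : ℂ))
    fun_prop
  exact continuous_trans_family
    (γ₁ := fun u => (thinTail s w (E u) (R u)).trans (thinCircle w (E u) (R u)))
    (γ₂ := fun u => (thinTail s w (E u) (R u)).symm)
    (continuous_trans_family (γ₁ := fun u => thinTail s w (E u) (R u))
      (γ₂ := fun u => thinCircle w (E u) (R u)) h1 h2)
    (continuous_symm_family (γ := fun u => thinTail s w (E u) (R u)) h1)

/-- The tilt `ε` is small with respect to the points `y` between `l` and `s`, which are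
lexicographically ordered. -/
structure SmallTilt (y : Fin 4 → ℂ) (s l ε : ℝ) : Prop where
  pos : 0 < ε
  lt_right : ∀ j, tilt ε (y j) < s
  left_lt : ∀ j, l < tilt ε (y j)
  deep : ∀ j, ε * -(y j).im < 1
  deep' : ∀ i j, ε * ((y i).im - (y j).im) < 1
  lt : ∀ i j, i < j → tilt ε (y j) < tilt ε (y i)
  disjoint : ∀ i j, i ≠ j → ‖(ε : ℂ) * (ε - Complex.I)‖ < ‖y i - y j‖

lemma eventually_smallTilt {S : Set ℂ} {y : Fin 4 → ℂ} (hy : IsLexOrdering S y) {s l : ℝ}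
    (hs : ∀ z ∈ S, z.re < s) (hl : ∀ z ∈ S, l < z.re) : ∀ᶠ ε in 𝓝[>] 0, SmallTilt y s l ε := by
  have hcont : ∀ {f : ℝ → ℝ} {c : ℝ}, Continuous f → f 0 < c → ∀ᶠ ε in 𝓝[>] (0 : ℝ), f ε < c :=
    fun hf h => ((hf.tendsto 0).eventually_lt_const h).filter_mono nhdsWithin_le_nhds
  have hm : ∀ j, y j ∈ S := fun j => hy.1 ▸ mem_range_self j
  have h1 : ∀ᶠ ε in 𝓝[>] (0 : ℝ), ∀ j, tilt ε (y j) < s := eventually_all.2 fun j =>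
    hcont (by unfold tilt; fun_prop) (by simpa using hs _ (hm j))
  have h2 : ∀ᶠ ε in 𝓝[>] (0 : ℝ), ∀ j, l < tilt ε (y j) := eventually_all.2 fun j =>
    (hcont (f := fun ε => - tilt ε (y j)) (c := -l) (by unfold tilt; fun_prop)
      (by simpa using hl _ (hm j))).mono fun ε h => neg_lt_neg_iff.1 h
  have h3 : ∀ᶠ ε in 𝓝[>] (0 : ℝ), ∀ j, ε * -(y j).im < 1 := eventually_all.2 fun j =>
    hcont (by fun_prop) (by simp)
  have h4 : ∀ᶠ ε in 𝓝[>] (0 : ℝ), ∀ i j, ε * ((y i).im - (y j).im) < 1 :=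
    eventually_all.2 fun i => eventually_all.2 fun j => hcont (by fun_prop) (by simp)
  have h5 : ∀ᶠ ε in 𝓝[>] (0 : ℝ), ∀ i j, i < j → tilt ε (y j) < tilt ε (y i) := by
    refine eventually_all.2 fun i => eventually_all.2 fun j => eventually_imp_distrib_left.2
      fun hij => ?_
    rcases hy.2 i j hij with h | ⟨h, h'⟩
    · have := hcont (f := fun ε => tilt ε (y j) - tilt ε (y i)) (c := 0)
        (by unfold tilt; fun_prop) (by simpa using h)
      exact this.mono fun ε h => sub_neg.1 h
    · filter_upwards [self_mem_nhdsWithin] with ε hε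
      simp only [tilt, h]
      have := mul_lt_mul_of_pos_left h' (show (0 : ℝ) < ε from hε)
      linarith
  have h6 : ∀ᶠ ε : ℝ in 𝓝[>] (0 : ℝ), ∀ i j, i ≠ j →
      ‖(ε : ℂ) * (ε - Complex.I)‖ < ‖y i - y j‖ := by
    refine eventually_all.2 fun i => eventually_all.2 fun j => eventually_imp_distrib_left.2
      fun hij => hcont (f := fun ε : ℝ => ‖(ε : ℂ) * (ε - Complex.I)‖) (by fun_prop) ?_
    have : y i ≠ y j := by
      intro h
      rcases lt_or_gt_of_ne hij with h' | h'
      · rcases hy.2 _ _ h' with h2 | h2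
        · exact h2.ne (by rw [h])
        · exact h2.2.ne (by rw [h])
      · rcases hy.2 _ _ h' with h2 | h2
        · exact h2.ne (by rw [h])
        · exact h2.2.ne (by rw [h])
    simpa [sub_eq_zero] using this
  filter_upwards [self_mem_nhdsWithin, h1, h2, h3, h4, h5, h6] with ε a1 a2 a3 a4 a5 a6 a7
  exact ⟨a1, a2, a3, a4, a5, a6, a7⟩

section Lasso

variable {S : Set ℂ} {y : Fin 4 → ℂ} {s l ε ρ : ℝ}

lemma SmallTilt.tilt_ne (h : SmallTilt y s l ε) {i j : Fin 4} (hij : i ≠ j) :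
    tilt ε (y i) ≠ tilt ε (y j) := by
  rcases lt_or_gt_of_ne hij with h' | h'
  · exact (h.lt _ _ h').ne'
  · exact (h.lt _ _ h').ne

/-- The tail of a lasso passes below all points. -/
lemma SmallTilt.thinTail_below (h : SmallTilt y s l ε) (hρ : 0 < ρ) (j k : Fin 4) (t : I)
    (hk : tilt ε (thinTail s (y j) ε ρ t) = tilt ε (y k)) :
    (thinTail s (y j) ε ρ t).im < (y k).im := by
  rcases thinTail_cases (s := s) (w := y j) h.pos hρ t with h1 | ⟨u, h1⟩ | ⟨h1, h2⟩
  · exact absurd (h.lt_right k) (by rw [← hk, h1]; exact lt_irrefl _)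
  · rw [h1, sub_lt_iff_lt_add, ← sub_lt_iff_lt_add', lt_div_iff₀ h.pos]
    have e1 := h.deep k
    have e2 := h.deep' j k
    have h0 := u.2.1
    have h1 := u.2.2
    rcases h0.eq_or_lt with h | h
    · rw [← h]; linarith
    · nlinarith [mul_le_mul_of_nonneg_left e1.le (sub_nonneg.2 h1), mul_lt_mul_of_pos_left e2 h]
  · rw [h1] at hk
    obtain rfl : j = k := by
      by_contra hne
      exact h.tilt_ne hne hk
    exact h2

lemma norm_mul_tilt_le {ε ρ ρ' : ℝ} (hρ : 0 ≤ ρ) (h : ρ ≤ ρ') :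
    ‖(ρ : ℂ) * (ε - Complex.I)‖ ≤ ‖(ρ' : ℂ) * (ε - Complex.I)‖ := by
  rw [norm_mul, norm_mul, Complex.norm_real, Complex.norm_real, Real.norm_of_nonneg hρ,
    Real.norm_of_nonneg (hρ.trans h)]
  exact mul_le_mul_of_nonneg_right h (norm_nonneg _)

lemma SmallTilt.thinCircle_ne (h : SmallTilt y s l ε) (hρ : 0 < ρ) (hρε : ρ ≤ ε) (j k : Fin 4)
    (t : I) : thinCircle (y j) ε ρ t ≠ y k := by
  intro ht
  have hn := norm_thinCircle_sub (y j) ε ρ t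
  rw [ht] at hn
  rcases eq_or_ne k j with rfl | hkj
  · have h7 : (ρ : ℂ) * (ε - Complex.I) = 0 := by simpa using hn.symm
    rcases mul_eq_zero.1 h7 with h8 | h8
    · exact hρ.ne' (by exact_mod_cast h8)
    · have := congrArg Complex.im h8
      simp at this
  · exact absurd hn ((norm_mul_tilt_le hρ.le hρε).trans_lt (h.disjoint k j hkj)).ne'

lemma SmallTilt.thinTail_mem (h : SmallTilt y s l ε) (hy : range y = S) (hρ : 0 < ρ) (j : Fin 4)
    (t : I) : thinTail s (y j) ε ρ t ∈ Sᶜ := by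
  rw [← hy]
  rintro ⟨k, hk⟩
  exact (h.thinTail_below hρ j k t (by rw [hk])).ne (by rw [hk])

lemma SmallTilt.thinCircle_mem (h : SmallTilt y s l ε) (hy : range y = S) (hρ : 0 < ρ)
    (hρε : ρ ≤ ε) (j : Fin 4) (t : I) : thinCircle (y j) ε ρ t ∈ Sᶜ := by
  rw [← hy]
  rintro ⟨k, hk⟩
  exact h.thinCircle_ne hρ hρε j k t hk.symm

lemma SmallTilt.thinLasso_mem (h : SmallTilt y s l ε) (hy : range y = S) (hρ : 0 < ρ)
    (hρε : ρ ≤ ε) (j : Fin 4) (t : I) : thinLasso s (y j) ε ρ t ∈ Sᶜ := by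
  have ht : thinLasso s (y j) ε ρ t ∈ range (thinLasso s (y j) ε ρ) := mem_range_self t
  simp only [thinLasso, Path.trans_range, Path.symm_range] at ht
  rcases ht with (⟨u, hu⟩ | ⟨u, hu⟩) | ⟨u, hu⟩
  · rw [thinLasso, ← hu]; exact h.thinTail_mem hy hρ j u
  · rw [thinLasso, ← hu]; exact h.thinCircle_mem hy hρ hρε j u
  · rw [thinLasso, ← hu]; exact h.thinTail_mem hy hρ j u

/-- The lasso with a small circle, in the punctured plane. -/
def SmallTilt.loop (h : SmallTilt y s l ε) (hy : range y = S) (hs : ∀ z ∈ S, z.re < s)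
    (hρ : 0 < ρ) (hρε : ρ ≤ ε) (j : Fin 4) : Path (basePoint hs) (basePoint hs) :=
  (thinLasso s (y j) ε ρ).intoSet (h.thinLasso_mem hy hρ hρε j) (basePoint hs).2 (basePoint hs).2

lemma SmallTilt.coe_loop (h : SmallTilt y s l ε) (hy : range y = S) (hs : ∀ z ∈ S, z.re < s)
    (hρ : 0 < ρ) (hρε : ρ ≤ ε) (j : Fin 4) (t : I) :
    (h.loop hy hs hρ hρε j t : ℂ) = thinLasso s (y j) ε ρ t := rfl

/-- The canonical loops are homotopic to lassos with a small tilt and a small circle. -/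
lemma loopClass_canonicalLoop (h : SmallTilt y s l ε) (hy : IsLexOrdering S y)
    (hs : ∀ z ∈ S, z.re < s) (hρ : 0 < ρ) (hρε : ρ ≤ ε) (j : Fin 4)
    (hε : ε ≤ (exists_lasso_scale hy hs j).choose) :
    loopClass hs (canonicalLoop hy hs j) = loopClass hs (h.loop hy.1 hs hρ hρε j) := by
  have hsc := (exists_lasso_scale hy hs j).choose_spec
  set ε₀ := (exists_lasso_scale hy hs j).choose with hε₀
  trans loopClass hs (h.loop hy.1 hs h.pos le_rfl j)
  · rw [loopClass_eq_iff]
    let E : I → ℝ := fun u => (1 - u) * ε₀ + u * ε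
    have hE : ∀ u, 0 < E u ∧ E u ≤ ε₀ := fun u => by
      have h0 := u.2.1
      have h1 := u.2.2
      have h2 := h.pos
      have h3 := hsc.1
      simp only [E]
      constructor <;> nlinarith
    refine homotopic_of_family (fun p => ⟨thinLasso s (y j) (E p.1) (E p.1) p.2,
      hsc.2 _ (hE p.1).1 (hE p.1).2 p.2⟩)
      (Continuous.subtype_mk (continuous_thinLasso_family s (y j) (by fun_prop) (by fun_prop)
        fun u => (hE u).1.ne') _) ?_ ?_ ?_ ?_
    · intro t
      apply Subtype.ext
      simp [E, canonicalLoop, lasso_eq_thinLasso, hε₀]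
    · intro t
      apply Subtype.ext
      simp [E, SmallTilt.coe_loop]
    · intro u
      apply Subtype.ext
      simp [basePoint]
    · intro u
      apply Subtype.ext
      simp [basePoint]
  · rw [loopClass_eq_iff]
    let R : I → ℝ := fun u => (1 - u) * ε + u * ρ
    have hR : ∀ u, 0 < R u ∧ R u ≤ ε := fun u => by
      have h0 := u.2.1
      have h1 := u.2.2
      have h2 := h.pos
      simp only [R]
      constructor <;> nlinarith
    have hm : ∀ p : I × I, thinLasso s (y j) ε (R p.1) p.2 ∈ Sᶜ := fun p => by
      rw [← h.coe_loop hy.1 hs (hR p.1).1 (hR p.1).2 j]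
      exact Subtype.coe_prop _
    refine homotopic_of_family (fun p => ⟨thinLasso s (y j) ε (R p.1) p.2, hm p⟩)
      (Continuous.subtype_mk (continuous_thinLasso_family s (y j) (by fun_prop) (by fun_prop)
        fun u => h.pos.ne') _) ?_ ?_ ?_ ?_
    · intro t
      apply Subtype.ext
      simp [R, SmallTilt.coe_loop]
    · intro t
      apply Subtype.ext
      simp [R, SmallTilt.coe_loop]
    · intro u
      apply Subtype.ext
      simp [basePoint]
    · intro u
      apply Subtype.ext
      simp [basePoint]

end Lasso

lemma Path.intoSet_trans {X : Type*} [TopologicalSpace X] {A : Set X} {x y z : X}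
    (p : Path x y) (q : Path y z) (hp : ∀ t, p t ∈ A) (hq : ∀ t, q t ∈ A)
    (h : ∀ t, p.trans q t ∈ A) (hx : x ∈ A) (hy : y ∈ A) (hz : z ∈ A) :
    (p.trans q).intoSet h hx hz = (p.intoSet hp hx hy).trans (q.intoSet hq hy hz) := by
  ext t
  change (p.trans q) t = ((p.intoSet hp hx hy).trans (q.intoSet hq hy hz) t : X)
  simp only [Path.trans_apply]
  split_ifs <;> rfl

section Lasso

variable {S : Set ℂ} {y : Fin 4 → ℂ} {s l ε ρ : ℝ} {g₀ g : ℝ → ℝ}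

/-- The function passes below all points. -/
def PassesBelow (S : Set ℂ) (ε : ℝ) (g : ℝ → ℝ) : Prop := ∀ v ∈ S, g (tilt ε v) < v.im

lemma PassesBelow.mem_slitRegion (hb : PassesBelow S ε g) {z : ℂ}
    (h : ∀ v ∈ S, tilt ε z = tilt ε v → z.im < v.im) : z ∈ slitRegion S ε g :=
  fun v hv e => mul_pos_of_neg_of_neg (sub_neg.2 (h v hv e)) (sub_neg.2 (hb v hv))

/-- One quarter of the unit interval. -/
def quarter : I := ⟨1 / 4, by norm_num, by norm_num⟩

/-- Three quarters of the unit interval. -/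
def threeQuarters : I := ⟨3 / 4, by norm_num, by norm_num⟩

/-- The circle is narrow with respect to the distances of the tilted vertical lines through the
points. -/
def NarrowCircle (y : Fin 4 → ℂ) (ε ρ : ℝ) : Prop :=
  ∀ i j, i ≠ j → ρ * (1 + ε ^ 2) < |tilt ε (y i) - tilt ε (y j)|

lemma NarrowCircle.eq_of_tilt (h : NarrowCircle y ε ρ) (hρ : 0 < ρ) {j k : Fin 4} {t : I}
    (ht : tilt ε (thinCircle (y j) ε ρ t) = tilt ε (y k)) :
    k = j ∧ Real.sin (2 * Real.pi * t) = 0 := by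
  rw [tilt_thinCircle] at ht
  have hpos : 0 < ρ * (1 + ε ^ 2) := by positivity
  have hkj : k = j := by
    by_contra hne
    have h1 := h k j hne
    rw [← ht, add_sub_cancel_left, abs_mul, abs_of_pos hpos] at h1
    have := mul_le_mul_of_nonneg_left (Real.abs_sin_le_one (2 * Real.pi * t)) hpos.le
    linarith
  subst hkj
  refine ⟨rfl, ?_⟩
  have : ρ * (1 + ε ^ 2) * Real.sin (2 * Real.pi * t) = 0 := by linarith
  exact (mul_eq_zero.1 this).resolve_left hpos.ne'

lemma thinCircle_mem_lower (hn : NarrowCircle y ε ρ) (hρ : 0 < ρ)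
    (hb : PassesBelow (range y) ε g) {j : Fin 4} {t : I} (ht : t ≤ quarter ∨ threeQuarters ≤ t) :
    thinCircle (y j) ε ρ t ∈ slitRegion (range y) ε g := by
  refine hb.mem_slitRegion ?_
  rintro _ ⟨k, rfl⟩ hk
  obtain ⟨rfl, hsin⟩ := hn.eq_of_tilt hρ hk
  rw [im_thinCircle, hsin]
  have hπ := Real.pi_pos
  have hcos : 0 ≤ Real.cos (2 * Real.pi * t) := by
    have h0 := t.2.1
    have h1 := t.2.2
    rcases ht with ht | ht
    · have ht' : (t : ℝ) ≤ 1 / 4 := ht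
      exact Real.cos_nonneg_of_mem_Icc ⟨by nlinarith, by nlinarith⟩
    · have ht' : 3 / 4 ≤ (t : ℝ) := ht
      rw [← Real.cos_sub_two_pi]
      exact Real.cos_nonneg_of_mem_Icc ⟨by nlinarith, by nlinarith⟩
  have h1 : Real.cos (2 * Real.pi * t) = 1 := by
    rcases Real.sin_eq_zero_iff_cos_eq.1 hsin with h | h
    · exact h
    · linarith
  rw [h1]
  linarith

lemma thinCircle_mem_upper (hn : NarrowCircle y ε ρ) (hρ : 0 < ρ) {j : Fin 4}
    (hj : (y j).im < g (tilt ε (y j))) {t : I} (ht : quarter ≤ t) (ht' : t ≤ threeQuarters) :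
    thinCircle (y j) ε ρ t ∈ slitRegion (range y) ε g := by
  rintro _ ⟨k, rfl⟩ hk
  obtain ⟨rfl, hsin⟩ := hn.eq_of_tilt hρ hk
  refine mul_pos ?_ (sub_pos.2 hj)
  rw [im_thinCircle, hsin]
  have hπ := Real.pi_pos
  have hcos : Real.cos (2 * Real.pi * t) ≤ 0 := by
    have ht : 1 / 4 ≤ (t : ℝ) := ht
    have ht' : (t : ℝ) ≤ 3 / 4 := ht'
    exact Real.cos_nonpos_of_pi_div_two_le_of_le (by nlinarith) (by nlinarith)
  have h1 : Real.cos (2 * Real.pi * t) = -1 := by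
    rcases Real.sin_eq_zero_iff_cos_eq.1 hsin with h | h
    · linarith
    · exact h
  rw [h1]
  linarith

/-- The points of the punctured plane to the right and to the left of the `j`-th point. -/
def SmallTilt.circlePoint (h : SmallTilt y s l ε) (hy : range y = S) (hρ : 0 < ρ) (hρε : ρ ≤ ε)
    (j : Fin 4) (t : I) : ↥(Sᶜ) := ⟨thinCircle (y j) ε ρ t, h.thinCircle_mem hy hρ hρε j t⟩

lemma circlePoint_mem_lower (h : SmallTilt y s l ε) (hy : range y = S) (hρ : 0 < ρ)
    (hρε : ρ ≤ ε) (hn : NarrowCircle y ε ρ) (hb : PassesBelow S ε g) {j : Fin 4} {t : I}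
    (ht : t ≤ quarter ∨ threeQuarters ≤ t) : h.circlePoint hy hρ hρε j t ∈ slitSet S ε g := by
  subst hy
  exact thinCircle_mem_lower hn hρ hb ht

lemma circlePoint_mem_upper (h : SmallTilt y s l ε) (hy : range y = S) (hρ : 0 < ρ)
    (hρε : ρ ≤ ε) (hn : NarrowCircle y ε ρ) {j : Fin 4} (hj : (y j).im < g (tilt ε (y j)))
    {t : I} (ht : quarter ≤ t) (ht' : t ≤ threeQuarters) :
    h.circlePoint hy hρ hρε j t ∈ slitSet S ε g := by
  subst hy
  exact thinCircle_mem_upper hn hρ hj ht ht'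

lemma quarter_le_threeQuarters : quarter ≤ threeQuarters := by
  change (1 / 4 : ℝ) ≤ 3 / 4
  norm_num

/-- A lasso passes below all points except for a half-turn above one of them. -/
lemma SmallTilt.loopClass_loop (h : SmallTilt y s l ε) (hy : range y = S)
    (hs : ∀ z ∈ S, z.re < s) (hρ : 0 < ρ) (hρε : ρ ≤ ε) (hn : NarrowCircle y ε ρ) (j : Fin 4)
    (hg₀ : Separates S ε s l g₀) (hb : PassesBelow S ε g₀)
    (hg : Separates S ε s l g) (hj : (y j).im < g (tilt ε (y j))) :
    loopClass hs (h.loop hy hs hρ hρε j) = fiberClass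
      ((pathClassIn hg₀.isSimplyConnected (hg₀.basePoint_mem hs)
        (circlePoint_mem_lower h hy hρ hρε hn hb (j := j) (t := quarter) (.inl le_rfl))).trans
      ((pathClassIn hg.isSimplyConnected
        (circlePoint_mem_upper h hy hρ hρε hn hj le_rfl quarter_le_threeQuarters)
        (circlePoint_mem_upper h hy hρ hρε hn hj quarter_le_threeQuarters le_rfl)).trans
      (pathClassIn hg₀.isSimplyConnected
        (circlePoint_mem_lower h hy hρ hρε hn hb (.inr le_rfl)) (hg₀.basePoint_mem hs)))) := by
  have he : y j + ρ * (ε - Complex.I) ∈ Sᶜ := by simpa using h.thinTail_mem hy hρ j 1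
  have hb' : (s : ℂ) ∈ Sᶜ := (basePoint hs).2
  set T : Path (basePoint hs) ⟨_, he⟩ := (thinTail s (y j) ε ρ).intoSet
    (h.thinTail_mem hy hρ j) hb' he with hT
  set R : Path (⟨_, he⟩ : ↥(Sᶜ)) ⟨_, he⟩ := (thinCircle (y j) ε ρ).intoSet
    (h.thinCircle_mem hy hρ hρε j) he he with hR
  have hTm : ∀ t, T t ∈ slitSet S ε g₀ := by
    intro t
    refine hb.mem_slitRegion fun v hv hk => ?_
    obtain ⟨k, rfl⟩ : v ∈ range y := hy ▸ hv
    exact h.thinTail_below hρ j k t hk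
  have hem : (⟨_, he⟩ : ↥(Sᶜ)) ∈ slitSet S ε g₀ := by simpa using hTm 1
  have hloop : h.loop hy hs hρ hρε j = (T.trans R).trans T.symm := by
    have hTR : ∀ t, ((thinTail s (y j) ε ρ).trans (thinCircle (y j) ε ρ)) t ∈ Sᶜ := fun t => by
      have ht : ((thinTail s (y j) ε ρ).trans (thinCircle (y j) ε ρ)) t ∈
        range ((thinTail s (y j) ε ρ).trans (thinCircle (y j) ε ρ)) := mem_range_self t
      rw [Path.trans_range] at ht
      rcases ht with ⟨u, hu⟩ | ⟨u, hu⟩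
      · rw [← hu]; exact h.thinTail_mem hy hρ j u
      · rw [← hu]; exact h.thinCircle_mem hy hρ hρε j u
    have e1 : (((thinTail s (y j) ε ρ).trans (thinCircle (y j) ε ρ)).intoSet hTR hb' he) =
        T.trans R := Path.intoSet_trans _ _ (h.thinTail_mem hy hρ j)
          (h.thinCircle_mem hy hρ hρε j) hTR hb' he he
    exact (Path.intoSet_trans _ _ hTR (fun t => h.thinTail_mem hy hρ j _)
      (h.thinLasso_mem hy hρ hρε j) hb' he hb').trans (congrArg (fun p => Path.trans p T.symm) e1)
  have hRc : Path.Homotopic.Quotient.mk R =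
      (pathClassIn hg₀.isSimplyConnected hem
        (circlePoint_mem_lower h hy hρ hρε hn hb (j := j) (t := quarter) (.inl le_rfl))).trans
      ((pathClassIn hg.isSimplyConnected
        (circlePoint_mem_upper h hy hρ hρε hn hj le_rfl quarter_le_threeQuarters)
        (circlePoint_mem_upper h hy hρ hρε hn hj quarter_le_threeQuarters le_rfl)).trans
      (pathClassIn hg₀.isSimplyConnected
        (circlePoint_mem_lower h hy hρ hρε hn hb (.inr le_rfl)) hem)) :=
    mk_eq_trans_pathClassIn hg₀.isSimplyConnected hg.isSimplyConnected
      hg₀.isSimplyConnected R quarter threeQuarters quarter_le_threeQuarters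
      (fun t ht => circlePoint_mem_lower h hy hρ hρε hn hb (.inl ht))
      (fun t ht ht' => circlePoint_mem_upper h hy hρ hρε hn hj ht ht')
      (fun t ht => circlePoint_mem_lower h hy hρ hρε hn hb (.inr ht)) hem hem
  have hTc := mk_eq_pathClassIn hg₀.isSimplyConnected T hTm (hg₀.basePoint_mem hs) hem
  rw [hloop]
  change fiberClass (Path.Homotopic.Quotient.mk ((T.trans R).trans T.symm)) = _
  rw [Path.Homotopic.Quotient.mk_trans, Path.Homotopic.Quotient.mk_trans,
    Path.Homotopic.Quotient.mk_symm, hRc, hTc, pathClassIn_symm]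
  congr 1
  simp only [Path.Homotopic.Quotient.trans_assoc]
  rw [pathClassIn_trans, ← Path.Homotopic.Quotient.trans_assoc, pathClassIn_trans]

end Lasso

section Step

variable {S : Set ℂ} {y : Fin 4 → ℂ} {s l ε ρ : ℝ} {g₀ g g' : ℝ → ℝ}

lemma circlePoint_mem (h : SmallTilt y s l ε) (hy : range y = S) (hρ : 0 < ρ)
    (hρε : ρ ≤ ε) (hn : NarrowCircle y ε ρ) {j : Fin 4} {t : I}
    (ht : Real.sin (2 * Real.pi * t) ≠ 0) (g : ℝ → ℝ) :
    h.circlePoint hy hρ hρε j t ∈ slitSet S ε g := by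
  subst hy
  rintro _ ⟨k, rfl⟩ hk
  exact absurd (hn.eq_of_tilt hρ hk).2 ht

lemma sin_quarter : Real.sin (2 * Real.pi * (quarter : ℝ)) = 1 := by
  rw [show 2 * Real.pi * (quarter : ℝ) = Real.pi / 2 by simp only [quarter]; ring,
    Real.sin_pi_div_two]

lemma sin_threeQuarters : Real.sin (2 * Real.pi * (threeQuarters : ℝ)) = -1 := by
  rw [show 2 * Real.pi * (threeQuarters : ℝ) = Real.pi / 2 + Real.pi by
    simp only [threeQuarters]; ring, Real.sin_add_pi, Real.sin_pi_div_two]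

/-- If the graph of `g'` passes above the `k`-th point, and below all further points, then the loop
along it is the loop along the graph that passes below the `k`-th point, too, followed by the lasso
around this point. -/
lemma SmallTilt.loopClass_sepLoop_step (h : SmallTilt y s l ε) (hy : range y = S)
    (hs : ∀ z ∈ S, z.re < s) (hl : ∀ z ∈ S, l < z.re)
    (hρ : 0 < ρ) (hρε : ρ ≤ ε) (hn : NarrowCircle y ε ρ) (k : Fin 4)
    (hg₀ : Separates S ε s l g₀) (hb : PassesBelow S ε g₀)
    (hg : Separates S ε s l g) (hg' : Separates S ε s l g')
    (hlt : ∀ j < k, 0 < (g (tilt ε (y j)) - (y j).im) * (g' (tilt ε (y j)) - (y j).im))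
    (hge : ∀ j, k ≤ j → g (tilt ε (y j)) < (y j).im)
    (hk : (y k).im < g' (tilt ε (y k)))
    (hgt : ∀ j, k < j → g' (tilt ε (y j)) < (y j).im) :
    loopClass hs (sepLoop hg' hg₀ hs hl) =
      loopClass hs (sepLoop hg hg₀ hs hl) * loopClass hs (h.loop hy hs hρ hρε k) := by
  have hδ : 0 < ρ * (1 + ε ^ 2) := by positivity
  set z₁ := h.circlePoint hy hρ hρε k quarter with hz₁
  set z₂ := h.circlePoint hy hρ hρε k threeQuarters with hz₂
  have hm₁ : ∀ g, z₁ ∈ slitSet S ε g := circlePoint_mem h hy hρ hρε hn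
    (by rw [sin_quarter]; exact one_ne_zero)
  have hm₂ : ∀ g, z₂ ∈ slitSet S ε g := circlePoint_mem h hy hρ hρε hn
    (by rw [sin_threeQuarters]; norm_num)
  have ht₁ : tilt ε (z₁ : ℂ) = tilt ε (y k) + ρ * (1 + ε ^ 2) := by
    change tilt ε (thinCircle _ _ _ _) = _
    rw [tilt_thinCircle, sin_quarter, mul_one]
  have ht₂ : tilt ε (z₂ : ℂ) = tilt ε (y k) - ρ * (1 + ε ^ 2) := by
    change tilt ε (thinCircle _ _ _ _) = _
    rw [tilt_thinCircle, sin_threeQuarters, mul_neg_one, sub_eq_add_neg]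
  have hbs : tilt ε (basePoint hs : ℂ) = s := tilt_ofReal _ _
  have hlp : tilt ε (leftPoint hl : ℂ) = l := tilt_ofReal _ _
  have hgap : ∀ j, j < k → tilt ε (y k) + ρ * (1 + ε ^ 2) < tilt ε (y j) := fun j hj => by
    have h1 := hn j k hj.ne
    rw [abs_of_pos (sub_pos.2 (h.lt _ _ hj))] at h1
    linarith
  have hgap' : ∀ j, k < j → tilt ε (y j) < tilt ε (y k) - ρ * (1 + ε ^ 2) := fun j hj => by
    have h1 := hn k j hj.ne
    rw [abs_of_pos (sub_pos.2 (h.lt _ _ hj))] at h1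
    linarith
  have hright : ∀ j, tilt ε (y j) ∈ uIcc (tilt ε (basePoint hs : ℂ)) (tilt ε (z₁ : ℂ)) → j < k := by
    intro j hj
    by_contra hjk
    rw [hbs, ht₁, mem_uIcc] at hj
    have h2 := h.lt_right j
    rcases (not_lt.1 hjk).eq_or_lt with rfl | h3
    · rcases hj with hj | hj <;> linarith
    · have := hgap' j h3
      rcases hj with hj | hj <;> linarith
  have hleft₁ : ∀ j, tilt ε (y j) ∈ uIcc (tilt ε (z₁ : ℂ)) (tilt ε (leftPoint hl : ℂ)) → k ≤ j := by
    intro j hj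
    by_contra hjk
    rw [hlp, ht₁, mem_uIcc] at hj
    have := hgap j (not_le.1 hjk)
    have h2 := h.left_lt j
    rcases hj with hj | hj <;> linarith
  have hleft₂ : ∀ j, tilt ε (y j) ∈ uIcc (tilt ε (z₂ : ℂ)) (tilt ε (leftPoint hl : ℂ)) → k < j := by
    intro j hj
    by_contra hjk
    rw [hlp, ht₂, mem_uIcc] at hj
    have h2 := h.left_lt j
    rcases (not_lt.1 hjk).eq_or_lt with rfl | h3
    · rcases hj with hj | hj <;> linarith
    · have := hgap j h3
      rcases hj with hj | hj <;> linarith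
  have hnn : ∀ {a b c : ℝ}, a < c → b < c → 0 < (a - c) * (b - c) := fun h1 h2 =>
    mul_pos_of_neg_of_neg (sub_neg.2 h1) (sub_neg.2 h2)
  have c1 : pathClassIn hg'.isSimplyConnected (hg'.basePoint_mem hs) (hm₁ _) =
      pathClassIn hg.isSimplyConnected (hg.basePoint_mem hs) (hm₁ _) := by
    refine (pathClassIn_slitSet_congr hg hg' _ _ _ _ fun v hv hv' => ?_).symm
    obtain ⟨j, rfl⟩ : v ∈ range y := hy ▸ hv
    exact hlt j (hright j hv')
  have c2 : pathClassIn hg'.isSimplyConnected (hm₂ _) (hg'.leftPoint_mem hl) =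
      pathClassIn hg₀.isSimplyConnected (hm₂ _) (hg₀.leftPoint_mem hl) := by
    refine (pathClassIn_slitSet_congr hg' hg₀ _ _ _ _ fun v hv hv' => ?_)
    have hv₀ := hb v hv
    obtain ⟨j, rfl⟩ : v ∈ range y := hy ▸ hv
    exact hnn (hgt j (hleft₂ j hv')) hv₀
  have c3 : pathClassIn hg.isSimplyConnected (hm₁ _) (hg.leftPoint_mem hl) =
      pathClassIn hg₀.isSimplyConnected (hm₁ _) (hg₀.leftPoint_mem hl) := by
    refine (pathClassIn_slitSet_congr hg hg₀ _ _ _ _ fun v hv hv' => ?_)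
    have hv₀ := hb v hv
    obtain ⟨j, rfl⟩ : v ∈ range y := hy ▸ hv
    exact hnn (hge j (hleft₁ j hv')) hv₀
  rw [h.loopClass_loop hy hs hρ hρε hn k hg₀ hb hg' hk, loopClass_sepLoop, loopClass_sepLoop,
    ← fiberClass_trans,
    ← pathClassIn_trans hg'.isSimplyConnected (hg'.basePoint_mem hs) (hm₁ _)
      (hg'.leftPoint_mem hl),
    ← pathClassIn_trans hg'.isSimplyConnected (hm₁ _) (hm₂ _) (hg'.leftPoint_mem hl),
    ← pathClassIn_trans hg.isSimplyConnected (hg.basePoint_mem hs) (hm₁ _) (hg.leftPoint_mem hl),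
    c1, c2, c3]
  congr 1
  simp only [Path.Homotopic.Quotient.trans_assoc]
  congr 1
  rw [← Path.Homotopic.Quotient.trans_assoc _ _ (Path.Homotopic.Quotient.trans _ _),
    ← Path.Homotopic.Quotient.trans_assoc _ _ (Path.Homotopic.Quotient.trans _ _),
    pathClassIn_trans, pathClassIn_trans, pathClassIn_trans, pathClassIn_self,
    Path.Homotopic.Quotient.refl_trans]

end Step

open Classical in
/-- The product of the generators with indices in a given set, in the natural order. -/
def subword (e : Fin 4 → Prop) : FreeGroup (Fin 4) :=
  (if e 0 then FreeGroup.of 0 else 1) * (if e 1 then FreeGroup.of 1 else 1) *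
    (if e 2 then FreeGroup.of 2 else 1) * (if e 3 then FreeGroup.of 3 else 1)

section Static

variable {S : Set ℂ} {y : Fin 4 → ℂ} {s l : ℝ}

lemma exists_scale (hy : IsLexOrdering S y) (hs : ∀ z ∈ S, z.re < s) (hl : ∀ z ∈ S, l < z.re)
    {δ : ℝ} (hδ : 0 < δ) : ∃ ε ρ : ℝ, SmallTilt y s l ε ∧ ε < δ ∧
      (∀ j, ε ≤ (exists_lasso_scale hy hs j).choose) ∧ 0 < ρ ∧ ρ ≤ ε ∧ NarrowCircle y ε ρ := by
  have h1 : ∀ᶠ ε in 𝓝[>] (0 : ℝ), ∀ j, ε ≤ (exists_lasso_scale hy hs j).choose :=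
    eventually_all.2 fun j => (eventually_le_nhds
      (exists_lasso_scale hy hs j).choose_spec.1).filter_mono nhdsWithin_le_nhds
  obtain ⟨ε, hε, hεδ, hε'⟩ := ((eventually_smallTilt hy hs hl).and
    (((eventually_lt_nhds hδ).filter_mono nhdsWithin_le_nhds).and h1)).exists
  have h2 : ∀ᶠ ρ in 𝓝[>] (0 : ℝ), NarrowCircle y ε ρ := by
    refine eventually_all.2 fun i => eventually_all.2 fun j => eventually_imp_distrib_left.2
      fun hij => ?_
    have : Continuous fun ρ : ℝ => ρ * (1 + ε ^ 2) := by fun_prop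
    refine ((this.tendsto 0).eventually_lt_const ?_).filter_mono nhdsWithin_le_nhds
    rw [zero_mul]
    exact abs_pos.2 (sub_ne_zero.2 (hε.tilt_ne hij))
  obtain ⟨ρ, hρ, hρε, hn⟩ := ((eventually_mem_nhdsWithin (a := (0 : ℝ)) (s := Ioi 0)).and
    (((eventually_le_nhds hε.pos).filter_mono nhdsWithin_le_nhds).and h2)).exists
  exact ⟨ε, ρ, hε, hεδ, hε', hρ, hρε, hn⟩

/-- The class of the loop along the graphs of two functions, the second one below all points, in
terms of the canonical basis. -/
theorem loopClass_sepLoop_eq_canonicalBasis (hy : IsLexOrdering S y) (hs : ∀ z ∈ S, z.re < s)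
    (hl : ∀ z ∈ S, l < z.re) {g g₀ : ℝ → ℝ} (hg : Separates S 0 s l g)
    (hg₀ : Separates S 0 s l g₀) (hb : PassesBelow S 0 g₀) :
    loopClass hs (sepLoop hg hg₀ hs hl) =
      canonicalBasis hy hs (subword fun j => (y j).im < g (y j).re) := by
  classical
  have hev : ∀ {g : ℝ → ℝ}, Separates S 0 s l g → ∀ᶠ ε in 𝓝 (0 : ℝ), ∀ j,
      0 < (g (tilt ε (y j)) - (y j).im) * (g (y j).re - (y j).im) := by
    intro g hg
    refine eventually_all.2 fun j => ?_
    have hc := hg.continuous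
    have : Continuous fun ε => (g (tilt ε (y j)) - (y j).im) * (g (y j).re - (y j).im) := by
      unfold tilt; fun_prop
    refine (this.tendsto 0).eventually_const_lt ?_
    rw [tilt_zero]
    have := hg.ne (y j) (hy.1 ▸ mem_range_self j)
    rw [tilt_zero] at this
    exact mul_self_pos.2 (sub_ne_zero.2 this)
  obtain ⟨δ, hδ, hδ'⟩ := Metric.eventually_nhds_iff.1 ((hev hg).and (hev hg₀))
  obtain ⟨ε, ρ, hε, hεδ, hεc, hρ, hρε, hn⟩ := exists_scale hy hs hl hδ
  have hu : ∀ u : I, dist (u * ε) 0 < δ := fun u => by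
    rw [Real.dist_0_eq_abs, abs_of_nonneg (mul_nonneg u.2.1 hε.pos.le)]
    exact (mul_le_of_le_one_left hε.pos.le u.2.2).trans_lt hεδ
  have hε1 : dist ε 0 < δ := by simpa using hu 1
  have hne : ∀ {a b c : ℝ}, 0 < (a - c) * (b - c) → a ≠ c := by
    rintro a b c h rfl
    simp at h
  have hg' : Separates S ε s l g := ⟨hg.continuous, hg.right, hg.left, fun v hv => by
    obtain ⟨j, rfl⟩ : v ∈ range y := hy.1 ▸ hv
    exact hne ((hδ' hε1).1 j)⟩
  have hg₀' : Separates S ε s l g₀ := ⟨hg₀.continuous, hg₀.right, hg₀.left, fun v hv => by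
    obtain ⟨j, rfl⟩ : v ∈ range y := hy.1 ▸ hv
    exact hne ((hδ' hε1).2 j)⟩
  have hneg : ∀ {a b c : ℝ}, 0 < (a - c) * (b - c) → b < c → a < c := fun h h' => by
    by_contra h2
    have := mul_nonpos_of_nonneg_of_nonpos (sub_nonneg.2 (not_lt.1 h2)) (sub_neg.2 h').le
    linarith
  have hpos : ∀ {a b c : ℝ}, 0 < (a - c) * (b - c) → c < b → c < a := fun h h' => by
    by_contra h2
    have := mul_nonpos_of_nonpos_of_nonneg (sub_nonpos.2 (not_lt.1 h2)) (sub_pos.2 h').le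
    linarith
  have hb' : PassesBelow S ε g₀ := fun v hv => by
    have := hb v hv
    obtain ⟨j, rfl⟩ : v ∈ range y := hy.1 ▸ hv
    rw [tilt_zero] at this
    exact hneg ((hδ' hε1).2 j) this
  rw [loopClass_sepLoop_tilt hg hg₀ hg' hg₀' hs hl
    (fun u v hv => by
      obtain ⟨j, rfl⟩ : v ∈ range y := hy.1 ▸ hv
      exact hne ((hδ' (hu u)).1 j))
    (fun u v hv => by
      obtain ⟨j, rfl⟩ : v ∈ range y := hy.1 ▸ hv
      exact hne ((hδ' (hu u)).2 j))]
  have hpat : ∀ j, (y j).im < g (tilt ε (y j)) ↔ (y j).im < g (y j).re := fun j =>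
    ⟨fun h1 => hpos (by rw [mul_comm]; exact (hδ' hε1).1 j) h1, hpos ((hδ' hε1).1 j)⟩
  -- the functions that pass above the first points like `g`, and below the others
  have hex : ∀ n : ℕ, ∃ f, Separates S ε s l f ∧
      ∀ j, (y j).im < f (tilt ε (y j)) ↔ ((y j).im < g (y j).re ∧ (j : ℕ) < n) := by
    intro n
    rw [← hy.1]
    refine exists_separates hε.left_lt hε.lt_right _ ?_
    intro i j hij h1 h2
    have : i = j := by
      by_contra hne
      exact hε.tilt_ne hne hij
    exact absurd (this ▸ h2) h1
  choose f hf hfp using hex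
  have hfn : ∀ n j, ¬ ((y j).im < g (y j).re ∧ (j : ℕ) < n) → f n (tilt ε (y j)) < (y j).im :=
    fun n j hj => lt_of_le_of_ne (not_lt.1 ((hfp n j).not.2 hj))
      ((hf n).ne _ (hy.1 ▸ mem_range_self j))
  have hsame : ∀ n m j, ((y j).im < g (y j).re ∧ (j : ℕ) < n ↔
      (y j).im < g (y j).re ∧ (j : ℕ) < m) →
      0 < (f n (tilt ε (y j)) - (y j).im) * (f m (tilt ε (y j)) - (y j).im) := by
    intro n m j hj
    by_cases h1 : (y j).im < g (y j).re ∧ (j : ℕ) < n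
    · exact mul_pos (sub_pos.2 ((hfp n j).2 h1)) (sub_pos.2 ((hfp m j).2 (hj.1 h1)))
    · exact mul_pos_of_neg_of_neg (sub_neg.2 (hfn n j h1)) (sub_neg.2 (hfn m j (hj.not.1 h1)))
  have hstep : ∀ k : Fin 4, loopClass hs (sepLoop (hf (k + 1)) hg₀' hs hl) =
      loopClass hs (sepLoop (hf k) hg₀' hs hl) *
        canonicalBasis hy hs (if (y k).im < g (y k).re then FreeGroup.of k else 1) := by
    intro k
    split_ifs with hk
    · rw [canonicalBasis, FreeGroup.lift_apply_of,
        loopClass_canonicalLoop hε hy hs hρ hρε k (hεc k)]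
      refine hε.loopClass_sepLoop_step hy.1 hs hl hρ hρε hn k hg₀' hb' (hf k) (hf (k + 1)) ?_ ?_ ?_ ?_
      · intro j hj
        have : (j : ℕ) < k := hj
        exact hsame _ _ _ (and_congr_right fun _ => by omega)
      · intro j hj
        have : (k : ℕ) ≤ j := hj
        exact hfn _ _ fun h => by omega
      · exact (hfp _ _).2 ⟨hk, by omega⟩
      · intro j hj
        have : (k : ℕ) < j := hj
        exact hfn _ _ fun h => by omega
    · rw [map_one, mul_one]
      refine loopClass_sepLoop_congr _ _ _ _ hs hl (fun v hv => ?_) (fun v hv => ?_)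
      · obtain ⟨j, rfl⟩ : v ∈ range y := hy.1 ▸ hv
        refine hsame _ _ _ (and_congr_right fun hj => ?_)
        have : (j : ℕ) ≠ k := fun h => hk (Fin.ext h ▸ hj)
        omega
      · exact mul_self_pos.2 (sub_ne_zero.2 (hg₀'.ne v hv))
  have h0 : loopClass hs (sepLoop (hf 0) hg₀' hs hl) = 1 := by
    rw [loopClass_sepLoop_congr (hf 0) hg₀' hg₀' hg₀' hs hl (fun v hv => ?_)
      (fun v hv => mul_self_pos.2 (sub_ne_zero.2 (hg₀'.ne v hv))), loopClass_sepLoop,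
      pathClassIn_trans, pathClassIn_self]
    · rfl
    · have hv' := hb' v hv
      obtain ⟨j, rfl⟩ : v ∈ range y := hy.1 ▸ hv
      exact mul_pos_of_neg_of_neg (sub_neg.2 (hfn 0 j (by simp))) (sub_neg.2 hv')
  have h4 : loopClass hs (sepLoop hg' hg₀' hs hl) = loopClass hs (sepLoop (hf 4) hg₀' hs hl) := by
    refine loopClass_sepLoop_congr _ _ _ _ hs hl (fun v hv => ?_)
      (fun v hv => mul_self_pos.2 (sub_ne_zero.2 (hg₀'.ne v hv)))
    have hgv := hg'.ne v hv
    obtain ⟨j, rfl⟩ : v ∈ range y := hy.1 ▸ hv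
    by_cases hj : (y j).im < g (y j).re
    · exact mul_pos (sub_pos.2 ((hpat j).2 hj)) (sub_pos.2 ((hfp 4 j).2 ⟨hj, j.2⟩))
    · exact mul_pos_of_neg_of_neg
        (sub_neg.2 (lt_of_le_of_ne (not_lt.1 ((hpat j).not.2 hj)) hgv))
        (sub_neg.2 (hfn 4 j fun h => hj h.1))
  have s0 := hstep 0
  have s1 := hstep 1
  have s2 := hstep 2
  have s3 := hstep 3
  simp only [Fin.isValue, Fin.val_zero, Fin.val_one, Fin.val_two, zero_add, Nat.reduceAdd,
    show ((3 : Fin 4) : ℕ) = 3 from rfl] at s0 s1 s2 s3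
  rw [h4, s3, s2, s1, s0, h0, one_mul, subword, map_mul, map_mul, map_mul]

end Static

/-! ### Monodromy of trivialized families -/

section FiberMap

variable {S S' : Set ℂ} {s : ℝ} {hs : ∀ z ∈ S, z.re < s} {hs' : ∀ z ∈ S', z.re < s}

/-- The homomorphism induced by a map of punctured planes. -/
def fiberMap (f : C(↥(Sᶜ), ↥(S'ᶜ))) (hf : f (basePoint hs) = basePoint hs') :
    FiberGroup hs →* FiberGroup hs' :=
  (FundamentalGroup.mapOfEq f hf).op

lemma fiberMap_loopClass (f : C(↥(Sᶜ), ↥(S'ᶜ))) (hf : f (basePoint hs) = basePoint hs')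
    (ℓ : Path (basePoint hs) (basePoint hs)) : fiberMap f hf (loopClass hs ℓ) =
      loopClass hs' ((ℓ.map f.continuous).cast hf.symm hf.symm) :=
  congrArg MulOpposite.op (FundamentalGroup.mapOfEq_apply f hf _)

/-- The isomorphism induced by a homeomorphism of punctured planes. -/
def fiberEquiv (f : ↥(Sᶜ) ≃ₜ ↥(S'ᶜ)) (hf : f (basePoint hs) = basePoint hs') :
    FiberGroup hs ≃* FiberGroup hs' :=
  MonoidHom.toMulEquiv (fiberMap f hf)
    (fiberMap f.symm (by simp [← hf]))
    (by
      ext c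
      obtain ⟨ℓ, rfl⟩ := loopClass_surjective c
      rw [MonoidHom.comp_apply, fiberMap_loopClass, fiberMap_loopClass, MonoidHom.id_apply]
      congr 1
      ext t
      simp)
    (by
      ext c
      obtain ⟨ℓ, rfl⟩ := loopClass_surjective c
      rw [MonoidHom.comp_apply, fiberMap_loopClass, fiberMap_loopClass, MonoidHom.id_apply]
      congr 1
      ext t
      simp)

lemma fiberEquiv_loopClass (f : ↥(Sᶜ) ≃ₜ ↥(S'ᶜ)) (hf : f (basePoint hs) = basePoint hs')
    (ℓ : Path (basePoint hs) (basePoint hs)) : fiberEquiv f hf (loopClass hs ℓ) =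
      loopClass hs' ((ℓ.map f.continuous).cast hf.symm hf.symm) :=
  fiberMap_loopClass _ _ _

end FiberMap

/-- A family of punctured planes with a trivialization has a monodromy. -/
lemma exists_isMonodromy_of_trivialization {S : ℝ → Set ℂ} {a b s : ℝ}
    (ha : ∀ z ∈ S a, z.re < s) (hb : ∀ z ∈ S b, z.re < s) (S₀ : Set ℂ) (F G : I → ℂ → ℂ)
    (hF : Continuous fun p : I × ℂ => F p.1 p.2) (hG : Continuous fun p : I × ℂ => G p.1 p.2)
    (hGF : ∀ u z, G u (F u z) = z) (hFG : ∀ u z, F u (G u z) = z)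
    (hFS : ∀ (u : I) z, F u z ∈ S (a + (u : ℝ) * (b - a)) ↔ z ∈ S₀) (hs : ∀ u, F u s = s) :
    ∃ μ : FiberGroup ha ≃* FiberGroup hb, IsMonodromy S ha hb μ := by
  have hGS : ∀ (u : I) z, G u z ∈ S₀ ↔ z ∈ S (a + (u : ℝ) * (b - a)) := fun u z => by
    rw [← hFS u, hFG]
  have hF0 : ∀ z, F 0 z ∈ S a ↔ z ∈ S₀ := fun z => by simpa using hFS 0 z
  have hF1 : ∀ z, F 1 z ∈ S b ↔ z ∈ S₀ := fun z => by simpa using hFS 1 z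
  have hG0 : ∀ z, G 0 z ∈ S₀ ↔ z ∈ S a := fun z => by simpa using hGS 0 z
  have hG1 : ∀ z, G 1 z ∈ S₀ ↔ z ∈ S b := fun z => by simpa using hGS 1 z
  have hGs : ∀ u, G u s = s := fun u => by conv_lhs => rw [← hs u, hGF]
  have hFc : ∀ u, Continuous (F u) := fun u => hF.comp (by fun_prop : Continuous fun z => (u, z))
  have hGc : ∀ u, Continuous (G u) := fun u => hG.comp (by fun_prop : Continuous fun z => (u, z))
  let f : ↥((S a)ᶜ) ≃ₜ ↥((S b)ᶜ) :=
    { toFun := fun z => ⟨F 1 (G 0 z), fun h => z.2 ((hG0 _).1 ((hF1 _).1 h))⟩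
      invFun := fun z => ⟨F 0 (G 1 z), fun h => z.2 ((hG1 _).1 ((hF0 _).1 h))⟩
      left_inv := fun z => Subtype.ext (by simp only [hGF, hFG])
      right_inv := fun z => Subtype.ext (by simp only [hGF, hFG])
      continuous_toFun := Continuous.subtype_mk
        ((hFc 1).comp ((hGc 0).comp continuous_subtype_val)) _
      continuous_invFun := Continuous.subtype_mk
        ((hFc 0).comp ((hGc 1).comp continuous_subtype_val)) _ }
  have hf : f (basePoint ha) = basePoint hb := Subtype.ext (by
    change F 1 (G 0 s) = s
    rw [hGs, hs])
  refine ⟨fiberEquiv f hf, fun ℓ ℓ' => ?_⟩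
  rw [fiberEquiv_loopClass, loopClass_eq_iff]
  constructor
  · rintro ⟨h⟩
    have e0 : ∀ t, h (0, t) = f (ℓ t) := fun t => h.apply_zero t
    have e1 : ∀ t, h (1, t) = ℓ' t := fun t => h.apply_one t
    have es : ∀ u, h (u, 0) = basePoint hb := fun u => Path.Homotopy.source h u
    have et : ∀ u, h (u, 1) = basePoint hb := fun u => Path.Homotopy.target h u
    have hbs : G 1 (basePoint hb : ℂ) = s := hGs 1
    refine ⟨fun p => F p.1 (G 1 (h p)), ?_, ?_, ?_, ?_, ?_⟩
    · have h1 : Continuous fun p : I × I => (p.1, G 1 (h p)) := by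
        refine continuous_fst.prodMk ((hGc 1).comp ?_)
        exact continuous_subtype_val.comp h.continuous
      exact hF.comp h1
    · intro u t hm
      exact (h (u, t)).2 ((hG1 _).1 ((hFS _ _).1 hm))
    · intro t
      dsimp only
      rw [e0]
      change F 0 (G 1 (F 1 (G 0 (ℓ t)))) = ℓ t
      rw [hGF, hFG]
    · intro t
      dsimp only
      rw [e1, hFG]
    · intro u
      simp only [es, et, hbs, hs, and_self]
  · rintro ⟨H, hH, hm, h0, h1, hbase⟩
    have hnot : ∀ p : I × I, F 1 (G p.1 (H p)) ∈ (S b)ᶜ := fun p h =>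
      hm p.1 p.2 ((hGS _ _).1 ((hF1 _).1 h))
    refine homotopic_of_family (fun p => ⟨F 1 (G p.1 (H p)), hnot p⟩) ?_ ?_ ?_ ?_ ?_
    · refine Continuous.subtype_mk ((hFc 1).comp ?_) _
      exact hG.comp (continuous_fst.prodMk hH)
    · intro t
      apply Subtype.ext
      change F 1 (G 0 (H (0, t))) = F 1 (G 0 (ℓ t))
      rw [h0]
    · intro t
      apply Subtype.ext
      change F 1 (G 1 (H (1, t))) = ℓ' t
      rw [hFG, h1]
    · intro u
      apply Subtype.ext
      change F 1 (G u (H (u, 0))) = s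
      rw [(hbase u).1, hGs, hs]
    · intro u
      apply Subtype.ext
      change F 1 (G u (H (u, 1))) = s
      rw [(hbase u).2, hGs, hs]

section Composition

variable {S : ℝ → Set ℂ} {a b c s : ℝ} {ha : ∀ z ∈ S a, z.re < s} {hb : ∀ z ∈ S b, z.re < s}
  {hc : ∀ z ∈ S c, z.re < s}

lemma CarriedTo.trans (hac : a < c) (hcb : c < b) {ℓ : Path (basePoint ha) (basePoint ha)}
    {m : Path (basePoint hc) (basePoint hc)} {ℓ' : Path (basePoint hb) (basePoint hb)}
    (h : CarriedTo S ℓ m) (h' : CarriedTo S m ℓ') : CarriedTo S ℓ ℓ' := by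
  obtain ⟨H, hH, hm, h0, h1, hs⟩ := h
  obtain ⟨H', hH', hm', h0', h1', hs'⟩ := h'
  have hba : 0 < b - a := by linarith
  have hca : 0 < c - a := by linarith
  have hbc : 0 < b - c := by linarith
  set q : ℝ := (c - a) / (b - a) with hq
  have hqb : q * (b - a) = c - a := div_mul_cancel₀ _ hba.ne'
  let α : I → I := fun u => projIcc 0 1 zero_le_one ((u : ℝ) * (b - a) / (c - a))
  let β : I → I := fun u => projIcc 0 1 zero_le_one (((u : ℝ) * (b - a) - (c - a)) / (b - c))
  have hα : ∀ u : I, (u : ℝ) ≤ q → (α u : ℝ) = (u : ℝ) * (b - a) / (c - a) := fun u hu => by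
    have : (u : ℝ) * (b - a) ≤ c - a := by
      rw [← hqb]; exact mul_le_mul_of_nonneg_right hu hba.le
    simp only [α]
    rw [projIcc_of_mem zero_le_one ⟨div_nonneg (mul_nonneg u.2.1 hba.le) hca.le,
      (div_le_one hca).2 this⟩]
  have hβ : ∀ u : I, q ≤ (u : ℝ) → (β u : ℝ) = ((u : ℝ) * (b - a) - (c - a)) / (b - c) :=
      fun u hu => by
    have h1 : c - a ≤ (u : ℝ) * (b - a) := by
      rw [← hqb]; exact mul_le_mul_of_nonneg_right hu hba.le
    have h2 : (u : ℝ) * (b - a) - (c - a) ≤ b - c := by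
      have := mul_le_mul_of_nonneg_right u.2.2 hba.le
      linarith
    simp only [β]
    rw [projIcc_of_mem zero_le_one ⟨div_nonneg (by linarith) hbc.le, (div_le_one hbc).2 h2⟩]
  have hαc : Continuous α := continuous_projIcc.comp (by fun_prop)
  have hβc : Continuous β := continuous_projIcc.comp (by fun_prop)
  have hq0 : 0 < q := div_pos hca hba
  have hq1 : q < 1 := (div_lt_one hba).2 (by linarith)
  refine ⟨fun p => if (p.1 : ℝ) ≤ q then H (α p.1, p.2) else H' (β p.1, p.2), ?_, ?_, ?_, ?_, ?_⟩
  · refine Continuous.if_le (hH.comp (by fun_prop)) (hH'.comp (by fun_prop)) (by fun_prop)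
      continuous_const ?_
    rintro ⟨u, t⟩ hu
    change (u : ℝ) = q at hu
    have e1 : α u = 1 := by
      apply Subtype.ext
      rw [hα u hu.le, hu, hqb, div_self hca.ne']
      rfl
    have e2 : β u = 0 := by
      apply Subtype.ext
      rw [hβ u hu.ge, hu, hqb, sub_self, zero_div]
      rfl
    simp only [e1, e2, h1, h0']
  · intro u t
    dsimp only
    split_ifs with hu
    · have := hm (α u) t
      rwa [hα u hu, div_mul_cancel₀ _ hca.ne'] at this
    · have := hm' (β u) t
      rw [hβ u (not_le.1 hu).le, div_mul_cancel₀ _ hbc.ne'] at this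
      rwa [show a + (u : ℝ) * (b - a) = c + ((u : ℝ) * (b - a) - (c - a)) by ring]
  · intro t
    have e1 : α 0 = 0 := by
      apply Subtype.ext
      rw [hα 0 hq0.le]
      simp
    simp only [Icc.coe_zero, hq0.le, if_true, e1, h0]
  · intro t
    have e1 : β 1 = 1 := by
      apply Subtype.ext
      rw [hβ 1 hq1.le]
      simp only [Icc.coe_one, one_mul]
      rw [show b - a - (c - a) = b - c by ring, div_self hbc.ne']
    simp only [Icc.coe_one, not_le.2 hq1, if_false, e1, h1']
  · intro u
    dsimp only
    split_ifs
    · exact hs _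
    · exact hs' _

lemma CarriedTo.split (hac : a < c) (hcb : c < b) {ℓ : Path (basePoint ha) (basePoint ha)}
    {ℓ' : Path (basePoint hb) (basePoint hb)} (h : CarriedTo S ℓ ℓ') :
    ∃ m : Path (basePoint hc) (basePoint hc), CarriedTo S ℓ m ∧ CarriedTo S m ℓ' := by
  obtain ⟨H, hH, hm, h0, h1, hs⟩ := h
  have hba : 0 < b - a := by linarith
  have hq0 : 0 ≤ (c - a) / (b - a) := div_nonneg (by linarith) hba.le
  have hq1 : (c - a) / (b - a) ≤ 1 := (div_le_one hba).2 (by linarith)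
  let q : I := ⟨(c - a) / (b - a), hq0, hq1⟩
  have hqb : (q : ℝ) * (b - a) = c - a := div_mul_cancel₀ _ hba.ne'
  have hqc : ∀ t, H (q, t) ∈ (S c)ᶜ := fun t => by
    have := hm q t
    rwa [hqb, add_sub_cancel] at this
  let m : Path (basePoint hc) (basePoint hc) :=
    ⟨⟨fun t => ⟨H (q, t), hqc t⟩, Continuous.subtype_mk (hH.comp (by fun_prop)) _⟩,
      Subtype.ext (hs q).1, Subtype.ext (hs q).2⟩
  refine ⟨m, ⟨fun p => H (q * p.1, p.2), hH.comp ?_, ?_, ?_, ?_, fun u => hs _⟩,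
    ⟨fun p => H (σ (σ q * σ p.1), p.2), hH.comp ?_, ?_, ?_, ?_, fun u => hs _⟩⟩
  · fun_prop
  · intro u t
    rw [show a + (u : ℝ) * (c - a) = a + ((q * u : I) : ℝ) * (b - a) by
      rw [Icc.coe_mul, mul_right_comm, hqb]; ring]
    exact hm (q * u) t
  · intro t; simp [h0]
  · intro t; simp; rfl
  · fun_prop
  · intro u t
    rw [show c + (u : ℝ) * (b - c) = a + ((σ (σ q * σ u) : I) : ℝ) * (b - a) by
      simp only [unitInterval.coe_symm_eq, Icc.coe_mul]
      linear_combination ((u : ℝ) - 1) * hqb]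
    exact hm (σ (σ q * σ u)) t
  · intro t; simp; rfl
  · intro t; simp [h1]

lemma IsMonodromy.trans (hac : a < c) (hcb : c < b) {μ : FiberGroup ha ≃* FiberGroup hc}
    {ν : FiberGroup hc ≃* FiberGroup hb} (hμ : IsMonodromy S ha hc μ)
    (hν : IsMonodromy S hc hb ν) : IsMonodromy S ha hb (μ.trans ν) := by
  intro ℓ ℓ'
  rw [MulEquiv.trans_apply]
  constructor
  · intro h
    obtain ⟨m, hm⟩ := loopClass_surjective (μ (loopClass ha ℓ))
    rw [← hm] at h
    exact ((hμ ℓ m).1 hm.symm).trans hac hcb ((hν m ℓ').1 h)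
  · intro h
    obtain ⟨m, h1, h2⟩ := h.split (hc := hc) hac hcb
    rw [(hμ ℓ m).2 h1, (hν m ℓ').2 h2]

lemma HasMonodromy.trans (hac : a < c) (hcb : c < b) {y y' y'' : Fin 4 → ℂ}
    {hy : IsLexOrdering (S a) y} {hy' : IsLexOrdering (S c) y'} {hy'' : IsLexOrdering (S b) y''}
    {β β' : FreeAut} (h : HasMonodromy S ha hc hy hy' β) (h' : HasMonodromy S hc hb hy' hy'' β') :
    HasMonodromy S ha hb hy hy'' (β * β') := by
  obtain ⟨μ, hμ, e⟩ := h
  obtain ⟨ν, hν, e'⟩ := h'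
  refine ⟨μ.trans ν, hμ.trans hac hcb hν, fun w => ?_⟩
  rw [MulEquiv.trans_apply, e, e']
  rfl

end Composition

/-- A transitive relation between the points of a dense subset of a segment that holds locally
holds between the ends. -/
lemma rel_of_local {a b : ℝ} (hab : a ≤ b) {D : Set ℝ} (hD : Dense D) (ha : a ∈ D) (hb : b ∈ D)
    {R : ℝ → ℝ → Prop}
    (htrans : ∀ x y z, x ∈ Icc a b → y ∈ Icc a b → z ∈ Icc a b → y ∈ D → x < y → y < z →
      R x y → R y z → R x z)
    (hloc : ∀ x ∈ Icc a b, ∃ δ > 0, ∀ y ∈ Icc a b, ∀ z ∈ Icc a b, y ∈ D → z ∈ D →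
      |y - x| < δ → |z - x| < δ → y ≤ z → R y z) : R a b := by
  choose! δ hδ hR using hloc
  obtain ⟨d, hd, hcov⟩ := lebesgue_number_lemma_of_metric (s := Icc a b)
    (c := fun x : Icc a b => Metric.ball (x : ℝ) (δ x)) isCompact_Icc
    (fun _ => Metric.isOpen_ball)
    (fun x hx => mem_iUnion.2 ⟨⟨x, hx⟩, Metric.mem_ball_self (hδ x hx)⟩)
  have hsmall : ∀ y ∈ Icc a b, ∀ z ∈ Icc a b, y ∈ D → z ∈ D → y ≤ z → z - y < d → R y z := by
    intro y hy z hz hyD hzD hyz hd'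
    obtain ⟨x, hx⟩ := hcov y hy
    refine hR x x.2 y hy z hz hyD hzD (hx (Metric.mem_ball_self hd)) (hx ?_) hyz
    rwa [Metric.mem_ball, Real.dist_eq, abs_of_nonneg (sub_nonneg.2 hyz)]
  have hind : ∀ n : ℕ, ∀ y ∈ Icc a b, ∀ z ∈ Icc a b, y ∈ D → z ∈ D → y ≤ z →
      z - y < (n + 1) * (d / 2) → R y z := by
    intro n
    induction n with
    | zero =>
      intro y hy z hz hyD hzD hyz h
      exact hsmall y hy z hz hyD hzD hyz (by norm_num at h; linarith)
    | succ n ih =>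
      intro y hy z hz hyD hzD hyz h
      rcases lt_or_ge (z - y) d with h' | h'
      · exact hsmall y hy z hz hyD hzD hyz h'
      · obtain ⟨m, hmD, hm⟩ := hD.exists_between (show z - d < z - d / 2 by linarith)
        have h1 := hm.1
        have h2 := hm.2
        have hmI : m ∈ Icc a b := ⟨by linarith [hy.1], by linarith [hz.2]⟩
        refine htrans y m z hy hmI hz hmD (by linarith) (by linarith)
          (ih y hy m hmI hyD hmD (by linarith) ?_)
          (hsmall m hmI z hz hmD hzD (by linarith) (by linarith))
        push_cast at h
        linarith
  obtain ⟨n, hn⟩ := exists_nat_gt ((b - a) / (d / 2))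
  rw [div_lt_iff₀ (by linarith)] at hn
  exact hind n a (left_mem_Icc.2 hab) b (right_mem_Icc.2 hab) ha hb hab (by linarith)

/-! ### Moving points -/

section Isotopy

/-- The bump function around `v` of radius `η`. -/
def bump (η : ℝ) (v z : ℂ) : ℝ := max 0 (1 - ‖z - v‖ / η)

lemma bump_self (η : ℝ) (v : ℂ) : bump η v v = 1 := by simp [bump]

lemma bump_eq_zero {η : ℝ} (hη : 0 < η) {v z : ℂ} (h : η ≤ ‖z - v‖) : bump η v z = 0 := by
  rw [bump, max_eq_left]
  rw [sub_nonpos]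
  exact (one_le_div hη).2 h

lemma continuous_bump (η : ℝ) (v : ℂ) : Continuous (bump η v) := by unfold bump; fun_prop

lemma abs_bump_sub_le {η : ℝ} (hη : 0 < η) (v z z' : ℂ) :
    |bump η v z - bump η v z'| ≤ ‖z - z'‖ / η := by
  have h := abs_max_sub_max_le_abs (1 - ‖z - v‖ / η) (1 - ‖z' - v‖ / η) 0
  rw [max_comm _ 0, max_comm _ 0] at h
  refine h.trans ?_
  rw [show (1 - ‖z - v‖ / η) - (1 - ‖z' - v‖ / η) = (‖z' - v‖ - ‖z - v‖) / η by ring, abs_div,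
    abs_of_pos hη]
  gcongr
  rw [norm_sub_rev z z']
  refine (abs_norm_sub_norm_le _ _).trans_eq ?_
  congr 1
  ring

/-- The map that displaces each of the points `v k` by `d k`. -/
def displace (η : ℝ) (v d : Fin 4 → ℂ) (z : ℂ) : ℂ := z + ∑ k, bump η (v k) z * d k

variable {η : ℝ} {v d : Fin 4 → ℂ}

lemma norm_sub_le_displace (hη : 0 < η) (hd : ∑ k, ‖d k‖ ≤ η / 2) (z z' : ℂ) :
    ‖z - z'‖ ≤ 2 * ‖displace η v d z - displace η v d z'‖ := by
  have h1 : ‖∑ k, (bump η (v k) z * d k - bump η (v k) z' * d k)‖ ≤ ‖z - z'‖ / 2 := by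
    calc _ ≤ ∑ k, ‖(bump η (v k) z * d k - bump η (v k) z' * d k)‖ := norm_sum_le _ _
      _ ≤ ∑ k, ‖z - z'‖ / η * ‖d k‖ := by
        refine Finset.sum_le_sum fun k _ => ?_
        rw [← sub_mul, norm_mul, ← Complex.ofReal_sub, Complex.norm_real]
        exact mul_le_mul_of_nonneg_right (abs_bump_sub_le hη _ _ _) (norm_nonneg _)
      _ = ‖z - z'‖ / η * ∑ k, ‖d k‖ := by rw [Finset.mul_sum]
      _ ≤ ‖z - z'‖ / η * (η / 2) := by gcongr
      _ = ‖z - z'‖ / 2 := by field_simp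
  have h2 : z - z' = (displace η v d z - displace η v d z') -
      ∑ k, (bump η (v k) z * d k - bump η (v k) z' * d k) := by
    simp only [displace, Finset.sum_sub_distrib]
    ring
  have h3 := norm_sub_le (displace η v d z - displace η v d z')
    (∑ k, (bump η (v k) z * d k - bump η (v k) z' * d k))
  rw [← h2] at h3
  linarith

lemma displace_surjective (hη : 0 < η) (hd : ∑ k, ‖d k‖ ≤ η / 2) :
    Function.Surjective (displace η v d) := by
  intro w
  have hc : ContractingWith (1 / 2) fun z : ℂ => w - ∑ k, bump η (v k) z * d k := by
    refine ⟨by rw [← NNReal.coe_lt_coe]; norm_num, LipschitzWith.of_dist_le_mul fun z z' => ?_⟩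
    rw [dist_eq_norm, dist_eq_norm, sub_sub_sub_cancel_left, ← Finset.sum_sub_distrib]
    calc _ ≤ ∑ k, ‖(bump η (v k) z' * d k - bump η (v k) z * d k)‖ := norm_sum_le _ _
      _ ≤ ∑ k, ‖z - z'‖ / η * ‖d k‖ := by
        refine Finset.sum_le_sum fun k _ => ?_
        rw [← sub_mul, norm_mul, ← Complex.ofReal_sub, Complex.norm_real, norm_sub_rev z]
        exact mul_le_mul_of_nonneg_right (abs_bump_sub_le hη _ _ _) (norm_nonneg _)
      _ = ‖z - z'‖ / η * ∑ k, ‖d k‖ := by rw [Finset.mul_sum]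
      _ ≤ ‖z - z'‖ / η * (η / 2) := by gcongr
      _ = _ := by push_cast; field_simp
  refine ⟨hc.fixedPoint, ?_⟩
  have := hc.fixedPoint_isFixedPt
  rw [Function.IsFixedPt] at this
  rw [displace]
  nth_rewrite 1 [← this]
  ring

lemma displace_injective (hη : 0 < η) (hd : ∑ k, ‖d k‖ ≤ η / 2) :
    Function.Injective (displace η v d) := by
  intro z z' h
  have := norm_sub_le_displace (v := v) hη hd z z'
  rw [h, sub_self, norm_zero, mul_zero] at this
  exact sub_eq_zero.1 (norm_le_zero_iff.1 this)

lemma displace_apply_self (hη : 0 < η) (hv : ∀ i j, i ≠ j → η ≤ ‖v i - v j‖) (k : Fin 4) :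
    displace η v d (v k) = v k + d k := by
  rw [displace, Finset.sum_eq_single k]
  · simp [bump_self]
  · intro j _ hj
    simp [bump_eq_zero hη (hv k j hj.symm)]
  · simp

lemma displace_of_far (hη : 0 < η) {z : ℂ} (hz : ∀ k, η ≤ ‖z - v k‖) :
    displace η v d z = z := by
  simp [displace, bump_eq_zero hη (hz _)]

/-- The family of punctured planes over a segment has a monodromy if the points move little. -/
lemma exists_isMonodromy_of_near {S : ℝ → Set ℂ} {a b s : ℝ} (hab : a ≤ b)
    (ha : ∀ z ∈ S a, z.re < s) (hb : ∀ z ∈ S b, z.re < s) (hη : 0 < η)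
    (hv : ∀ i j, i ≠ j → η ≤ ‖v i - v j‖) (hsv : ∀ k, η ≤ ‖(s : ℂ) - v k‖)
    {w : ℝ → Fin 4 → ℂ} (hw : ContinuousOn w (Icc a b)) (hS : ∀ x ∈ Icc a b, range (w x) = S x)
    (hnear : ∀ x ∈ Icc a b, ∑ k, ‖w x k - v k‖ ≤ η / 2) :
    ∃ μ : FiberGroup ha ≃* FiberGroup hb, IsMonodromy S ha hb μ := by
  let x : I → ℝ := fun u => a + (u : ℝ) * (b - a)
  have hx : ∀ u, x u ∈ Icc a b := fun u => by
    have h0 := u.2.1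
    have h1 := u.2.2
    constructor <;> simp only [x] <;> nlinarith
  let d : I → Fin 4 → ℂ := fun u k => w (x u) k - v k
  have hd : ∀ u, ∑ k, ‖d u k‖ ≤ η / 2 := fun u => hnear _ (hx u)
  have hdc : Continuous d := by
    have h1 : Continuous fun u => w (x u) :=
      hw.comp_continuous (by simp only [x]; fun_prop) hx
    exact continuous_pi fun k => ((continuous_apply k).comp h1).sub continuous_const
  let F : I → ℂ → ℂ := fun u => displace η v (d u)
  let G : I → ℂ → ℂ := fun u => Function.surjInv (displace_surjective (v := v) hη (hd u))
  have hFG : ∀ u z, F u (G u z) = z := fun u z => Function.surjInv_eq _ _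
  have hGF : ∀ u z, G u (F u z) = z := fun u z => displace_injective hη (hd u) (hFG u _)
  have hF : Continuous fun p : I × ℂ => F p.1 p.2 := by
    refine continuous_snd.add (continuous_finsetSum _ fun k _ => ?_)
    refine Continuous.mul ?_ ?_
    · exact Complex.continuous_ofReal.comp ((continuous_bump η (v k)).comp continuous_snd)
    · exact (continuous_apply k).comp (hdc.comp continuous_fst)
  have hG : Continuous fun p : I × ℂ => G p.1 p.2 := by
    rw [continuous_iff_continuousAt]
    rintro ⟨u₀, z₀⟩
    rw [ContinuousAt, tendsto_iff_norm_sub_tendsto_zero]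
    have hc : Continuous fun p : I × ℂ => 2 * ‖p.2 - F p.1 (G u₀ z₀)‖ := by
      have : Continuous fun p : I × ℂ => F p.1 (G u₀ z₀) :=
        hF.comp (continuous_fst.prodMk continuous_const)
      fun_prop
    have ht := hc.tendsto (u₀, z₀)
    simp only [hFG, sub_self, norm_zero, mul_zero] at ht
    refine squeeze_zero (fun _ => norm_nonneg _) (fun p => ?_) ht
    have := norm_sub_le_displace (v := v) hη (hd p.1) (G p.1 p.2) (G u₀ z₀)
    rwa [show displace η v (d p.1) (G p.1 p.2) = p.2 from hFG _ _] at this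
  have hFv : ∀ u k, F u (v k) = w (x u) k := fun u k => by
    simp only [F]
    rw [displace_apply_self hη hv]
    simp [d]
  refine exists_isMonodromy_of_trivialization ha hb (range v) F G hF hG hGF hFG ?_
    (fun u => displace_of_far hη hsv)
  intro u z
  rw [← hS _ (hx u)]
  constructor
  · rintro ⟨k, hk⟩
    refine ⟨k, displace_injective (v := v) hη (hd u) ?_⟩
    exact (hFv u k).trans hk
  · rintro ⟨k, rfl⟩
    exact ⟨k, (hFv u k).symm⟩

end Isotopy

/-! ### Frames -/

/-- The points can be separated, for each `k`, by a function that passes above those with index at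
least `k` and below the others. -/
def IsFrame (w : Fin 4 → ℂ) : Prop := ∀ i j, i < j → (w i).re = (w j).re → (w j).im < (w i).im

lemma IsFrame.injective {w : Fin 4 → ℂ} (h : IsFrame w) : Function.Injective w := by
  intro i j hij
  by_contra hne
  rcases lt_or_gt_of_ne hne with h' | h'
  · exact (h i j h' (by rw [hij])).ne (by rw [hij])
  · exact (h j i h' (by rw [hij])).ne (by rw [hij])

lemma IsFrame.exists_separates {w : Fin 4 → ℂ} (h : IsFrame w) {s l : ℝ}
    (hs : ∀ j, (w j).re < s) (hl : ∀ j, l < (w j).re) (k : ℕ) :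
    ∃ g, Separates (range w) 0 s l g ∧ ∀ j : Fin 4, (w j).im < g (w j).re ↔ k ≤ j := by
  have := _root_.exists_separates (y := w) (ε := 0) (s := s) (l := l) (by simpa using hl)
    (by simpa using hs) (fun j => k ≤ j) (fun i j hij hi hj => ?_)
  · simpa using this
  · refine h i j ?_ (by simpa using hij)
    have : (i : ℕ) < j := by omega
    exact this

/-- The function passes above the points with index at least `k`, and the others. -/
structure SeparatesFrom (w : Fin 4 → ℂ) (s l : ℝ) (k : ℕ) (g : ℝ → ℝ) : Prop where
  separates : Separates (range w) 0 s l g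
  lt_iff : ∀ j : Fin 4, (w j).im < g (w j).re ↔ k ≤ j

lemma SeparatesFrom.mul_pos {w : Fin 4 → ℂ} {s l : ℝ} {k : ℕ} {g h : ℝ → ℝ}
    (hg : SeparatesFrom w s l k g) (hh : SeparatesFrom w s l k h) :
    ∀ v ∈ range w, 0 < (g (tilt 0 v) - v.im) * (h (tilt 0 v) - v.im) := by
  rintro _ ⟨j, rfl⟩
  have h1 := hg.separates.ne _ (mem_range_self j)
  have h2 := hh.separates.ne _ (mem_range_self j)
  rw [tilt_zero] at h1 h2 ⊢
  by_cases hj : k ≤ j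
  · exact _root_.mul_pos (sub_pos.2 ((hg.lt_iff j).2 hj)) (sub_pos.2 ((hh.lt_iff j).2 hj))
  · exact mul_pos_of_neg_of_neg
      (sub_neg.2 (lt_of_le_of_ne (not_lt.1 ((hg.lt_iff j).not.2 hj)) h1))
      (sub_neg.2 (lt_of_le_of_ne (not_lt.1 ((hh.lt_iff j).not.2 hj)) h2))

lemma coe_sepLoop_eq {S S' : Set ℂ} {ε s l : ℝ} {g g₀ : ℝ → ℝ}
    (hg : Separates S ε s l g) (hg₀ : Separates S ε s l g₀) (hs : ∀ z ∈ S, z.re < s)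
    (hl : ∀ z ∈ S, l < z.re) (hg' : Separates S' ε s l g) (hg₀' : Separates S' ε s l g₀)
    (hs' : ∀ z ∈ S', z.re < s) (hl' : ∀ z ∈ S', l < z.re) (t : I) :
    (sepLoop hg hg₀ hs hl t : ℂ) = sepLoop hg' hg₀' hs' hl' t := by
  simp only [sepLoop, Path.trans_apply]
  split_ifs <;> rfl

/-- Any loop between the graphs of the functions separating a frame is carried to a loop of the
same kind. -/
def CarriesFrame (S : ℝ → Set ℂ) (w : ℝ → Fin 4 → ℂ) (s l x z : ℝ) : Prop :=
  ∀ (hx : ∀ v ∈ S x, v.re < s) (hz : ∀ v ∈ S z, v.re < s) (hlx : ∀ v ∈ S x, l < v.re)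
    (hlz : ∀ v ∈ S z, l < v.re), ∃ μ : FiberGroup hx ≃* FiberGroup hz, IsMonodromy S hx hz μ ∧
    ∀ (k : Fin 4) (g g₀ h h₀ : ℝ → ℝ), SeparatesFrom (w x) s l k g →
      SeparatesFrom (w x) s l 4 g₀ → SeparatesFrom (w z) s l k h → SeparatesFrom (w z) s l 4 h₀ →
      ∀ (hg : Separates (S x) 0 s l g) (hg₀ : Separates (S x) 0 s l g₀)
      (hh : Separates (S z) 0 s l h) (hh₀ : Separates (S z) 0 s l h₀),
      μ (loopClass hx (sepLoop hg hg₀ hx hlx)) = loopClass hz (sepLoop hh hh₀ hz hlz)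

section Frames

variable {S : ℝ → Set ℂ} {w : ℝ → Fin 4 → ℂ} {s l a b : ℝ}

lemma carriesFrame_of_near (hw : ContinuousOn w (Icc a b))
    (hS : ∀ x ∈ Icc a b, range (w x) = S x) (hfr : ∀ x ∈ Icc a b, IsFrame (w x))
    (hs : ∀ x ∈ Icc a b, ∀ v ∈ S x, v.re < s) (hl : ∀ x ∈ Icc a b, ∀ v ∈ S x, l < v.re)
    {x : ℝ} (hx : x ∈ Icc a b) : ∃ δ > 0, ∀ y ∈ Icc a b, ∀ z ∈ Icc a b, |y - x| < δ →
      |z - x| < δ → y ≤ z → CarriesFrame S w s l y z := by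
  have hws : ∀ x ∈ Icc a b, ∀ j, (w x j).re < s := fun x hx j =>
    hs x hx _ (hS x hx ▸ mem_range_self j)
  have hwl : ∀ x ∈ Icc a b, ∀ j, l < (w x j).re := fun x hx j =>
    hl x hx _ (hS x hx ▸ mem_range_self j)
  choose g hg hgp using (hfr x hx).exists_separates (hws x hx) (hwl x hx)
  have hinj := (hfr x hx).injective
  have hη : ∃ η > 0, (∀ i j, i ≠ j → η ≤ ‖w x i - w x j‖) ∧ ∀ k, η ≤ ‖(s : ℂ) - w x k‖ := by
    have h1 : ∀ᶠ η in 𝓝[>] (0 : ℝ), ∀ i j, i ≠ j → η ≤ ‖w x i - w x j‖ :=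
      eventually_all.2 fun i => eventually_all.2 fun j => eventually_imp_distrib_left.2 fun hij =>
        (eventually_le_nhds (norm_pos_iff.2 (sub_ne_zero.2 (hinj.ne hij)))).filter_mono
          nhdsWithin_le_nhds
    have h2 : ∀ᶠ η in 𝓝[>] (0 : ℝ), ∀ k, η ≤ ‖(s : ℂ) - w x k‖ :=
      eventually_all.2 fun k => (eventually_le_nhds (norm_pos_iff.2 (sub_ne_zero.2 fun h =>
        (hws x hx k).ne (by rw [← h]; simp)))).filter_mono nhdsWithin_le_nhds
    obtain ⟨η, h3, h4⟩ := ((eventually_mem_nhdsWithin (a := (0 : ℝ)) (s := Ioi 0)).and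
      (h1.and h2)).exists
    exact ⟨η, h3, h4⟩
  obtain ⟨η, hη, hη1, hη2⟩ := hη
  have hwc := hw x hx
  have hwk : ∀ k, ContinuousWithinAt (fun x => w x k) (Icc a b) x := fun k =>
    ((continuous_apply k).continuousAt).comp_continuousWithinAt hwc
  have e1 : ∀ᶠ u in 𝓝[Icc a b] x, ∑ k, ‖w u k - w x k‖ ≤ η / 2 := by
    have : ContinuousWithinAt (fun u => ∑ k, ‖w u k - w x k‖) (Icc a b) x := by
      refine tendsto_finsetSum _ fun k _ => ?_
      exact ((hwk k).sub continuousWithinAt_const).norm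
    refine (this.tendsto.eventually_lt_const (u := η / 2) ?_).mono fun _ h => h.le
    simpa using hη
  have e2 : ∀ᶠ u in 𝓝[Icc a b] x, ∀ (k : Fin 5) (j : Fin 4),
      0 < (g k (w u j).re - (w u j).im) * (g k (w x j).re - (w x j).im) := by
    refine eventually_all.2 fun k => eventually_all.2 fun j => ?_
    have hre : ContinuousWithinAt (fun u => (w u j).re) (Icc a b) x :=
      Complex.continuous_re.continuousAt.comp_continuousWithinAt (hwk j)
    have him : ContinuousWithinAt (fun u => (w u j).im) (Icc a b) x :=
      Complex.continuous_im.continuousAt.comp_continuousWithinAt (hwk j)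
    have : ContinuousWithinAt (fun u => (g k (w u j).re - (w u j).im) *
        (g k (w x j).re - (w x j).im)) (Icc a b) x :=
      (((hg k).continuous.continuousAt.comp_continuousWithinAt hre).sub him).mul
        continuousWithinAt_const
    refine this.tendsto.eventually_const_lt ?_
    have h1 := (hg k).ne _ (mem_range_self j)
    rw [tilt_zero] at h1
    exact mul_self_pos.2 (sub_ne_zero.2 h1)
  obtain ⟨δ, hδ, hball⟩ := Metric.mem_nhdsWithin_iff.1 (e1.and e2)
  have hgood : ∀ u ∈ Icc a b, |u - x| < δ → ∑ k, ‖w u k - w x k‖ ≤ η / 2 ∧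
      ∀ k : Fin 5, SeparatesFrom (w u) s l k (g k) := by
    intro u hu hux
    obtain ⟨h1, h2⟩ := hball ⟨by rwa [Metric.mem_ball, Real.dist_eq], hu⟩
    refine ⟨h1, fun k => ⟨⟨(hg k).continuous, (hg k).right, (hg k).left, ?_⟩, fun j => ?_⟩⟩
    · rintro _ ⟨j, rfl⟩ h3
      have := h2 k j
      rw [tilt_zero] at h3
      rw [h3] at this
      simp at this
    · rw [← hgp k j]
      have := h2 k j
      constructor
      · intro h3
        exact sub_pos.1 ((pos_iff_pos_of_mul_pos this).1 (sub_pos.2 h3))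
      · intro h3
        exact sub_pos.1 ((pos_iff_pos_of_mul_pos this).2 (sub_pos.2 h3))
  refine ⟨δ, hδ, fun y hy z hz hyx hzx hyz hsy hsz hly hlz => ?_⟩
  have hsub : ∀ u ∈ Icc y z, u ∈ Icc a b ∧ |u - x| < δ := fun u hu => by
    refine ⟨⟨hy.1.trans hu.1, hu.2.trans hz.2⟩, ?_⟩
    rw [abs_lt] at hyx hzx ⊢
    constructor <;> linarith [hu.1, hu.2]
  obtain ⟨μ, hμ⟩ := exists_isMonodromy_of_near hyz hsy hsz hη hη1 hη2
    (hw.mono fun u hu => (hsub u hu).1) (fun u hu => hS u (hsub u hu).1)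
    (fun u hu => (hgood u (hsub u hu).1 (hsub u hu).2).1)
  have hsep : ∀ u ∈ Icc y z, ∀ k : Fin 5, Separates (S u) 0 s l (g k) := fun u hu k =>
    hS u (hsub u hu).1 ▸ ((hgood u (hsub u hu).1 (hsub u hu).2).2 k).separates
  have hy' := left_mem_Icc.2 hyz
  have hz' := right_mem_Icc.2 hyz
  refine ⟨μ, hμ, fun k p p₀ q q₀ hp hp₀ hq hq₀ hP hP₀ hQ hQ₀ => ?_⟩
  have hc : CarriedTo S (sepLoop (hsep y hy' k.castSucc) (hsep y hy' 4) hsy hly)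
      (sepLoop (hsep z hz' k.castSucc) (hsep z hz' 4) hsz hlz) := by
    refine ⟨fun v => sepLoop (hsep y hy' k.castSucc) (hsep y hy' 4) hsy hly v.2, ?_, ?_,
      fun t => rfl, fun t => coe_sepLoop_eq _ _ _ _ _ _ _ _ t, fun u => ?_⟩
    · exact continuous_subtype_val.comp ((Path.continuous _).comp continuous_snd)
    · intro u t
      have hu : y + (u : ℝ) * (z - y) ∈ Icc y z := by
        have h0 := u.2.1
        have h1 := u.2.2
        constructor <;> nlinarith
      have hu' := (hsub _ hu).1
      have e := coe_sepLoop_eq (hsep y hy' k.castSucc) (hsep y hy' 4) hsy hly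
        (hsep _ hu k.castSucc) (hsep _ hu 4) (hs _ hu') (hl _ hu') t
      dsimp only
      rw [e]
      exact Subtype.coe_prop (sepLoop _ _ _ _ t)
    · exact ⟨congrArg Subtype.val (Path.source _), congrArg Subtype.val (Path.target _)⟩
  have e := (hμ _ _).2 hc
  have hy'' := hsub y hy'
  have hz'' := hsub z hz'
  rw [loopClass_sepLoop_congr hP hP₀ (hsep y hy' k.castSucc) (hsep y hy' 4) hsy hly
      (hS y hy ▸ hp.mul_pos ((hgood y hy''.1 hy''.2).2 k.castSucc))
      (hS y hy ▸ hp₀.mul_pos ((hgood y hy''.1 hy''.2).2 4)), e]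
  exact (loopClass_sepLoop_congr hQ hQ₀ (hsep z hz' k.castSucc) (hsep z hz' 4) hsz hlz
      (hS z hz ▸ hq.mul_pos ((hgood z hz''.1 hz''.2).2 k.castSucc))
      (hS z hz ▸ hq₀.mul_pos ((hgood z hz''.1 hz''.2).2 4))).symm

lemma carriesFrame (hab : a ≤ b) (hw : ContinuousOn w (Icc a b))
    (hS : ∀ x ∈ Icc a b, range (w x) = S x) (hfr : ∀ x ∈ Icc a b, IsFrame (w x))
    (hs : ∀ x ∈ Icc a b, ∀ v ∈ S x, v.re < s) (hl : ∀ x ∈ Icc a b, ∀ v ∈ S x, l < v.re) :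
    CarriesFrame S w s l a b := by
  refine rel_of_local hab dense_univ (mem_univ a) (mem_univ b) ?_ ?_
  · intro x y z hx hy hz _ hxy hyz h1 h2 hsx hsz hlx hlz
    obtain ⟨μ, hμ, hμ'⟩ := h1 hsx (hs y hy) hlx (hl y hy)
    obtain ⟨ν, hν, hν'⟩ := h2 (hs y hy) hsz (hl y hy) hlz
    refine ⟨μ.trans ν, hμ.trans hxy hyz hν, fun k g g₀ h h₀ hg hg₀ hh hh₀ hG hG₀ hH hH₀ => ?_⟩
    have hex : ∀ k : ℕ, ∃ f, SeparatesFrom (w y) s l k f := fun k => by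
      obtain ⟨f, hf, hf'⟩ := (hfr y hy).exists_separates
        (fun j => hs y hy _ (hS y hy ▸ mem_range_self j))
        (fun j => hl y hy _ (hS y hy ▸ mem_range_self j)) k
      exact ⟨f, hf, hf'⟩
    obtain ⟨f, hf⟩ := hex k
    obtain ⟨f₀, hf₀⟩ := hex 4
    have hF : Separates (S y) 0 s l f := hS y hy ▸ hf.separates
    have hF₀ : Separates (S y) 0 s l f₀ := hS y hy ▸ hf₀.separates
    rw [MulEquiv.trans_apply, hμ' k g g₀ f f₀ hg hg₀ hf hf₀ hG hG₀ hF hF₀,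
      hν' k f f₀ h h₀ hf hf₀ hh hh₀ hF hF₀ hH hH₀]
  · intro x hx
    obtain ⟨δ, hδ, h⟩ := carriesFrame_of_near hw hS hfr hs hl hx
    exact ⟨δ, hδ, fun y hy z hz _ _ => h y hy z hz⟩

/-- The monodromy along a segment over which the points form a continuous frame. -/
theorem exists_isMonodromy_of_frame (hab : a ≤ b) (hw : ContinuousOn w (Icc a b))
    (hS : ∀ x ∈ Icc a b, range (w x) = S x) (hfr : ∀ x ∈ Icc a b, IsFrame (w x))
    (hs : ∀ x ∈ Icc a b, ∀ v ∈ S x, v.re < s) (ha : ∀ v ∈ S a, v.re < s)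
    (hb : ∀ v ∈ S b, v.re < s) {y y' : Fin 4 → ℂ} (hy : IsLexOrdering (S a) y)
    (hy' : IsLexOrdering (S b) y') (π π' : Fin 4 → Fin 4) (hπ : ∀ j, y j = w a (π j))
    (hπ' : ∀ j, y' j = w b (π' j)) :
    ∃ μ : FiberGroup ha ≃* FiberGroup hb, IsMonodromy S ha hb μ ∧ ∀ k,
      μ (canonicalBasis hy ha (subword fun j => k ≤ π j)) =
        canonicalBasis hy' hb (subword fun j => k ≤ π' j) := by
  have hl : ∃ l, ∀ x ∈ Icc a b, ∀ v ∈ S x, l < v.re := by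
    have h1 : ∀ j, ∃ l, ∀ x ∈ Icc a b, l ≤ (w x j).re := fun j => by
      have hc : ContinuousOn (fun x => (w x j).re) (Icc a b) :=
        Complex.continuous_re.comp_continuousOn ((continuous_apply j).comp_continuousOn hw)
      obtain ⟨l, hl⟩ := (isCompact_Icc.image_of_continuousOn hc).bddBelow
      exact ⟨l, fun x hx => hl (mem_image_of_mem _ hx)⟩
    choose l hl using h1
    refine ⟨(⨅ j, l j) - 1, fun x hx v hv => ?_⟩
    obtain ⟨j, rfl⟩ : v ∈ range (w x) := hS x hx ▸ hv
    have := ciInf_le (Finite.bddBelow_range l) j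
    linarith [hl j x hx]
  obtain ⟨l, hl⟩ := hl
  have haI := left_mem_Icc.2 hab
  have hbI := right_mem_Icc.2 hab
  obtain ⟨μ, hμ, h⟩ := carriesFrame hab hw hS hfr hs hl ha hb (hl a haI) (hl b hbI)
  refine ⟨μ, hμ, fun k => ?_⟩
  have hex : ∀ x ∈ Icc a b, ∀ k : ℕ, ∃ f, SeparatesFrom (w x) s l k f := fun x hx k => by
    obtain ⟨f, hf, hf'⟩ := (hfr x hx).exists_separates
      (fun j => hs x hx _ (hS x hx ▸ mem_range_self j))
      (fun j => hl x hx _ (hS x hx ▸ mem_range_self j)) k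
    exact ⟨f, hf, hf'⟩
  have hword : ∀ {x : ℝ} (_ : x ∈ Icc a b) (hsx : ∀ v ∈ S x, v.re < s) {y : Fin 4 → ℂ}
      (hy : IsLexOrdering (S x) y) (π : Fin 4 → Fin 4) (_ : ∀ j, y j = w x (π j)) {g g₀ : ℝ → ℝ}
      (_ : SeparatesFrom (w x) s l k g) (_ : SeparatesFrom (w x) s l 4 g₀)
      (hlx : ∀ v ∈ S x, l < v.re)
      (hG : Separates (S x) 0 s l g) (hG₀ : Separates (S x) 0 s l g₀),
      loopClass hsx (sepLoop hG hG₀ hsx hlx) =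
        canonicalBasis hy hsx (subword fun j => k ≤ π j) := by
    intro x hx hsx y hy π hπ g g₀ hg hg₀ hlx hG hG₀
    rw [loopClass_sepLoop_eq_canonicalBasis hy hsx hlx hG hG₀]
    · congr 2
      funext j
      rw [hπ j, hg.lt_iff (π j)]
      exact propext Fin.le_def.symm
    · intro v hv
      have h1 := hG₀.ne v hv
      obtain ⟨j, rfl⟩ : v ∈ range (w x) := hS x hx ▸ hv
      refine lt_of_le_of_ne (not_lt.1 fun h2 => ?_) h1
      rw [tilt_zero, hg₀.lt_iff] at h2
      omega
  obtain ⟨g, hg⟩ := hex a haI k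
  obtain ⟨g₀, hg₀⟩ := hex a haI 4
  obtain ⟨f, hf⟩ := hex b hbI k
  obtain ⟨f₀, hf₀⟩ := hex b hbI 4
  have hG : Separates (S a) 0 s l g := hS a haI ▸ hg.separates
  have hG₀ : Separates (S a) 0 s l g₀ := hS a haI ▸ hg₀.separates
  have hF : Separates (S b) 0 s l f := hS b hbI ▸ hf.separates
  have hF₀ : Separates (S b) 0 s l f₀ := hS b hbI ▸ hf₀.separates
  rw [← hword haI ha hy π hπ hg hg₀ (hl a haI) hG hG₀,
    ← hword hbI hb hy' π' hπ' hf hf₀ (hl b hbI) hF hF₀]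
  exact h k g g₀ f f₀ hg hg₀ hf hf₀ hG hG₀ hF hF₀

end Frames

/-! ### Braids and frames -/

lemma subword_eq (e : Fin 4 → Prop) [DecidablePred e] :
    subword e = (if e 0 then .of 0 else 1) * (if e 1 then .of 1 else 1) *
      (if e 2 then .of 2 else 1) * (if e 3 then .of 3 else 1) := by
  unfold subword
  congr

lemma monoidHom_ext_of_subword {G : Type*} [Group G] {f f' : FreeGroup (Fin 4) →* G}
    {π : Fin 4 → Fin 4} (hπ : Function.Injective π)
    (h : ∀ k, f (subword fun j => k ≤ π j) = f' (subword fun j => k ≤ π j)) : f = f' := by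
  have key : ∀ n : ℕ, ∀ j, 3 - (π j : ℕ) = n → f (.of j) = f' (.of j) := by
    intro n
    induction n using Nat.strong_induction_on with
    | _ n ih =>
      intro j hj
      have hc : ∀ i, i ≠ j → f (if π j ≤ π i then .of i else 1) =
          f' (if π j ≤ π i then .of i else 1) := by
        intro i hij
        split_ifs with h1
        · refine ih (3 - (π i : ℕ)) ?_ i rfl
          have h2 : (π i : ℕ) ≠ π j := fun h => hij (hπ (Fin.ext h))
          have h3 : (π j : ℕ) ≤ π i := h1
          omega
        · simp
      have h1 := h (π j)
      simp only [subword_eq, map_mul] at h1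
      have hjj : (if π j ≤ π j then FreeGroup.of j else 1) = FreeGroup.of j := if_pos le_rfl
      rw [← hjj]
      fin_cases j
      · have a1 := hc 1 (by decide)
        have a2 := hc 2 (by decide)
        have a3 := hc 3 (by decide)
        simp only [Fin.zero_eta, Fin.isValue] at *
        rw [a1, a2, a3] at h1
        exact mul_right_cancel (mul_right_cancel (mul_right_cancel h1))
      · have a1 := hc 0 (by decide)
        have a2 := hc 2 (by decide)
        have a3 := hc 3 (by decide)
        simp only [Fin.mk_one, Fin.isValue] at *
        rw [a1, a2, a3] at h1
        exact mul_left_cancel (mul_right_cancel (mul_right_cancel h1))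
      · have a1 := hc 0 (by decide)
        have a2 := hc 1 (by decide)
        have a3 := hc 3 (by decide)
        simp only [Fin.reduceFinMk, Fin.isValue] at *
        rw [a1, a2, a3] at h1
        exact mul_left_cancel (mul_right_cancel h1)
      · have a1 := hc 0 (by decide)
        have a2 := hc 1 (by decide)
        have a3 := hc 2 (by decide)
        simp only [Fin.reduceFinMk, Fin.isValue] at *
        rw [a1, a2, a3] at h1
        exact mul_left_cancel h1
  ext j
  exact key _ j rfl

/-- The monodromy along a segment over which the points form a continuous frame, as an automorphism
of the free group. -/
theorem hasMonodromy_of_frame {S : ℝ → Set ℂ} {w : ℝ → Fin 4 → ℂ} {s a b : ℝ} (hab : a ≤ b)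
    (hw : ContinuousOn w (Icc a b)) (hS : ∀ x ∈ Icc a b, range (w x) = S x)
    (hfr : ∀ x ∈ Icc a b, IsFrame (w x)) (hs : ∀ x ∈ Icc a b, ∀ v ∈ S x, v.re < s)
    {ha : ∀ v ∈ S a, v.re < s} {hb : ∀ v ∈ S b, v.re < s} {y y' : Fin 4 → ℂ}
    {hy : IsLexOrdering (S a) y} {hy' : IsLexOrdering (S b) y'} (π π' : Fin 4 → Fin 4)
    (hπi : Function.Injective π) (hπ : ∀ j, y j = w a (π j)) (hπ' : ∀ j, y' j = w b (π' j))
    {β : FreeAut}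
    (hβ : ∀ k : Fin 4, β.unop (subword fun j => k ≤ π j) = subword fun j => k ≤ π' j) :
    HasMonodromy S ha hb hy hy' β := by
  obtain ⟨μ, hμ, h⟩ := exists_isMonodromy_of_frame hab hw hS hfr hs ha hb hy hy' π π' hπ hπ'
  refine ⟨μ, hμ, fun v => ?_⟩
  have : μ.toMonoidHom.comp (canonicalBasis hy ha) =
      (canonicalBasis hy' hb).comp β.unop.toMonoidHom := by
    refine monoidHom_ext_of_subword hπi fun k => ?_
    change μ _ = canonicalBasis hy' hb (β.unop _)
    rw [h, hβ]
  exact DFunLike.congr_fun this v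

lemma unop_mul_apply (β β' : FreeAut) (v : FreeGroup (Fin 4)) :
    (β * β').unop v = β'.unop (β.unop v) := rfl

lemma unop_sigma_apply (i : Fin 3) (v : FreeGroup (Fin 4)) : (sigma i).unop v = sigmaHom i v := rfl

lemma unop_sigma_inv_apply (i : Fin 3) (v : FreeGroup (Fin 4)) :
    ((sigma i)⁻¹).unop v = sigmaInvHom i v := rfl

/-- The order of the points of the frame (upper, left, right, lower) of a configuration with two
real points if the non-real pair is at the positions `i`, `i + 1`. -/
def pairPerm : Fin 3 → Fin 4 → Fin 4
  | 0 => ![0, 3, 2, 1]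
  | 1 => ![2, 0, 3, 1]
  | 2 => ![2, 1, 0, 3]

lemma pairPerm_injective (i : Fin 3) : Function.Injective (pairPerm i) := by
  revert i
  decide

lemma sigmaHom_of (i : Fin 3) (k : Fin 4) : sigmaHom i (.of k) =
    if k = i.castSucc then .of i.castSucc * .of i.succ * (.of i.castSucc)⁻¹
    else if k = i.succ then .of i.castSucc else .of k := FreeGroup.lift_apply_of

lemma sigmaInvHom_of (i : Fin 3) (k : Fin 4) : sigmaInvHom i (.of k) =
    if k = i.castSucc then .of i.succ
    else if k = i.succ then (.of i.succ)⁻¹ * .of i.castSucc * .of i.succ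
    else .of k := FreeGroup.lift_apply_of

lemma pairBraid_subword (i : Fin 3) (k : Fin 4) :
    (pairBraid i).unop (subword fun j => k ≤ pairPerm 0 j) = subword fun j => k ≤ pairPerm i j := by
  fin_cases i <;> fin_cases k <;>
  simp only [pairBraid, subword_eq, pairPerm, unop_mul_apply, unop_sigma_apply,
    unop_sigma_inv_apply] <;>
  simp [sigmaHom_of, sigmaInvHom_of, Fin.ext_iff, mul_assoc]

lemma pairBraid_inv_mul_subword (i i' : Fin 3) (k : Fin 4) :
    ((pairBraid i)⁻¹ * pairBraid i').unop (subword fun j => k ≤ pairPerm i j) =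
      subword fun j => k ≤ pairPerm i' j := by
  rw [unop_mul_apply, ← pairBraid_subword i k, ← pairBraid_subword i' k]
  congr 1
  exact (pairBraid i).unop.symm_apply_apply _

/-- The order of the points of a frame of two conjugate pairs, with decreasing imaginary parts, if
the outer pair is on the right. -/
def outerRight : Fin 4 → Fin 4 := ![0, 3, 1, 2]

/-- The order of the points of a frame of two conjugate pairs, with decreasing imaginary parts, if
the outer pair is on the left. -/
def outerLeft : Fin 4 → Fin 4 := ![1, 2, 0, 3]

lemma outerRight_injective : Function.Injective outerRight := by decide

lemma outerLeft_injective : Function.Injective outerLeft := by decide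

lemma tau_subword (k : Fin 4) :
    tau.unop (subword fun j => k ≤ outerLeft j) = subword fun j => k ≤ outerRight j := by
  fin_cases k <;>
  simp only [tau, subword_eq, outerLeft, outerRight, unop_mul_apply, unop_sigma_apply,
    unop_sigma_inv_apply] <;>
  simp [sigmaHom_of, sigmaInvHom_of, Fin.ext_iff, mul_assoc]

lemma tau_inv_subword (k : Fin 4) :
    (tau⁻¹).unop (subword fun j => k ≤ outerRight j) = subword fun j => k ≤ outerLeft j := by
  rw [← tau_subword]
  exact tau.unop.symm_apply_apply _

/-! ### Labellings of the points of a fiber -/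

/-- An enumeration that is increasing for a strict order is determined by its range. -/
lemma eq_of_range_eq_of_order {r : ℂ → ℂ → Prop} (hirr : ∀ z, ¬ r z z)
    (htr : ∀ x y z, r x y → r y z → r x z) {w w' : Fin 4 → ℂ} (h : range w = range w')
    (hw : ∀ i j, i < j → r (w i) (w j)) (hw' : ∀ i j, i < j → r (w' i) (w' j)) : w = w' := by
  have h1 : ∀ k, ∃ j, w j = w' k := fun k => by
    have : w' k ∈ range w := h ▸ mem_range_self k
    exact this
  choose m hm using h1
  have h2 : StrictMono m := by
    intro i j hij
    by_contra! hc
    have h3 := hw' i j hij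
    rw [← hm, ← hm] at h3
    rcases hc.eq_or_lt with h4 | h4
    · rw [h4] at h3
      exact hirr _ h3
    · exact hirr _ (htr _ _ _ h3 (hw _ _ h4))
  have h5 : m = id := (h2.range_inj strictMono_id).1 (by
    rw [range_id, (Finite.injective_iff_surjective.1 h2.injective).range_eq])
  funext k
  rw [← hm, h5, id]

lemma IsLexOrdering.unique {S : Set ℂ} {y y' : Fin 4 → ℂ} (h : IsLexOrdering S y)
    (h' : IsLexOrdering S y') : y = y' := by
  refine eq_of_range_eq_of_order
    (r := fun z z' => z'.re < z.re ∨ (z'.re = z.re ∧ z'.im < z.im)) ?_ ?_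
    (h.1.trans h'.1.symm) h.2 h'.2
  · simp
  · rintro x y z (h1 | h1) (h2 | h2)
    · exact Or.inl (h2.trans h1)
    · exact Or.inl (h2.1 ▸ h1)
    · exact Or.inl (h1.1 ▸ h2)
    · exact Or.inr ⟨h2.1.trans h1.1, h2.2.trans h1.2⟩

lemma IsLexOrdering.injective {S : Set ℂ} {y : Fin 4 → ℂ} (h : IsLexOrdering S y) :
    Function.Injective y := by
  have key : ∀ i j, i < j → y i ≠ y j := by
    intro i j hij heq
    rcases h.2 i j hij with h1 | h1 <;> rw [heq] at h1
    · exact lt_irrefl _ h1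
    · exact lt_irrefl _ h1.2
  intro i j heq
  rcases lt_trichotomy i j with h1 | h1 | h1
  · exact absurd heq (key _ _ h1)
  · exact h1
  · exact absurd heq.symm (key _ _ h1)

lemma IsLexOrdering.isFrame {S : Set ℂ} {y : Fin 4 → ℂ} (h : IsLexOrdering S y) : IsFrame y := by
  intro i j hij he
  rcases h.2 i j hij with h1 | h1
  · exact absurd he h1.ne'
  · exact h1.2

namespace RealTetragonalCurve

variable {d : ℕ} {K : RealTetragonalCurve d} {x : ℝ} {w : Fin 4 → ℂ}

lemma fiberPoly_eq (K : RealTetragonalCurve d) (x : ℝ) : K.fiberPoly x =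
    X ^ 4 + C ((K.p.eval x : ℝ) : ℂ) * X ^ 2 + C ((K.q.eval x : ℝ) : ℂ) * X + C ((K.r.eval x : ℝ) : ℂ) := by
  simp [fiberPoly, reducedQuartic]

lemma eval_fiberPoly (K : RealTetragonalCurve d) (x : ℝ) (z : ℂ) : (K.fiberPoly x).eval z =
    z ^ 4 + ((K.p.eval x : ℝ) : ℂ) * z ^ 2 + ((K.q.eval x : ℝ) : ℂ) * z + ((K.r.eval x : ℝ) : ℂ) := by
  simp [fiberPoly_eq]

lemma natDegree_fiberPoly (K : RealTetragonalCurve d) (x : ℝ) : (K.fiberPoly x).natDegree = 4 := by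
  rw [fiberPoly_eq]
  compute_degree!

lemma monic_fiberPoly (K : RealTetragonalCurve d) (x : ℝ) : (K.fiberPoly x).Monic := by
  rw [fiberPoly_eq]
  monicity!

lemma conj_mem_points {z : ℂ} (hz : z ∈ K.points x) : (starRingEnd ℂ) z ∈ K.points x := by
  have h : (K.fiberPoly x).eval z = 0 := hz
  change (K.fiberPoly x).eval _ = 0
  rw [eval_fiberPoly] at h ⊢
  have := congrArg (starRingEnd ℂ) h
  simpa using this

lemma points_eq_roots (K : RealTetragonalCurve d) (x : ℝ) :
    K.points x = ((K.fiberPoly x).roots.toFinset : Set ℂ) := by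
  ext z
  simp [points, (K.monic_fiberPoly x).ne_zero]

lemma ncard_points_le (K : RealTetragonalCurve d) (x : ℝ) : (K.points x).ncard ≤ 4 := by
  rw [points_eq_roots, ncard_coe_finset, ← K.natDegree_fiberPoly x]
  exact (Multiset.toFinset_card_le _).trans (card_roots' _)

lemma injective_of_range_eq (hx : ¬ K.IsSingularFiber x) (hw : range w = K.points x) :
    Function.Injective w := by
  have h4 : (range w).ncard = 4 := hw ▸ le_antisymm (K.ncard_points_le x) (not_lt.1 hx)
  rw [← image_univ] at h4
  rw [← injOn_univ]
  refine (ncard_image_iff finite_univ).1 ?_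
  rw [h4, ncard_univ, Nat.card_fin]

lemma exists_range_eq (hx : ¬ K.IsSingularFiber x) : ∃ w : Fin 4 → ℂ, range w = K.points x := by
  have h4 : (K.points x).ncard = 4 := le_antisymm (K.ncard_points_le x) (not_lt.1 hx)
  have h5 : Nat.card (K.points x) = 4 := h4
  have : Finite (K.points x) := Nat.finite_of_card_ne_zero (by rw [h5]; decide)
  let e := (Finite.equivFinOfCardEq h5).symm
  refine ⟨fun k => e k, ?_⟩
  rw [show (fun k => ((e k : K.points x) : ℂ)) = Subtype.val ∘ e from rfl, range_comp,
    e.surjective.range_eq, image_univ, Subtype.range_coe]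

lemma fiberPoly_eq_prod (hx : ¬ K.IsSingularFiber x) (hw : range w = K.points x) :
    K.fiberPoly x = ∏ k, (X - C (w k)) := by
  have hinj := injective_of_range_eq hx hw
  have hm : (∏ k, (X - C (w k)) : ℂ[X]).Monic := monic_prod_of_monic _ _ fun k _ => monic_X_sub_C _
  have hd : (∏ k, (X - C (w k)) : ℂ[X]).natDegree = 4 := by
    rw [natDegree_prod_of_monic _ _ fun k _ => monic_X_sub_C _]
    simp
  refine eq_of_degree_sub_lt_of_eval_finset_eq (Finset.univ.image w) ?_ ?_
  · rw [Finset.card_image_of_injective _ hinj, Finset.card_fin]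
    have h1 : (K.fiberPoly x).degree = ((4 : ℕ) : WithBot ℕ) := by
      rw [degree_eq_natDegree (K.monic_fiberPoly x).ne_zero, natDegree_fiberPoly]
    refine (degree_sub_lt_left ?_ (K.monic_fiberPoly x).ne_zero ?_).trans_eq h1
    · rw [h1, degree_eq_natDegree hm.ne_zero, hd]
    · rw [(K.monic_fiberPoly x).leadingCoeff, hm.leadingCoeff]
  · intro z hz
    obtain ⟨k, -, rfl⟩ := Finset.mem_image.1 hz
    have h1 : w k ∈ K.points x := hw ▸ mem_range_self k
    rw [show (K.fiberPoly x).eval (w k) = 0 from h1, eval_prod]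
    exact (Finset.prod_eq_zero (Finset.mem_univ k) (by simp)).symm

lemma exists_near_of_near {v : Fin 4 → ℂ} (hx : ¬ K.IsSingularFiber x) {η : ℝ} (hη : 0 < η)
    (hv : ∀ i j, i ≠ j → 2 * η ≤ ‖v i - v j‖)
    (hn : ∀ k, ‖(K.fiberPoly x).eval (v k)‖ < η ^ 4) :
    ∃ w : Fin 4 → ℂ, range w = K.points x ∧ ∀ k, ‖w k - v k‖ < η := by
  obtain ⟨u, hu⟩ := exists_range_eq hx
  have h1 : ∀ k, ∃ j, ‖u j - v k‖ < η := by
    intro k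
    by_contra! hc
    refine (hn k).not_ge ?_
    rw [fiberPoly_eq_prod hx hu, eval_prod, norm_prod]
    calc η ^ 4 = ∏ _j : Fin 4, η := by simp
      _ ≤ _ := Finset.prod_le_prod (fun _ _ => hη.le) fun j _ => by
        simpa [norm_sub_rev] using hc j
  choose m hm using h1
  have h2 : Function.Injective m := by
    intro i j hij
    by_contra hne
    have h3 := hv i j hne
    have h4 := hm i
    have h5 := hm j
    rw [hij] at h4
    have h6 : ‖v i - v j‖ ≤ ‖u (m j) - v j‖ + ‖u (m j) - v i‖ := by
      rw [show v i - v j = (u (m j) - v j) - (u (m j) - v i) by ring]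
      exact norm_sub_le _ _
    linarith
  refine ⟨u ∘ m, ?_, hm⟩
  rw [(Finite.injective_iff_surjective.1 h2).range_comp, hu]

/-- The points of the fibers near a nonsingular one are close to its points, and lie on the same
sides of the real line. -/
lemma eventually_exists_near {x₀ : ℝ} (hx₀ : ¬ K.IsSingularFiber x₀) {v : Fin 4 → ℂ}
    (hv : range v = K.points x₀) {η : ℝ} (hη : 0 < η) :
    ∀ᶠ x in 𝓝 x₀, ¬ K.IsSingularFiber x → ∃ w : Fin 4 → ℂ, range w = K.points x ∧
      (∀ k, ‖w k - v k‖ < η) ∧ ∀ k, SignType.sign (w k).im = SignType.sign (v k).im := by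
  have hinj := injective_of_range_eq hx₀ hv
  have hsmall : ∀ᶠ δ : ℝ in 𝓝[>] 0, δ < η ∧ (∀ i j, i ≠ j → 2 * δ ≤ ‖v i - v j‖) ∧
      ∀ k, (v k).im ≠ 0 → δ < |(v k).im| := by
    have hlt : ∀ c : ℝ, 0 < c → ∀ᶠ δ : ℝ in 𝓝[>] 0, δ < c := fun c hc =>
      (eventually_lt_nhds hc).filter_mono nhdsWithin_le_nhds
    refine (hlt η hη).and (Eventually.and ?_ ?_)
    · simp only [eventually_all]
      intro i j hij
      filter_upwards [hlt (‖v i - v j‖ / 2) (by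
        have := norm_pos_iff.2 (sub_ne_zero.2 (hinj.ne hij)); linarith)] with δ hδ
      linarith
    · simp only [eventually_all]
      exact fun k hk => hlt _ (abs_pos.2 hk)
  obtain ⟨δ, ⟨hδη, hδv, hδi⟩, hδ⟩ := (hsmall.and self_mem_nhdsWithin).exists
  have hδ0 : (0 : ℝ) < δ := hδ
  have hev : ∀ᶠ x in 𝓝 x₀, ∀ k, ‖(K.fiberPoly x).eval (v k)‖ < δ ^ 4 := by
    rw [eventually_all]
    intro k
    have hc : Continuous fun x : ℝ => ‖(K.fiberPoly x).eval (v k)‖ := by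
      simp only [eval_fiberPoly]
      fun_prop
    refine hc.continuousAt.eventually_lt_const ?_
    have h1 : v k ∈ K.points x₀ := hv ▸ mem_range_self k
    change ‖(K.fiberPoly x₀).eval (v k)‖ < _
    rw [show (K.fiberPoly x₀).eval (v k) = 0 from h1, norm_zero]
    positivity
  filter_upwards [hev] with x hx hns
  obtain ⟨w, hw, hwv⟩ := exists_near_of_near hns hδ0 hδv hx
  refine ⟨w, hw, fun k => (hwv k).trans hδη, fun k => ?_⟩
  have him : |(w k).im - (v k).im| < δ := by
    simpa using (Complex.abs_im_le_norm (w k - v k)).trans_lt (hwv k)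
  rcases lt_trichotomy (v k).im 0 with h | h | h
  · have h1 := hδi k h.ne
    rw [abs_of_neg h] at h1
    rw [sign_neg h, sign_neg (by linarith [(abs_lt.1 him).2])]
  · have h1 : (starRingEnd ℂ) (w k) ∈ range w := hw ▸ conj_mem_points (hw ▸ mem_range_self k)
    obtain ⟨j, hj⟩ := h1
    have h2 : j = k := by
      by_contra hne
      have h3 := hδv j k hne
      have h4 : ‖(starRingEnd ℂ) (w k) - v k‖ < δ := by
        have : v k = (starRingEnd ℂ) (v k) := (Complex.conj_eq_iff_im.2 h).symm
        rw [this, ← map_sub, Complex.norm_conj]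
        exact hwv k
      rw [← hj] at h4
      have h6 : ‖v j - v k‖ ≤ ‖w j - v k‖ + ‖w j - v j‖ := by
        rw [show v j - v k = (w j - v k) - (w j - v j) by ring]
        exact norm_sub_le _ _
      linarith [hwv j]
    rw [h2] at hj
    rw [h, Complex.conj_eq_iff_im.1 hj.symm]
  · have h1 := hδi k h.ne'
    rw [abs_of_pos h] at h1
    rw [sign_pos h, sign_pos (by linarith [(abs_lt.1 him).1])]

/-- A labelling rule that is stable under small deformations and unambiguous gives continuous
branches. -/
lemma exists_continuousOn_labelling {a b : ℝ} (hns : ∀ x ∈ Icc a b, ¬ K.IsSingularFiber x)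
    {P : (Fin 4 → ℂ) → Prop}
    (hP : ∀ v, P v → ∀ᶠ w in 𝓝 v,
      (∀ k, SignType.sign (w k).im = SignType.sign (v k).im) → P w)
    (hu : ∀ x ∈ Icc a b, ∀ v w, range v = K.points x → range w = K.points x → P v → P w → v = w)
    (he : ∀ x ∈ Icc a b, ∃ w, range w = K.points x ∧ P w) :
    ∃ w : ℝ → Fin 4 → ℂ, ContinuousOn w (Icc a b) ∧
      ∀ x ∈ Icc a b, range (w x) = K.points x ∧ P (w x) := by
  choose! w hw using he
  refine ⟨w, fun x₀ hx₀ => ?_, hw⟩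
  rw [ContinuousWithinAt, Metric.tendsto_nhds]
  intro ε hε
  obtain ⟨δ, hδ, hδP⟩ := Metric.eventually_nhds_iff.1 (hP _ (hw x₀ hx₀).2)
  have h1 := eventually_exists_near (hns x₀ hx₀) (hw x₀ hx₀).1 (lt_min hδ hε)
  filter_upwards [h1.filter_mono nhdsWithin_le_nhds, self_mem_nhdsWithin] with x hx hxI
  obtain ⟨u, hu1, hu2, hu3⟩ := hx (hns x hxI)
  have h2 : dist u (w x₀) < min δ ε := by
    rw [dist_pi_lt_iff (lt_min hδ hε)]
    intro k
    rw [dist_eq_norm]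
    exact hu2 k
  have h3 := hδP (h2.trans_le (min_le_left _ _)) hu3
  rw [hu x hxI _ _ (hw x hxI).1 hu1 (hw x hxI).2 h3]
  exact h2.trans_le (min_le_right _ _)

/-- The number of real branches is constant over a segment without singular fibers. -/
lemma ncard_real_eq {a b : ℝ} (hns : ∀ x ∈ Icc a b, ¬ K.IsSingularFiber x) {x x' : ℝ}
    (hx : x ∈ Icc a b) (hx' : x' ∈ Icc a b) :
    {z ∈ K.points x | z.im = 0}.ncard = {z ∈ K.points x' | z.im = 0}.ncard := by
  have hcard : ∀ x ∈ Icc a b, ∀ w : Fin 4 → ℂ, range w = K.points x →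
      {z ∈ K.points x | z.im = 0}.ncard = {k | SignType.sign (w k).im = 0}.ncard := by
    intro x hx w hw
    rw [← ncard_image_of_injective _ (injective_of_range_eq (hns x hx) hw)]
    congr 1
    ext z
    simp only [← hw, mem_ofPred_eq, mem_range, mem_image, sign_eq_zero_iff]
    constructor
    · rintro ⟨⟨k, rfl⟩, h⟩
      exact ⟨k, h, rfl⟩
    · rintro ⟨k, h, rfl⟩
      exact ⟨⟨k, rfl⟩, h⟩
  refine isPreconnected_Icc.constant (f := fun x => {z ∈ K.points x | z.im = 0}.ncard)
    (fun x₀ hx₀ => ?_) hx hx'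
  obtain ⟨v, hv⟩ := exists_range_eq (hns x₀ hx₀)
  refine ContinuousWithinAt.congr_of_eventuallyEq (continuousWithinAt_const
    (b := {z ∈ K.points x₀ | z.im = 0}.ncard)) ?_ rfl
  filter_upwards [(eventually_exists_near (hns x₀ hx₀) hv one_pos).filter_mono nhdsWithin_le_nhds,
    self_mem_nhdsWithin] with x hx hxI
  obtain ⟨u, hu1, -, hu3⟩ := hx (hns x hxI)
  rw [hcard x hxI u hu1, hcard x₀ hx₀ v hv]
  simp only [hu3]

end RealTetragonalCurve

/-! ### Real forms of a fiber -/

set_option synthInstance.maxSize 1000 in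
set_option synthInstance.maxHeartbeats 200000 in
lemma involution_fin_four (m : Fin 4 → Fin 4) (hm : ∀ k, m (m k) = k) :
    (∀ k, m k = k) ∨
    (∃ i j k l : Fin 4, m i = l ∧ m j = j ∧ m k = k ∧ i ≠ l ∧ j ≠ k ∧ i ≠ j ∧ i ≠ k ∧
      l ≠ j ∧ l ≠ k) ∨
    ∃ i j k l : Fin 4, m i = j ∧ m k = l ∧ i ≠ j ∧ k ≠ l ∧ i ≠ k ∧ i ≠ l ∧ j ≠ k ∧ j ≠ l := by
  revert m
  decide +kernel

/-- Labels of a fiber with two real points: upper, left, right, lower. -/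
def IsPairLabelling (w : Fin 4 → ℂ) : Prop :=
  0 < (w 0).im ∧ (w 1).im = 0 ∧ (w 2).im = 0 ∧ (w 3).im < 0 ∧ (w 1).re < (w 2).re

/-- Two pairs of conjugate points with opposite real parts. -/
def twoPairs (A B D : ℝ) : Fin 4 → ℂ := ![⟨A, B⟩, ⟨A, -B⟩, ⟨-A, D⟩, ⟨-A, -D⟩]

lemma range_four {α : Type*} (u : Fin 4 → α) : range u = {u 0, u 1, u 2, u 3} := by
  ext z
  simp [Fin.exists_fin_succ, eq_comm]

namespace RealTetragonalCurve

variable {d : ℕ} {K : RealTetragonalCurve d} {x : ℝ} {w : Fin 4 → ℂ}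

lemma vieta (hx : ¬ K.IsSingularFiber x) (hw : range w = K.points x) :
    w 0 + w 1 + w 2 + w 3 = 0 ∧
    ((K.p.eval x : ℝ) : ℂ) = w 0 * w 1 + w 0 * w 2 + w 0 * w 3 + w 1 * w 2 + w 1 * w 3 + w 2 * w 3 ∧
    ((K.q.eval x : ℝ) : ℂ) =
      -(w 0 * w 1 * w 2 + w 0 * w 1 * w 3 + w 0 * w 2 * w 3 + w 1 * w 2 * w 3) ∧
    ((K.r.eval x : ℝ) : ℂ) = w 0 * w 1 * w 2 * w 3 := by
  have h : ∀ z, z ^ 4 + ((K.p.eval x : ℝ) : ℂ) * z ^ 2 + ((K.q.eval x : ℝ) : ℂ) * z +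
      ((K.r.eval x : ℝ) : ℂ) = (z - w 0) * (z - w 1) * (z - w 2) * (z - w 3) := by
    intro z
    rw [← eval_fiberPoly, fiberPoly_eq_prod hx hw, eval_prod, Fin.prod_univ_four]
    simp
  have h0 := h 0
  have h1 := h 1
  have hm := h (-1)
  have h2 := h 2
  refine ⟨?_, ?_, ?_, ?_⟩
  · linear_combination (h2 - 3 * h1 - hm + 3 * h0) / 6
  · linear_combination (h1 + hm) / 2 - h0
  · linear_combination (h1 - hm) / 2 - (h2 - 3 * h1 - hm + 3 * h0) / 6
  · linear_combination h0

/-- The points of the fiber are two pairs of conjugate points. -/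
def IsTwoPairs (K : RealTetragonalCurve d) (x A B D : ℝ) : Prop :=
  0 ≤ A ∧ 0 < B ∧ 0 < D ∧ range (twoPairs A B D) = K.points x

lemma exists_isTwoPairs (hx : ¬ K.IsSingularFiber x) (hw : range w = K.points x)
    (h1 : (starRingEnd ℂ) (w 0) = w 1) (h2 : (starRingEnd ℂ) (w 2) = w 3) :
    ∃ A B D, K.IsTwoPairs x A B D := by
  have hinj := injective_of_range_eq hx hw
  have key : ∀ z : ℂ, (starRingEnd ℂ) z ≠ z → 0 < |z.im| ∧
      ({z, (starRingEnd ℂ) z} : Set ℂ) = {⟨z.re, |z.im|⟩, ⟨z.re, -|z.im|⟩} := by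
    intro z hz
    have h3 : z.im ≠ 0 := fun h => hz (Complex.conj_eq_iff_im.2 h)
    refine ⟨abs_pos.2 h3, ?_⟩
    rcases h3.lt_or_gt with h | h
    · rw [abs_of_neg h, pair_comm, neg_neg]
      rfl
    · rw [abs_of_pos h]
      rfl
  obtain ⟨hB, hB'⟩ := key (w 0) (h1 ▸ hinj.ne (by decide))
  obtain ⟨hD, hD'⟩ := key (w 2) (h2 ▸ hinj.ne (by decide))
  have hre : (w 2).re = -(w 0).re := by
    have h := congrArg Complex.re (vieta hx hw).1
    rw [← h1, ← h2] at h
    simp at h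
    linarith
  have hsplit : ∀ e f g h : ℂ, ({e, f, g, h} : Set ℂ) = {e, f} ∪ {g, h} := by
    intro e f g h
    ext z
    simp only [mem_union, mem_insert_iff, mem_singleton_iff, or_assoc]
  have hpts : K.points x = {⟨(w 0).re, |(w 0).im|⟩, ⟨(w 0).re, -|(w 0).im|⟩} ∪
      {⟨-(w 0).re, |(w 2).im|⟩, ⟨-(w 0).re, -|(w 2).im|⟩} := by
    rw [← hw, range_four, hsplit, ← h1, ← h2, hB', hD', hre]
  rcases le_total 0 (w 0).re with h | h
  · exact ⟨_, _, _, h, hB, hD, by rw [hpts, range_four, hsplit]; rfl⟩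
  · refine ⟨-(w 0).re, _, _, neg_nonneg.2 h, hD, hB, ?_⟩
    rw [hpts, range_four, hsplit, union_comm]
    simp [twoPairs]

lemma IsTwoPairs.ne_of_eq_zero {A B D : ℝ} (hx : ¬ K.IsSingularFiber x)
    (h : K.IsTwoPairs x A B D) (hA : A = 0) : B ≠ D := by
  rintro rfl
  have h1 := injective_of_range_eq hx h.2.2.2
  exact absurd (@h1 0 2 (by simp [twoPairs, hA])) (by decide)

lemma IsTwoPairs.eval_q {A B D : ℝ} (hx : ¬ K.IsSingularFiber x) (h : K.IsTwoPairs x A B D) :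
    K.q.eval x = 2 * A * (B ^ 2 - D ^ 2) := by
  have h1 := congrArg Complex.re (vieta hx h.2.2.2).2.2.1
  simp [twoPairs] at h1
  linear_combination h1

lemma IsTwoPairs.eval_b₁ {A B D : ℝ} (hx : ¬ K.IsSingularFiber x) (h : K.IsTwoPairs x A B D) :
    K.b₁.eval x = (B ^ 2 - D ^ 2) ^ 2 - 8 * A ^ 2 * (B ^ 2 + D ^ 2) := by
  have h1 := congrArg Complex.re (vieta hx h.2.2.2).2.1
  have h2 := congrArg Complex.re (vieta hx h.2.2.2).2.2.2
  simp [twoPairs] at h1 h2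
  simp only [b₁, eval_sub, eval_pow, eval_mul, eval_ofNat, h1, h2]
  ring

/-- A fiber has four real points, or two real points and a pair of conjugate ones, or two pairs of
conjugate points. -/
lemma real_form (hx : ¬ K.IsSingularFiber x) :
    (K.AllReal x ∧ {z ∈ K.points x | z.im = 0}.ncard = 4) ∨
    ((∃ w, range w = K.points x ∧ IsPairLabelling w) ∧
      {z ∈ K.points x | z.im = 0}.ncard = 2) ∨
    ((∃ A B D, K.IsTwoPairs x A B D) ∧ {z ∈ K.points x | z.im = 0}.ncard = 0) := by
  obtain ⟨u, hu⟩ := exists_range_eq hx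
  have hinj := injective_of_range_eq hx hu
  have h1 : ∀ k, ∃ j, u j = (starRingEnd ℂ) (u k) := fun k => by
    have : (starRingEnd ℂ) (u k) ∈ range u := hu ▸ conj_mem_points (hu ▸ mem_range_self k)
    exact this
  choose m hm using h1
  have h2 : ∀ k, m (m k) = k := fun k => hinj (by rw [hm, hm, Complex.conj_conj])
  have h3 : ∀ k, m k = k → (u k).im = 0 := fun k h =>
    Complex.conj_eq_iff_im.1 (by rw [← hm, h])
  have h4 : ∀ k, m k ≠ k → (u k).im ≠ 0 := fun k h h' =>
    h (hinj (by rw [hm, Complex.conj_eq_iff_im.2 h']))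
  have hperm : ∀ i j k l : Fin 4, i ≠ j → i ≠ k → i ≠ l → j ≠ k → j ≠ l → k ≠ l →
      range (u ∘ ![i, j, k, l]) = K.points x := by
    intro i j k l hij hik hil hjk hjl hkl
    have : Function.Injective ![i, j, k, l] := by
      intro e f hef
      fin_cases e <;> fin_cases f <;> simp_all
    rw [(Finite.injective_iff_surjective.1 this).range_comp, hu]
  rcases involution_fin_four m h2 with h | ⟨i, j, k, l, e1, e2, e3, n1, n2, n3, n4, n5, n6⟩ |
    ⟨i, j, k, l, e1, e2, n1, n2, n3, n4, n5, n6⟩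
  · have hr : K.AllReal x := by
      intro z hz
      rw [← hu] at hz
      obtain ⟨k, rfl⟩ := hz
      exact h3 k (h k)
    refine Or.inl ⟨hr, ?_⟩
    rw [show {z ∈ K.points x | z.im = 0} = K.points x from
      (sep_eq_self_iff_mem_true.2 fun z hz => hr z hz)]
    exact le_antisymm (K.ncard_points_le x) (not_lt.1 hx)
  · have hl : (u l).im = -(u i).im := by rw [← e1, hm, Complex.conj_im]
    have hi : (u i).im ≠ 0 := h4 i (by rw [e1]; exact n1.symm)
    have hj := h3 j e2
    have hk := h3 k e3
    have hjk : (u j).re ≠ (u k).re := fun h => n2 (hinj (Complex.ext h (hj.trans hk.symm)))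
    refine Or.inr (Or.inl ⟨?_, ?_⟩)
    · have hr := hperm i j k l n3 n4 n1 n2 n5.symm n6.symm
      rcases hi.lt_or_gt with hi | hi <;> rcases hjk.lt_or_gt with hjk | hjk
      · exact ⟨_, hperm l j k i n5 n6 n1.symm n2 n3.symm n4.symm, by
          simp [IsPairLabelling, hj, hk, hi, hl, hjk]⟩
      · exact ⟨_, hperm l k j i n6 n5 n1.symm n2.symm n4.symm n3.symm, by
          simp [IsPairLabelling, hj, hk, hi, hl, hjk]⟩
      · exact ⟨_, hperm i j k l n3 n4 n1 n2 n5.symm n6.symm, by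
          simp [IsPairLabelling, hj, hk, hi, hl, hjk]⟩
      · exact ⟨_, hperm i k j l n4 n3 n1 n2.symm n6.symm n5.symm, by
          simp [IsPairLabelling, hj, hk, hi, hl, hjk]⟩
    · have hset : {z ∈ K.points x | z.im = 0} = {u j, u k} := by
        ext z
        rw [← hperm i j k l n3 n4 n1 n2 n5.symm n6.symm, range_four]
        simp only [mem_ofPred_eq, mem_insert_iff, mem_singleton_iff]
        constructor
        · rintro ⟨rfl | rfl | rfl | rfl, hz⟩
          · exact absurd hz hi
          · exact Or.inl rfl
          · exact Or.inr rfl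
          · exact absurd hz (by simp [hl, hi])
        · rintro (rfl | rfl)
          · exact ⟨Or.inr (Or.inl rfl), hj⟩
          · exact ⟨Or.inr (Or.inr (Or.inl rfl)), hk⟩
      rw [hset, ncard_pair (hinj.ne n2)]
  · refine Or.inr (Or.inr ⟨exists_isTwoPairs hx (hperm i j k l n1 n3 n4 n5 n6 n2) ?_ ?_, ?_⟩)
    · simp [← e1, hm]
    · simp [← e2, hm]
    · have hset : {z ∈ K.points x | z.im = 0} = ∅ := by
        refine sep_eq_empty_iff_mem_false.2 fun z hz => ?_
        rw [← hperm i j k l n1 n3 n4 n5 n6 n2, range_four] at hz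
        have hi : (u i).im ≠ 0 := h4 i (by rw [e1]; exact n1.symm)
        have hk : (u k).im ≠ 0 := h4 k (by rw [e2]; exact n2.symm)
        simp only [mem_insert_iff, mem_singleton_iff] at hz
        rcases hz with rfl | rfl | rfl | rfl
        · exact hi
        · simp [← e1, hm, hi]
        · exact hk
        · simp [← e2, hm, hk]
      rw [hset, ncard_empty]

end RealTetragonalCurve

/-! ### Monodromy in terms of labellings -/

lemma eventually_re_lt {v : Fin 4 → ℂ} {i j : Fin 4} (h : (v i).re < (v j).re) :
    ∀ᶠ w in 𝓝 v, (w i).re < (w j).re :=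
  (isOpen_lt (Complex.continuous_re.comp (continuous_apply i))
    (Complex.continuous_re.comp (continuous_apply j))).mem_nhds h

lemma eventually_im_lt {v : Fin 4 → ℂ} {i j : Fin 4} (h : (v i).im < (v j).im) :
    ∀ᶠ w in 𝓝 v, (w i).im < (w j).im :=
  (isOpen_lt (Complex.continuous_im.comp (continuous_apply i))
    (Complex.continuous_im.comp (continuous_apply j))).mem_nhds h

namespace RealTetragonalCurve

variable {d : ℕ} {K : RealTetragonalCurve d} {a b s : ℝ} {y y' : Fin 4 → ℂ}
  {ha : ∀ v ∈ K.points a, v.re < s} {hb : ∀ v ∈ K.points b, v.re < s}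
  {hy : IsLexOrdering (K.points a) y} {hy' : IsLexOrdering (K.points b) y'}

theorem hasMonodromy_of_labelling (hab : a ≤ b) (hns : ∀ x ∈ Icc a b, ¬ K.IsSingularFiber x)
    (hs : ∀ x ∈ Icc a b, ∀ v ∈ K.points x, v.re < s) {P : (Fin 4 → ℂ) → Prop}
    (hP : ∀ v, P v → ∀ᶠ w in 𝓝 v,
      (∀ k, SignType.sign (w k).im = SignType.sign (v k).im) → P w)
    (hu : ∀ x ∈ Icc a b, ∀ v w, range v = K.points x → range w = K.points x → P v → P w → v = w)
    (he : ∀ x ∈ Icc a b, ∃ w, range w = K.points x ∧ P w)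
    (hfr : ∀ x ∈ Icc a b, ∀ w, range w = K.points x → P w → IsFrame w) (π π' : Fin 4 → Fin 4)
    (hπi : Function.Injective π)
    (hπ : ∀ w, range w = K.points a → P w → ∀ j, y j = w (π j))
    (hπ' : ∀ w, range w = K.points b → P w → ∀ j, y' j = w (π' j)) {β : FreeAut}
    (hβ : ∀ k : Fin 4, β.unop (subword fun j => k ≤ π j) = subword fun j => k ≤ π' j) :
    HasMonodromy K.points ha hb hy hy' β := by
  obtain ⟨w, hw, h⟩ := exists_continuousOn_labelling hns hP hu he
  have hA := h a (left_mem_Icc.2 hab)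
  have hB := h b (right_mem_Icc.2 hab)
  exact hasMonodromy_of_frame hab hw (fun x hx => (h x hx).1)
    (fun x hx => hfr x hx _ (h x hx).1 (h x hx).2) hs π π' hπi (hπ _ hA.1 hA.2)
    (hπ' _ hB.1 hB.2) hβ

theorem hasMonodromy_of_allReal (hab : a ≤ b) (hns : ∀ x ∈ Icc a b, ¬ K.IsSingularFiber x)
    (hs : ∀ x ∈ Icc a b, ∀ v ∈ K.points x, v.re < s) (hr : ∀ x ∈ Icc a b, K.AllReal x) :
    HasMonodromy K.points ha hb hy hy' 1 := by
  have hlex : ∀ x w, range w = K.points x → (∀ i j : Fin 4, i < j → (w j).re < (w i).re) →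
      IsLexOrdering (K.points x) w := fun x w h h' => ⟨h, fun i j hij => Or.inl (h' i j hij)⟩
  refine hasMonodromy_of_labelling hab hns hs
    (P := fun w => ∀ i j : Fin 4, i < j → (w j).re < (w i).re) ?_ ?_ ?_ ?_ id id
    Function.injective_id ?_ ?_ (fun k => rfl)
  · intro v hv
    have : ∀ᶠ w in 𝓝 v, ∀ i j : Fin 4, i < j → (w j).re < (w i).re := by
      simp only [eventually_all]
      exact fun i j hij => eventually_re_lt (hv i j hij)
    filter_upwards [this] with w hw _ using hw
  · exact fun x _ v w hv hw h h' => (hlex x v hv h).unique (hlex x w hw h')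
  · intro x hx
    obtain ⟨u, hu⟩ := exists_range_eq (hns x hx)
    have hinj := injective_of_range_eq (hns x hx) hu
    let m := Tuple.sort fun k => -(u k).re
    have hm : Monotone ((fun k => -(u k).re) ∘ m) := Tuple.monotone_sort _
    refine ⟨u ∘ m, by rw [m.surjective.range_comp, hu], fun i j hij => ?_⟩
    have h1 := hm hij.le
    simp only [Function.comp_apply] at h1 ⊢
    refine lt_of_le_of_ne (by linarith) fun h2 => hij.ne' (m.injective (hinj (Complex.ext h2 ?_)))
    rw [hr x hx _ (hu ▸ mem_range_self _), hr x hx _ (hu ▸ mem_range_self _)]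
  · exact fun x _ w hw h => (hlex x w hw h).isFrame
  · exact fun w hw h j => congrFun (hy.unique (hlex a w hw h)) j
  · exact fun w hw h j => congrFun (hy'.unique (hlex b w hw h)) j

end RealTetragonalCurve

lemma IsPairLabelling.unique {v w : Fin 4 → ℂ} (hv : IsPairLabelling v) (hw : IsPairLabelling w)
    (h : range v = range w) : v = w := by
  have key : ∀ w, IsPairLabelling w → ∀ i j : Fin 4, i < j →
      (w j).im < (w i).im ∨ ((w i).im = (w j).im ∧ (w i).re < (w j).re) := by
    rintro w ⟨h0, h1, h2, h3, h4⟩ i j hij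
    fin_cases i <;> fin_cases j <;> simp_all; left; linarith
  refine eq_of_range_eq_of_order
    (r := fun z z' => z'.im < z.im ∨ (z.im = z'.im ∧ z.re < z'.re)) ?_ ?_ h (key v hv) (key w hw)
  · simp
  · rintro x y z (h1 | h1) (h2 | h2)
    · exact Or.inl (h2.trans h1)
    · exact Or.inl (h2.1 ▸ h1)
    · exact Or.inl (h1.1 ▸ h2)
    · exact Or.inr ⟨h1.1.trans h2.1, h1.2.trans h2.2⟩

lemma IsPairLabelling.isFrame {w : Fin 4 → ℂ} (hw : IsPairLabelling w) : IsFrame w := by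
  obtain ⟨h0, h1, h2, h3, h4⟩ := hw
  intro i j hij he
  fin_cases i <;> fin_cases j <;> simp_all
  linarith

lemma IsPairLabelling.eq_of_isConjugatePair {S : Set ℂ} {y w : Fin 4 → ℂ} (hy : IsLexOrdering S y)
    (hw : range w = S) (hp : IsPairLabelling w) {i : Fin 3} (hi : IsConjugatePair y i) (j : Fin 4) :
    y j = w (pairPerm i j) := by
  obtain ⟨h0, h1, h2, h3, h4⟩ := hp
  have hm : ∀ k, ∃ j, w j = y k := fun k => by
    have : y k ∈ range w := by rw [hw, ← hy.1]; exact mem_range_self k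
    exact this
  choose m hm using hm
  have hinj : Function.Injective m := fun e f hef => hy.injective (by rw [← hm, ← hm, hef])
  have him : ∀ k, (w k).im ≠ 0 → k = 0 ∨ k = 3 := by
    intro k hk
    fin_cases k <;> simp_all
  have hc := hi.1
  have hs : (y i.succ).im = -(y i.castSucc).im := by rw [hi.2, Complex.conj_im]
  have hlt : (y i.succ).im < (y i.castSucc).im := by
    rcases hy.2 _ _ i.castSucc_lt_succ with h | h
    · rw [hi.2, Complex.conj_re] at h
      exact absurd h (lt_irrefl _)
    · exact h.2
  have hmi : m i.castSucc = 0 := by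
    rcases him (m i.castSucc) (by rw [hm]; exact hc) with h | h
    · exact h
    · rw [← hm i.castSucc, h] at hs hlt
      linarith
  have hmi' : m i.succ = 3 := by
    rcases him (m i.succ) (by rw [hm, hs]; exact neg_ne_zero.2 hc) with h | h
    · exact absurd (hinj (hmi.trans h.symm)) i.castSucc_lt_succ.ne
    · exact h
  have hrest : ∀ k l, k < l → k ≠ i.castSucc → k ≠ i.succ → l ≠ i.castSucc → l ≠ i.succ →
      m k = 2 ∧ m l = 1 := by
    intro k l hkl n1 n2 n3 n4
    have hk : m k = 1 ∨ m k = 2 := by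
      have e1 : m k ≠ 0 := fun h => n1 (hinj (h.trans hmi.symm))
      have e2 : m k ≠ 3 := fun h => n2 (hinj (h.trans hmi'.symm))
      revert e1 e2
      generalize m k = e
      revert e
      decide
    have hl : m l = 1 ∨ m l = 2 := by
      have e1 : m l ≠ 0 := fun h => n3 (hinj (h.trans hmi.symm))
      have e2 : m l ≠ 3 := fun h => n4 (hinj (h.trans hmi'.symm))
      revert e1 e2
      generalize m l = e
      revert e
      decide
    have hne : m k ≠ m l := hinj.ne hkl.ne
    have hlex := hy.2 k l hkl
    rw [← hm k, ← hm l] at hlex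
    rcases hk with hk | hk <;> rcases hl with hl | hl
    · exact absurd (hk.trans hl.symm) hne
    · rw [hk, hl, h1, h2] at hlex
      rcases hlex with h | h
      · exact absurd h h4.not_gt
      · exact absurd h.2 (lt_irrefl _)
    · exact ⟨hk, hl⟩
    · exact absurd (hk.trans hl.symm) hne
  rw [← hm j]
  congr 1
  fin_cases i
  · have hr := hrest 2 3 (by decide) (by decide) (by decide) (by decide) (by decide)
    have e0 : m 0 = 0 := hmi
    have e1 : m 1 = 3 := hmi'
    fin_cases j
    exacts [e0, e1, hr.1, hr.2]
  · have hr := hrest 0 3 (by decide) (by decide) (by decide) (by decide) (by decide)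
    have e0 : m 1 = 0 := hmi
    have e1 : m 2 = 3 := hmi'
    fin_cases j
    exacts [hr.1, e0, e1, hr.2]
  · have hr := hrest 0 1 (by decide) (by decide) (by decide) (by decide) (by decide)
    have e0 : m 2 = 0 := hmi
    have e1 : m 3 = 3 := hmi'
    fin_cases j
    exacts [hr.1, hr.2, e0, e1]

namespace RealTetragonalCurve

variable {d : ℕ} {K : RealTetragonalCurve d} {a b s : ℝ} {y y' : Fin 4 → ℂ}
  {ha : ∀ v ∈ K.points a, v.re < s} {hb : ∀ v ∈ K.points b, v.re < s}
  {hy : IsLexOrdering (K.points a) y} {hy' : IsLexOrdering (K.points b) y'}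

theorem hasMonodromy_of_twoReal (hab : a ≤ b) (hns : ∀ x ∈ Icc a b, ¬ K.IsSingularFiber x)
    (hs : ∀ x ∈ Icc a b, ∀ v ∈ K.points x, v.re < s)
    (hr : ∀ x ∈ Icc a b, ∃ w, range w = K.points x ∧ IsPairLabelling w) {i j : Fin 3}
    (hi : IsConjugatePair y i) (hj : IsConjugatePair y' j) :
    HasMonodromy K.points ha hb hy hy' ((pairBraid i)⁻¹ * pairBraid j) := by
  refine hasMonodromy_of_labelling hab hns hs (P := IsPairLabelling) ?_ ?_ hr ?_ (pairPerm i)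
    (pairPerm j) (pairPerm_injective i) ?_ ?_ (pairBraid_inv_mul_subword i j)
  · rintro v ⟨h0, h1, h2, h3, h4⟩
    filter_upwards [eventually_re_lt h4] with w hw hsgn
    have e0 := hsgn 0
    have e1 := hsgn 1
    have e2 := hsgn 2
    have e3 := hsgn 3
    rw [sign_pos h0, sign_eq_one_iff] at e0
    rw [h1, sign_zero, sign_eq_zero_iff] at e1
    rw [h2, sign_zero, sign_eq_zero_iff] at e2
    rw [sign_neg h3, sign_eq_neg_one_iff] at e3
    exact ⟨e0, e1, e2, e3, hw⟩
  · exact fun x _ v w hv hw h h' => h.unique h' (hv.trans hw.symm)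
  · exact fun x _ w _ h => h.isFrame
  · exact fun w hw h => h.eq_of_isConjugatePair hy hw hi
  · exact fun w hw h => h.eq_of_isConjugatePair hy' hw hj

end RealTetragonalCurve

/-! ### Two pairs of conjugate points -/

lemma isLexOrdering_twoPairs {A B D : ℝ} (hA : 0 < A) (hB : 0 < B) (hD : 0 < D) :
    IsLexOrdering (range (twoPairs A B D)) (twoPairs A B D) := by
  refine ⟨rfl, fun i j hij => ?_⟩
  fin_cases i <;> fin_cases j <;> simp_all [twoPairs]

/-- Labels of two pairs of conjugate points with different real parts: the two pairs from the right
to the left, the upper point of each pair first. -/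
def IsSideLabelling (w : Fin 4 → ℂ) : Prop :=
  0 < (w 0).im ∧ (w 1).im < 0 ∧ 0 < (w 2).im ∧ (w 3).im < 0 ∧
    (w 2).re < (w 0).re ∧ (w 2).re < (w 1).re ∧ (w 3).re < (w 0).re ∧ (w 3).re < (w 1).re

/-- Labels by decreasing imaginary parts. -/
def IsHeightLabelling (w : Fin 4 → ℂ) : Prop := ∀ i j : Fin 4, i < j → (w j).im < (w i).im

lemma IsHeightLabelling.unique {v w : Fin 4 → ℂ} (hv : IsHeightLabelling v)
    (hw : IsHeightLabelling w) (h : range v = range w) : v = w :=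
  eq_of_range_eq_of_order (r := fun z z' => z'.im < z.im) (fun _ => lt_irrefl _)
    (fun _ _ _ h1 h2 => h2.trans h1) h hv hw

lemma isHeightLabelling_outer {A B D : ℝ} (hD : 0 < D) (h : D < B) :
    IsHeightLabelling ![⟨A, B⟩, ⟨-A, D⟩, ⟨-A, -D⟩, ⟨A, -B⟩] := by
  intro i j hij
  fin_cases i <;> fin_cases j <;> simp_all <;> linarith

lemma isHeightLabelling_inner {A B D : ℝ} (hB : 0 < B) (h : B < D) :
    IsHeightLabelling ![⟨-A, D⟩, ⟨A, B⟩, ⟨A, -B⟩, ⟨-A, -D⟩] := by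
  intro i j hij
  fin_cases i <;> fin_cases j <;> simp_all <;> linarith

lemma range_outer (A B D : ℝ) :
    range ![(⟨A, B⟩ : ℂ), ⟨-A, D⟩, ⟨-A, -D⟩, ⟨A, -B⟩] = range (twoPairs A B D) := by
  rw [range_four, range_four]
  ext z
  simp only [twoPairs, mem_insert_iff, mem_singleton_iff, Matrix.cons_val]
  tauto

lemma range_inner (A B D : ℝ) :
    range ![(⟨-A, D⟩ : ℂ), ⟨A, B⟩, ⟨A, -B⟩, ⟨-A, -D⟩] = range (twoPairs A B D) := by
  rw [range_four, range_four]
  ext z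
  simp only [twoPairs, mem_insert_iff, mem_singleton_iff, Matrix.cons_val]
  tauto

namespace RealTetragonalCurve

variable {d : ℕ} {K : RealTetragonalCurve d} {x : ℝ}

/-- The fiber over `x` is regular unless all its points have the same real part. -/
def IsRegular (K : RealTetragonalCurve d) (x : ℝ) : Prop :=
  ¬ (K.q.eval x = 0 ∧ 0 < K.b₁.eval x)

namespace IsTwoPairs

variable {A B D : ℝ}

lemma isLexOrdering (h : K.IsTwoPairs x A B D) (hA : 0 < A) :
    IsLexOrdering (K.points x) (twoPairs A B D) :=
  h.2.2.2 ▸ isLexOrdering_twoPairs hA h.2.1 h.2.2.1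

lemma pos_of_isRegular (hx : ¬ K.IsSingularFiber x) (h : K.IsTwoPairs x A B D)
    (hr : K.IsRegular x) : 0 < A := by
  refine h.1.lt_of_ne' fun hA => hr ⟨?_, ?_⟩
  · rw [h.eval_q hx, hA]
    ring
  · have h1 : B ^ 2 - D ^ 2 ≠ 0 := by
      rw [sub_ne_zero]
      exact fun h2 => h.ne_of_eq_zero hx hA ((sq_eq_sq₀ h.2.1.le h.2.2.1.le).1 h2)
    rw [h.eval_b₁ hx, hA]
    have := sq_pos_of_ne_zero h1
    nlinarith

lemma eval_ne_zero_or (hx : ¬ K.IsSingularFiber x) (h : K.IsTwoPairs x A B D) (hr : K.IsRegular x) :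
    K.q.eval x ≠ 0 ∨ K.b₁.eval x < 0 := by
  have hA := h.pos_of_isRegular hx hr
  have hB := h.2.1
  have hD := h.2.2.1
  by_cases hBD : B ^ 2 - D ^ 2 = 0
  · right
    rw [h.eval_b₁ hx, hBD]
    have : 0 < 8 * A ^ 2 * (B ^ 2 + D ^ 2) := by positivity
    linarith
  · left
    rw [h.eval_q hx]
    positivity

lemma ne_of_b₁_pos (hx : ¬ K.IsSingularFiber x) (h : K.IsTwoPairs x A B D)
    (hb : 0 < K.b₁.eval x) : B ≠ D := by
  rintro rfl
  rw [h.eval_b₁ hx] at hb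
  have : 0 ≤ 8 * A ^ 2 * (B ^ 2 + B ^ 2) := by positivity
  linarith

end IsTwoPairs

lemma isLexOrdering_of_isSideLabelling {w : Fin 4 → ℂ} (hw : range w = K.points x)
    (h : IsSideLabelling w) : IsLexOrdering (K.points x) w := by
  obtain ⟨h0, h1, h2, h3, h4, h5, h6, h7⟩ := h
  have hc : ∀ k, ∃ j, w j = (starRingEnd ℂ) (w k) := fun k => by
    have : (starRingEnd ℂ) (w k) ∈ range w := hw ▸ conj_mem_points (hw ▸ mem_range_self k)
    exact this
  have e0 : (w 1).re = (w 0).re := by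
    obtain ⟨j, hj⟩ := hc 0
    have hr := congrArg Complex.re hj
    have hi := congrArg Complex.im hj
    rw [Complex.conj_re] at hr
    rw [Complex.conj_im] at hi
    fin_cases j <;> simp only [Fin.zero_eta, Fin.mk_one, Fin.reduceFinMk, Fin.isValue] at hr hi <;>
      linarith
  have e2 : (w 3).re = (w 2).re := by
    obtain ⟨j, hj⟩ := hc 2
    have hr := congrArg Complex.re hj
    have hi := congrArg Complex.im hj
    rw [Complex.conj_re] at hr
    rw [Complex.conj_im] at hi
    fin_cases j <;> simp only [Fin.zero_eta, Fin.mk_one, Fin.reduceFinMk, Fin.isValue] at hr hi <;>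
      linarith
  refine ⟨hw, fun i j hij => ?_⟩
  fin_cases i <;> fin_cases j <;> simp_all <;> linarith

variable {a b s : ℝ} {y y' : Fin 4 → ℂ}
  {ha : ∀ v ∈ K.points a, v.re < s} {hb : ∀ v ∈ K.points b, v.re < s}
  {hy : IsLexOrdering (K.points a) y} {hy' : IsLexOrdering (K.points b) y'}

theorem hasMonodromy_of_isRegular (hab : a ≤ b) (hns : ∀ x ∈ Icc a b, ¬ K.IsSingularFiber x)
    (hs : ∀ x ∈ Icc a b, ∀ v ∈ K.points x, v.re < s)
    (hr : ∀ x ∈ Icc a b, ∃ A B D, K.IsTwoPairs x A B D) (hreg : ∀ x ∈ Icc a b, K.IsRegular x) :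
    HasMonodromy K.points ha hb hy hy' 1 := by
  refine hasMonodromy_of_labelling hab hns hs (P := IsSideLabelling) ?_ ?_ ?_ ?_ id id
    Function.injective_id ?_ ?_ (fun k => rfl)
  · rintro v ⟨h0, h1, h2, h3, h4, h5, h6, h7⟩
    filter_upwards [eventually_re_lt h4, eventually_re_lt h5, eventually_re_lt h6,
      eventually_re_lt h7] with w g4 g5 g6 g7 hsgn
    have e0 := hsgn 0
    have e1 := hsgn 1
    have e2 := hsgn 2
    have e3 := hsgn 3
    rw [sign_pos h0, sign_eq_one_iff] at e0
    rw [sign_neg h1, sign_eq_neg_one_iff] at e1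
    rw [sign_pos h2, sign_eq_one_iff] at e2
    rw [sign_neg h3, sign_eq_neg_one_iff] at e3
    exact ⟨e0, e1, e2, e3, g4, g5, g6, g7⟩
  · exact fun x _ v w hv hw h h' => (isLexOrdering_of_isSideLabelling hv h).unique
      (isLexOrdering_of_isSideLabelling hw h')
  · intro x hx
    obtain ⟨A, B, D, h⟩ := hr x hx
    have hA := h.pos_of_isRegular (hns x hx) (hreg x hx)
    obtain ⟨-, hB, hD, h⟩ := h
    refine ⟨_, h, ?_⟩
    simp only [IsSideLabelling, twoPairs, Matrix.cons_val]
    refine ⟨hB, ?_, hD, ?_, ?_, ?_, ?_, ?_⟩ <;> linarith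
  · exact fun x _ w hw h => (isLexOrdering_of_isSideLabelling hw h).isFrame
  · exact fun w hw h j => congrFun (hy.unique (isLexOrdering_of_isSideLabelling hw h)) j
  · exact fun w hw h j => congrFun (hy'.unique (isLexOrdering_of_isSideLabelling hw h)) j

theorem hasMonodromy_of_b₁_pos (hab : a ≤ b) (hns : ∀ x ∈ Icc a b, ¬ K.IsSingularFiber x)
    (hs : ∀ x ∈ Icc a b, ∀ v ∈ K.points x, v.re < s)
    (hr : ∀ x ∈ Icc a b, ∃ A B D, K.IsTwoPairs x A B D) (hpos : ∀ x ∈ Icc a b, 0 < K.b₁.eval x)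
    (π π' : Fin 4 → Fin 4) (hπi : Function.Injective π)
    (hπ : ∀ w, range w = K.points a → IsHeightLabelling w → ∀ j, y j = w (π j))
    (hπ' : ∀ w, range w = K.points b → IsHeightLabelling w → ∀ j, y' j = w (π' j)) {β : FreeAut}
    (hβ : ∀ k : Fin 4, β.unop (subword fun j => k ≤ π j) = subword fun j => k ≤ π' j) :
    HasMonodromy K.points ha hb hy hy' β := by
  refine hasMonodromy_of_labelling hab hns hs (P := IsHeightLabelling) ?_ ?_ ?_ ?_ π π' hπi hπ hπ'
    hβ
  · intro v hv
    have : ∀ᶠ w in 𝓝 v, IsHeightLabelling w := by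
      simp only [IsHeightLabelling, eventually_all]
      exact fun i j hij => eventually_im_lt (hv i j hij)
    filter_upwards [this] with w hw _ using hw
  · exact fun x _ v w hv hw h h' => h.unique h' (hv.trans hw.symm)
  · intro x hx
    obtain ⟨A, B, D, h⟩ := hr x hx
    have hne := h.ne_of_b₁_pos (hns x hx) (hpos x hx)
    obtain ⟨-, hB, hD, h⟩ := h
    rcases hne.lt_or_gt with hlt | hlt
    · exact ⟨_, (range_inner A B D).trans h, isHeightLabelling_inner hB hlt⟩
    · exact ⟨_, (range_outer A B D).trans h, isHeightLabelling_outer hD hlt⟩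
  · exact fun x _ w _ h i j hij _ => h i j hij

variable {w : Fin 4 → ℂ}

lemma eq_outerRight (hx : ¬ K.IsSingularFiber x) (hr : ∃ A B D, K.IsTwoPairs x A B D)
    (hq : 0 < K.q.eval x) (hy : IsLexOrdering (K.points x) y) (hw : range w = K.points x)
    (h : IsHeightLabelling w) (j : Fin 4) : y j = w (outerRight j) := by
  obtain ⟨A, B, D, hp⟩ := hr
  have hA := hp.pos_of_isRegular hx fun h => hq.ne' h.1
  rw [hp.eval_q hx] at hq
  have hBD : D < B := by
    have := (pos_iff_pos_of_mul_pos hq).1 (by positivity)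
    exact lt_of_pow_lt_pow_left₀ 2 hp.2.1.le (by linarith)
  rw [hy.unique (hp.isLexOrdering hA), h.unique (isHeightLabelling_outer (A := A) hp.2.2.1 hBD)
    (by rw [hw, range_outer, hp.2.2.2])]
  fin_cases j <;> rfl

lemma eq_outerLeft (hx : ¬ K.IsSingularFiber x) (hr : ∃ A B D, K.IsTwoPairs x A B D)
    (hq : K.q.eval x < 0) (hy : IsLexOrdering (K.points x) y) (hw : range w = K.points x)
    (h : IsHeightLabelling w) (j : Fin 4) : y j = w (outerLeft j) := by
  obtain ⟨A, B, D, hp⟩ := hr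
  have hA := hp.pos_of_isRegular hx fun h => hq.ne h.1
  rw [hp.eval_q hx] at hq
  have hBD : B < D := by
    have : B ^ 2 - D ^ 2 < 0 := by
      by_contra! hc
      have : 0 ≤ 2 * A * (B ^ 2 - D ^ 2) := by positivity
      linarith
    exact lt_of_pow_lt_pow_left₀ 2 hp.2.2.1.le (by linarith)
  rw [hy.unique (hp.isLexOrdering hA), h.unique (isHeightLabelling_inner (A := A) hp.2.1 hBD)
    (by rw [hw, range_inner, hp.2.2.2])]
  fin_cases j <;> rfl

lemma eq_of_not_isRegular (hx : ¬ K.IsSingularFiber x) (hr : ∃ A B D, K.IsTwoPairs x A B D)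
    (hn : ¬ K.IsRegular x) (hy : IsLexOrdering (K.points x) y) (hw : range w = K.points x)
    (h : IsHeightLabelling w) (j : Fin 4) : y j = w j := by
  obtain ⟨A, B, D, hp⟩ := hr
  obtain ⟨hq, hb⟩ := not_not.1 hn
  have hBD := hp.ne_of_b₁_pos hx hb
  have hA : A = 0 := by
    rw [hp.eval_q hx] at hq
    have h1 : B ^ 2 - D ^ 2 ≠ 0 := by
      rw [sub_ne_zero]
      exact fun h2 => hBD ((sq_eq_sq₀ hp.2.1.le hp.2.2.1.le).1 h2)
    rcases mul_eq_zero.1 hq with h2 | h2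
    · linarith
    · exact absurd h2 h1
  have hre : ∀ k, (w k).re = 0 := by
    intro k
    have : w k ∈ range (twoPairs A B D) := by rw [hp.2.2.2, ← hw]; exact mem_range_self k
    obtain ⟨l, hl⟩ := this
    rw [← hl, hA]
    fin_cases l <;> simp [twoPairs]
  have hlex : IsLexOrdering (K.points x) w :=
    ⟨hw, fun i j hij => Or.inr ⟨by rw [hre, hre], h i j hij⟩⟩
  rw [hy.unique hlex]

end RealTetragonalCurve

/-! ### The twist parameter -/

lemma ncard_sep_Icc_add {Q : ℝ → Prop} (hf : {x | Q x}.Finite) {a b c : ℝ} (hab : a ≤ b)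
    (hbc : b ≤ c) (hb : ¬ Q b) : {x ∈ Icc a c | Q x}.ncard =
      {x ∈ Icc a b | Q x}.ncard + {x ∈ Icc b c | Q x}.ncard := by
  rw [← ncard_union_eq _ (hf.subset fun x hx => hx.2) (hf.subset fun x hx => hx.2)]
  · congr 1
    ext x
    simp only [mem_ofPred_eq, mem_union, ← or_and_right, ← Icc_union_Icc_eq_Icc hab hbc]
  · rw [Set.disjoint_left]
    rintro x ⟨h1, h2⟩ ⟨h3, -⟩
    exact hb (le_antisymm h1.2 h3.1 ▸ h2)

lemma pos_of_ne_zero_of_isPreconnected {f : ℝ → ℝ} {t : Set ℝ} (ht : IsPreconnected t)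
    (hf : ContinuousOn f t) (h0 : ∀ x ∈ t, f x ≠ 0) {x z : ℝ} (hx : x ∈ t) (hz : z ∈ t)
    (h : 0 < f x) : 0 < f z := by
  by_contra! hc
  obtain ⟨u, hu, hu0⟩ := ht.intermediate_value hz hx hf ⟨hc, h.le⟩
  exact h0 u hu hu0

lemma eventually_pos_nhdsLT_iff {f : ℝ → ℝ} (hf : Continuous f) {a x : ℝ} (hax : a < x)
    (h0 : ∀ u ∈ Ico a x, f u ≠ 0) : (∀ᶠ u in 𝓝[<] x, 0 < f u) ↔ 0 < f a := by
  constructor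
  · intro h
    obtain ⟨u, hu, hu'⟩ := (h.and (Ico_mem_nhdsLT hax)).exists
    exact pos_of_ne_zero_of_isPreconnected isPreconnected_Ico hf.continuousOn h0 hu'
      (left_mem_Ico.2 hax) hu
  · intro h
    filter_upwards [Ico_mem_nhdsLT hax] with u hu
    exact pos_of_ne_zero_of_isPreconnected isPreconnected_Ico hf.continuousOn h0
      (left_mem_Ico.2 hax) hu h

lemma eventually_pos_nhdsGT_iff {f : ℝ → ℝ} (hf : Continuous f) {b x : ℝ} (hxb : x < b)
    (h0 : ∀ u ∈ Ioc x b, f u ≠ 0) : (∀ᶠ u in 𝓝[>] x, 0 < f u) ↔ 0 < f b := by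
  constructor
  · intro h
    obtain ⟨u, hu, hu'⟩ := (h.and (Ioc_mem_nhdsGT hxb)).exists
    exact pos_of_ne_zero_of_isPreconnected isPreconnected_Ioc hf.continuousOn h0 hu'
      (right_mem_Ioc.2 hxb) hu
  · intro h
    filter_upwards [Ioc_mem_nhdsGT hxb] with u hu
    exact pos_of_ne_zero_of_isPreconnected isPreconnected_Ioc hf.continuousOn h0
      (right_mem_Ioc.2 hxb) hu h

lemma eventually_neg_nhdsLT_iff {f : ℝ → ℝ} (hf : Continuous f) {a x : ℝ} (hax : a < x)
    (h0 : ∀ u ∈ Ico a x, f u ≠ 0) : (∀ᶠ u in 𝓝[<] x, f u < 0) ↔ f a < 0 := by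
  simpa using eventually_pos_nhdsLT_iff hf.neg hax fun u hu => neg_ne_zero.2 (h0 u hu)

lemma eventually_neg_nhdsGT_iff {f : ℝ → ℝ} (hf : Continuous f) {b x : ℝ} (hxb : x < b)
    (h0 : ∀ u ∈ Ioc x b, f u ≠ 0) : (∀ᶠ u in 𝓝[>] x, f u < 0) ↔ f b < 0 := by
  simpa using eventually_pos_nhdsGT_iff hf.neg hxb fun u hu => neg_ne_zero.2 (h0 u hu)

namespace RealTetragonalCurve

variable {d : ℕ} {K : RealTetragonalCurve d} {a b c s x : ℝ}

lemma finite_roots_q (hq : K.q ≠ 0) : {x | K.q.eval x = 0}.Finite := by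
  refine (K.q.roots.toFinset.finite_toSet).subset fun x hx => ?_
  simpa [hq] using hx

lemma twist_add (hq : K.q ≠ 0) (hab : a ≤ b) (hbc : b ≤ c) (hb : K.IsRegular b) :
    K.twist a c = K.twist a b + K.twist b c := by
  have hf := finite_roots_q hq
  unfold twist
  rw [ncard_sep_Icc_add (hf.subset fun x hx => hx.1) hab hbc fun h => hb ⟨h.1, h.2.1⟩,
    ncard_sep_Icc_add (hf.subset fun x hx => hx.1) hab hbc fun h => hb ⟨h.1, h.2.1⟩]
  push_cast
  ring

lemma twist_eq_zero_of_isRegular (h : ∀ x ∈ Icc a b, K.IsRegular x) : K.twist a b = 0 := by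
  unfold twist
  rw [sep_eq_empty_iff_mem_false.2 fun x hx hc => h x hx ⟨hc.1, hc.2.1⟩,
    sep_eq_empty_iff_mem_false.2 fun x hx hc => h x hx ⟨hc.1, hc.2.1⟩]
  simp

lemma twist_eq_zero_of_q_eq_zero (hq : K.q = 0) : K.twist a b = 0 := by
  unfold twist
  simp [hq]

lemma twist_eq_of_unique (hax : a < x) (hxb : x < b) (hx : K.q.eval x = 0)
    (hb : 0 < K.b₁.eval x) (h0 : ∀ u ∈ Icc a b, u ≠ x → K.q.eval u ≠ 0) :
    K.twist a b = ({u | u = x ∧ K.q.eval a < 0 ∧ 0 < K.q.eval b}.ncard : ℤ) -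
      ({u | u = x ∧ 0 < K.q.eval a ∧ K.q.eval b < 0}.ncard : ℤ) := by
  have hl : ∀ u ∈ Ico a x, K.q.eval u ≠ 0 := fun u hu =>
    h0 u ⟨hu.1, (hu.2.trans hxb).le⟩ hu.2.ne
  have hr : ∀ u ∈ Ioc x b, K.q.eval u ≠ 0 := fun u hu =>
    h0 u ⟨(hax.trans hu.1).le, hu.2⟩ hu.1.ne'
  have hc : Continuous fun u => K.q.eval u := K.q.continuous
  have e1 := eventually_pos_nhdsLT_iff hc hax hl
  have e2 := eventually_neg_nhdsLT_iff hc hax hl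
  have e3 := eventually_pos_nhdsGT_iff hc hxb hr
  have e4 := eventually_neg_nhdsGT_iff hc hxb hr
  unfold twist
  congr 3
  · ext u
    constructor
    · rintro ⟨h1, h2, -, h4, h5⟩
      obtain rfl : u = x := by_contra fun h => h0 u h1 h h2
      exact ⟨rfl, e2.1 h4, e3.1 h5⟩
    · rintro ⟨rfl, h4, h5⟩
      exact ⟨⟨hax.le, hxb.le⟩, hx, hb, e2.2 h4, e3.2 h5⟩
  · ext u
    constructor
    · rintro ⟨h1, h2, -, h4, h5⟩
      obtain rfl : u = x := by_contra fun h => h0 u h1 h h2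
      exact ⟨rfl, e1.1 h4, e4.1 h5⟩
    · rintro ⟨rfl, h4, h5⟩
      exact ⟨⟨hax.le, hxb.le⟩, hx, hb, e1.2 h4, e4.2 h5⟩

lemma eventually_ball {Q : ℝ → Prop} (h : ∀ᶠ u in 𝓝 x, Q u) :
    ∃ δ > 0, ∀ u, |u - x| < δ → Q u := by
  obtain ⟨δ, hδ, h⟩ := Metric.eventually_nhds_iff.1 h
  exact ⟨δ, hδ, fun u hu => h (by rwa [Real.dist_eq])⟩

lemma abs_sub_lt_of_mem_Icc {y z u δ : ℝ} (hy : |y - x| < δ) (hz : |z - x| < δ)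
    (hu : u ∈ Icc y z) : |u - x| < δ := by
  rw [abs_lt] at *
  constructor <;> linarith [hu.1, hu.2]

/-- The monodromy along a short segment about a fiber all of whose points have the same real
part. -/
theorem hasMonodromy_tau_zpow_of_unique {y y' : Fin 4 → ℂ}
    {ha : ∀ v ∈ K.points a, v.re < s} {hb : ∀ v ∈ K.points b, v.re < s}
    {hy : IsLexOrdering (K.points a) y} {hy' : IsLexOrdering (K.points b) y'}
    (hns : ∀ x ∈ Icc a b, ¬ K.IsSingularFiber x)
    (hs : ∀ x ∈ Icc a b, ∀ v ∈ K.points x, v.re < s)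
    (hr : ∀ x ∈ Icc a b, ∃ A B D, K.IsTwoPairs x A B D) (hpos : ∀ x ∈ Icc a b, 0 < K.b₁.eval x)
    (hax : a < x) (hxb : x < b) (hx : K.q.eval x = 0)
    (h0 : ∀ u ∈ Icc a b, u ≠ x → K.q.eval u ≠ 0) :
    HasMonodromy K.points ha hb hy hy' (tau ^ K.twist a b) := by
  have hab := (hax.trans hxb).le
  have hA := left_mem_Icc.2 hab
  have hB := right_mem_Icc.2 hab
  rw [twist_eq_of_unique hax hxb hx (hpos x ⟨hax.le, hxb.le⟩) h0]
  rcases (h0 a hA hax.ne).lt_or_gt with h1 | h1 <;> rcases (h0 b hB hxb.ne').lt_or_gt with h2 | h2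
  · refine hasMonodromy_of_b₁_pos hab hns hs hr hpos outerLeft outerLeft outerLeft_injective
      (fun w hw h => eq_outerLeft (hns a hA) (hr a hA) h1 hy hw h)
      (fun w hw h => eq_outerLeft (hns b hB) (hr b hB) h2 hy' hw h) fun k => ?_
    simp [h1, h2, h1.not_gt, h2.not_gt]
  · refine hasMonodromy_of_b₁_pos hab hns hs hr hpos outerLeft outerRight outerLeft_injective
      (fun w hw h => eq_outerLeft (hns a hA) (hr a hA) h1 hy hw h)
      (fun w hw h => eq_outerRight (hns b hB) (hr b hB) h2 hy' hw h) fun k => ?_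
    simp [h1, h2, h1.not_gt, h2.not_gt, tau_subword]
  · refine hasMonodromy_of_b₁_pos hab hns hs hr hpos outerRight outerLeft outerRight_injective
      (fun w hw h => eq_outerRight (hns a hA) (hr a hA) h1 hy hw h)
      (fun w hw h => eq_outerLeft (hns b hB) (hr b hB) h2 hy' hw h) fun k => ?_
    rw [← tau_inv_subword]
    simp [h1, h2, h1.not_gt, h2.not_gt]
  · refine hasMonodromy_of_b₁_pos hab hns hs hr hpos outerRight outerRight outerRight_injective
      (fun w hw h => eq_outerRight (hns a hA) (hr a hA) h1 hy hw h)
      (fun w hw h => eq_outerRight (hns b hB) (hr b hB) h2 hy' hw h) fun k => ?_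
    simp [h1, h2, h1.not_gt, h2.not_gt]

theorem hasMonodromy_tau_zpow {y y' : Fin 4 → ℂ}
    {ha : ∀ v ∈ K.points a, v.re < s} {hb : ∀ v ∈ K.points b, v.re < s}
    (hy : IsLexOrdering (K.points a) y) (hy' : IsLexOrdering (K.points b) y') (hab : a ≤ b)
    (hns : ∀ x ∈ Icc a b, ¬ K.IsSingularFiber x)
    (hs : ∀ x ∈ Icc a b, ∀ v ∈ K.points x, v.re < s)
    (hr : ∀ x ∈ Icc a b, ∃ A B D, K.IsTwoPairs x A B D) (hq : K.q ≠ 0)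
    (hra : K.IsRegular a) (hrb : K.IsRegular b) :
    HasMonodromy K.points ha hb hy hy' (tau ^ K.twist a b) := by
  have hD : Dense {x | K.IsRegular x} := by
    refine (Set.Countable.dense_compl ℝ (finite_roots_q hq).countable).mono fun x hx h => ?_
    exact hx h.1
  have key : ∀ (hx : ∀ v ∈ K.points a, v.re < s) (hz : ∀ v ∈ K.points b, v.re < s)
      (y y' : Fin 4 → ℂ) (hy : IsLexOrdering (K.points a) y) (hy' : IsLexOrdering (K.points b) y'),
      HasMonodromy K.points hx hz hy hy' (tau ^ K.twist a b) := by
    refine rel_of_local (R := fun x z => ∀ (hx : ∀ v ∈ K.points x, v.re < s)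
      (hz : ∀ v ∈ K.points z, v.re < s) (y y' : Fin 4 → ℂ) (hy : IsLexOrdering (K.points x) y)
      (hy' : IsLexOrdering (K.points z) y'),
      HasMonodromy K.points hx hz hy hy' (tau ^ K.twist x z)) hab hD hra hrb ?_ ?_
    · intro x m z _ hm _ hmr hxm hmz h1 h2 hx hz y y' hy hy'
      obtain ⟨A, B, D, hp⟩ := hr m hm
      have hlex := hp.isLexOrdering (hp.pos_of_isRegular (hns m hm) hmr)
      rw [twist_add hq hxm.le hmz.le hmr, zpow_add]
      exact (h1 hx (hs m hm) y _ hy hlex).trans hxm hmz (h2 (hs m hm) hz _ y' hlex hy')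
    · intro x₀ hx₀
      have hregular : ∀ y ∈ Icc a b, ∀ z ∈ Icc a b, y ≤ z →
          (∀ u ∈ Icc y z, K.IsRegular u) → ∀ (hx : ∀ v ∈ K.points y, v.re < s)
          (hz : ∀ v ∈ K.points z, v.re < s) (v v' : Fin 4 → ℂ) (hv : IsLexOrdering (K.points y) v)
          (hv' : IsLexOrdering (K.points z) v'),
          HasMonodromy K.points hx hz hv hv' (tau ^ K.twist y z) := by
        intro y hy z hz hyz hreg _ _ _ _ _ _
        have hsub := Icc_subset_Icc hy.1 hz.2
        rw [twist_eq_zero_of_isRegular hreg, zpow_zero]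
        exact hasMonodromy_of_isRegular hyz (fun u hu => hns u (hsub hu))
          (fun u hu => hs u (hsub hu)) (fun u hu => hr u (hsub hu)) hreg
      by_cases hreg : K.IsRegular x₀
      · obtain ⟨A, B, D, hp⟩ := hr x₀ hx₀
        have hev : ∀ᶠ u in 𝓝 x₀, K.IsRegular u := by
          rcases hp.eval_ne_zero_or (hns x₀ hx₀) hreg with h | h
          · filter_upwards [K.q.continuous.continuousAt.eventually_ne h] with u hu hc
            exact hu hc.1
          · filter_upwards [K.b₁.continuous.continuousAt.eventually_lt_const h] with u hu hc
            exact hc.2.not_gt hu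
        obtain ⟨δ, hδ, hδr⟩ := eventually_ball hev
        exact ⟨δ, hδ, fun y hy z hz _ _ hyδ hzδ hyz => hregular y hy z hz hyz fun u hu =>
          hδr u (abs_sub_lt_of_mem_Icc hyδ hzδ hu)⟩
      · obtain ⟨hq0, hb0⟩ := not_not.1 hreg
        have hev : ∀ᶠ u in 𝓝 x₀, 0 < K.b₁.eval u ∧ (u ≠ x₀ → K.q.eval u ≠ 0) := by
          refine (K.b₁.continuous.continuousAt.eventually_const_lt hb0).and ?_
          have hfin : ({x | K.q.eval x = 0} \ {x₀}).Finite := (finite_roots_q hq).sdiff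
          filter_upwards [hfin.isClosed.isOpen_compl.mem_nhds (by simp : x₀ ∉ _)] with u hu hne h
          exact hu ⟨h, hne⟩
        obtain ⟨δ, hδ, hδr⟩ := eventually_ball hev
        refine ⟨δ, hδ, fun y hy z hz hyr hzr hyδ hzδ hyz => ?_⟩
        have hball : ∀ u ∈ Icc y z, 0 < K.b₁.eval u ∧ (u ≠ x₀ → K.q.eval u ≠ 0) := fun u hu =>
          hδr u (abs_sub_lt_of_mem_Icc hyδ hzδ hu)
        by_cases hmem : x₀ ∈ Icc y z
        · have hsub := Icc_subset_Icc hy.1 hz.2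
          intro _ _ _ _ _ _
          refine hasMonodromy_tau_zpow_of_unique (fun u hu => hns u (hsub hu))
            (fun u hu => hs u (hsub hu)) (fun u hu => hr u (hsub hu)) (fun u hu => (hball u hu).1)
            (hmem.1.lt_of_ne ?_) (hmem.2.lt_of_ne ?_) hq0 fun u hu => (hball u hu).2
          · rintro rfl
            exact hreg hyr
          · rintro rfl
            exact hreg hzr
        · refine hregular y hy z hz hyz fun u hu hc => (hball u hu).2 ?_ hc.1
          rintro rfl
          exact hmem hu
  exact key ha hb y y' hy hy'

theorem hasMonodromy_of_q_eq_zero {y y' : Fin 4 → ℂ}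
    {ha : ∀ v ∈ K.points a, v.re < s} {hb : ∀ v ∈ K.points b, v.re < s}
    {hy : IsLexOrdering (K.points a) y} {hy' : IsLexOrdering (K.points b) y'} (hab : a ≤ b)
    (hns : ∀ x ∈ Icc a b, ¬ K.IsSingularFiber x)
    (hs : ∀ x ∈ Icc a b, ∀ v ∈ K.points x, v.re < s)
    (hr : ∀ x ∈ Icc a b, ∃ A B D, K.IsTwoPairs x A B D) (hq : K.q = 0) :
    HasMonodromy K.points ha hb hy hy' 1 := by
  have hq0 : ∀ x, K.q.eval x = 0 := fun x => by rw [hq, eval_zero]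
  by_cases hex : ∃ x ∈ Icc a b, 0 < K.b₁.eval x
  · obtain ⟨x, hx, hxpos⟩ := hex
    have hne : ∀ u ∈ Icc a b, K.b₁.eval u ≠ 0 := by
      intro u hu h
      obtain ⟨A, B, D, hp⟩ := hr u hu
      rcases hp.eval_ne_zero_or (hns u hu) fun hc => hc.2.ne' h with h' | h'
      · exact h' (hq0 u)
      · exact h'.ne h
    have hpos : ∀ u ∈ Icc a b, 0 < K.b₁.eval u := fun u hu =>
      pos_of_ne_zero_of_isPreconnected isPreconnected_Icc K.b₁.continuous.continuousOn hne hx hu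
        hxpos
    have hA := left_mem_Icc.2 hab
    have hB := right_mem_Icc.2 hab
    exact hasMonodromy_of_b₁_pos hab hns hs hr hpos id id Function.injective_id
      (fun w hw h => eq_of_not_isRegular (hns a hA) (hr a hA)
        (not_not.2 ⟨hq0 a, hpos a hA⟩) hy hw h)
      (fun w hw h => eq_of_not_isRegular (hns b hB) (hr b hB)
        (not_not.2 ⟨hq0 b, hpos b hB⟩) hy' hw h) fun k => rfl
  · exact hasMonodromy_of_isRegular hab hns hs hr fun x hx hc => hex ⟨x, hx, hc.2⟩

end RealTetragonalCurve

end

theorem proposition3 {d : ℕ} (K : RealTetragonalCurve d) (a b s : ℝ) (hab : a ≤ b)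
    (hns : ∀ x ∈ Icc a b, ¬ K.IsSingularFiber x)
    (hs : ∀ x ∈ Icc a b, ∀ z ∈ K.points x, z.re < s)
    (y y' : Fin 4 → ℂ) (hy : IsLexOrdering (K.points a) y) (hy' : IsLexOrdering (K.points b) y') :
    ((∀ x ∈ Icc a b, K.AllReal x) →
      HasMonodromy K.points (hs a (left_mem_Icc.2 hab)) (hs b (right_mem_Icc.2 hab)) hy hy' 1) ∧
    ((¬ ∀ x ∈ Icc a b, K.AllReal x) →
      ((∀ x ∈ Icc a b, K.TwoReal x) ∧
        ∀ i j : Fin 3, IsConjugatePair y i → IsConjugatePair y' j →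
          HasMonodromy K.points (hs a (left_mem_Icc.2 hab)) (hs b (right_mem_Icc.2 hab)) hy hy'
            ((pairBraid i)⁻¹ * pairBraid j)) ∨
      ((∀ x ∈ Icc a b, K.NoneReal x) ∧
        ((K.q = 0 ∨ (¬ (K.q.eval a = 0 ∧ 0 < K.b₁.eval a) ∧
            ¬ (K.q.eval b = 0 ∧ 0 < K.b₁.eval b))) →
          HasMonodromy K.points (hs a (left_mem_Icc.2 hab)) (hs b (right_mem_Icc.2 hab)) hy hy'
            (tau ^ K.twist a b)))) := by
  refine ⟨K.hasMonodromy_of_allReal hab hns hs, fun hnr => ?_⟩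
  push Not at hnr
  obtain ⟨x₀, hx₀, hr₀⟩ := hnr
  have hN : ∀ x ∈ Icc a b, {z ∈ K.points x | z.im = 0}.ncard =
      {z ∈ K.points x₀ | z.im = 0}.ncard := fun x hx => K.ncard_real_eq hns hx hx₀
  rcases K.real_form (hns x₀ hx₀) with ⟨h, -⟩ | ⟨-, h2⟩ | ⟨-, h0⟩
  · exact absurd h hr₀
  · have hpair : ∀ x ∈ Icc a b, ∃ w, range w = K.points x ∧ IsPairLabelling w := by
      intro x hx
      have := (hN x hx).trans h2
      rcases K.real_form (hns x hx) with ⟨-, h⟩ | ⟨h, -⟩ | ⟨-, h⟩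
      · omega
      · exact h
      · omega
    exact Or.inl ⟨fun x hx => (hN x hx).trans h2, fun i j hi hj =>
      K.hasMonodromy_of_twoReal hab hns hs hpair hi hj⟩
  · have htwo : ∀ x ∈ Icc a b, ∃ A B D, K.IsTwoPairs x A B D := by
      intro x hx
      have := (hN x hx).trans h0
      rcases K.real_form (hns x hx) with ⟨-, h⟩ | ⟨-, h⟩ | ⟨h, -⟩
      · omega
      · omega
      · exact h
    refine Or.inr ⟨fun x hx z hz h => ?_, fun h => ?_⟩
    · have hfin : (K.points x).Finite := by
        rw [K.points_eq_roots]
        exact Finset.finite_toSet _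
      have he := (ncard_eq_zero (hfin.subset (sep_subset _ _))).1 ((hN x hx).trans h0)
      exact (he ▸ (⟨hz, h⟩ : z ∈ {z ∈ K.points x | z.im = 0}) : z ∈ (∅ : Set ℂ))
    · by_cases hq : K.q = 0
      · rw [K.twist_eq_zero_of_q_eq_zero hq, zpow_zero]
        exact K.hasMonodromy_of_q_eq_zero hab hns hs htwo hq
      · obtain ⟨h1, h2⟩ := h.resolve_left hq
        exact K.hasMonodromy_tau_zpow hy hy' hab hns hs htwo hq h1 h2
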